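/- **Setting.** Fix $\beta\in\mathbb C\setminus\{0\}$ with a square root $\sqrt\beta$, and put $\sqrt{-\beta}=\sqrt{-1}\,\sqrt\beta$, $\sqrt{-2}=\sqrt{-1}\,\sqrt2$, $\sigma=\frac{1-\beta}{2\sqrt\beta}$. Let $a_n,\chi,\tilde a_n$ ($n\in\mathbb Z$) satisfy $[a_n,a_m]=[\tilde a_n,\tilde a_m]=n\delta_{n+m,0}$, $[a_n,\tilde a_m]=0$, $[a_n,\chi]=\delta_{n,0}$, $[\tilde a_n,\chi]=0$. For $p\in\mathbb C$ they act on the Fock space $\mathcal F=\bigoplus_{c\in\mathbb Z}\mathbb C[a_{-n},\tilde a_{-n}\,(n>0)]\,|c\rangle$, where $a_n,\tilde a_n$ ($n>0$) kill $|c\rangle$, $a_0|c\rangle=c|c\rangle$, $\tilde a_0=p$ and $e^{\pm\chi}|c\rangle=|c\pm1\rangle$. Here $:\ :$ is the bosonic normal ordering (creation modes, then $\chi$, then zero modes, then annihilation modes). Put $$\phi(z)=\chi+a_0\log z-\sum_{n\ne0}\tfrac1n a_nz^{-n},\qquad \tilde\phi'(z)=\sum_n\tilde a_nz^{-n-1},$$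 $$\psi(z)=\tfrac1{\sqrt{-2}}\left(:e^{\phi(z)}:-:e^{-\phi(z)}:\right),\qquad \tilde\psi(z)=\tfrac1{\sqrt2}\left(:e^{\phi(z)}:+:e^{-\phi(z)}:\right),$$ $$T(z)=\tfrac12:\tilde\phi'(z)^2:+\sigma\tilde\phi''(z)+\tfrac12\,{\circ}\psi'(z)\psi(z){\circ},\qquad G(z)=\tilde\phi'(z)\psi(z)+2\sigma\psi'(z),$$ where fermionic modes are defined by $\psi(z)=\sum_{\mu\in\mathbb Z+1/2}\psi_\mu z^{-\mu-1/2}$ (similarly $\tilde\psi$) and ${\circ}\psi_\mu\psi_\nu{\circ}$ equals $\psi_\mu\psi_\nu$ if $\mu\le\nu$ and $-\psi_\nu\psi_\mu$ if $\mu>\nu$. For $x\in\mathbb C$ put $$\mathsf T(x;z)=T(z)+\left(\tfrac{x^2}{\beta}-\tfrac12\right){\circ}\tilde\psi'(z)\tilde\psi(z){\circ}+\tfrac{x}{\sqrt{-\beta}}\,\tilde\psi(z)G(z).$$ For $\hbar\in\mathbb C$ let $q_1=e^\hbar$, $q_2=e^{(\beta-1)\hbar}$, $q_3=e^{-\beta\hbar}$,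 $q=e^{(\beta-1)\hbar/2}$. With $\epsilon_1=1$, $\epsilon_2=-1$ and $n>0$ set $$b_{i,n}=\epsilon_i\tfrac{(1+q_1^n)(1+q_3^n)}{2(1+q_2^{-n})}a_n+\tfrac{\sqrt\beta}2(1-q_1^n)\tilde a_n,\qquad b_{i,-n}=\epsilon_ia_{-n}+\tfrac{1-q_3^n}{\sqrt\beta\,(1+q_2^{-n})}\tilde a_{-n},$$ $$\Lambda_i^{\pm}(z)=\,:\exp\Big(\mp\sum_{n\ne0}\tfrac{q^{\pm n}}n b_{i,n}z^{-n}\Big):\,e^{\pm\epsilon_i\chi}(q^{\mp1}z)^{\pm\epsilon_ia_0}q_1^{\pm\frac{\sqrt\beta}2\tilde a_0},$$ and, for $\xi\ne0$, $$\mathcal T(\xi;z)=q:\Lambda^+_1(\xi z)\Lambda^+_2(z):+q^{-1}:\Lambda^-_1(\xi z)\Lambda^-_2(z):+z^2q(1-q_1\xi)(1-q_3\xi):\Lambda^+_1(\xi z)\Lambda^-_2(z):+z^2q^{-1}(1-q_1^{-1}\xi)(1-q_3^{-1}\xi):\Lambda^-_1(\xi z)\Lambda^+_2(z):.$$ **Proposition.**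 All products and normally ordered expressions above are well defined: each coefficient in $z$ is a sum of operators that is finite on every vector of $\mathcal F$. (1) For every $x\in\mathbb C$ independent of $\hbar$ and $\xi=e^{x\hbar}$, $$\mathcal T(\xi;z)=2+\left(2\beta\,\mathsf T(x;z)\,z^2+\tfrac{(\beta-1)^2}4\right)\hbar^2+O(\hbar^3)\qquad(\hbar\to0),$$ that is, for every $n$, every $v\in\mathcal F$ and every monomial basis vector, the corresponding coordinate of the image of $v$ under the coefficient of $z^n$ in $\mathcal T(e^{x\hbar};z)$ is analytic in $\hbar$ at $0$ and has this expansion. (2) The modes of $\tilde\psi$ satisfy $\tilde\psi_\mu\tilde\psi_\nu+\tilde\psi_\nu\tilde\psi_\mu=\delta_{\mu+\nu,0}$ (the free fermion algebra $\mathsf F$); the modes of $T(z)=\sum L_nz^{-n-2}$, $G(z)=\sum_{\mu\in\mathbb Z+1/2}G_\mu z^{-\mu-3/2}$ satisfy the Neveu–Schwarz super Virasoro relations $$[L_n,L_m]=(n-m)L_{n+m}+\tfrac C{12}(n^3-n)\delta_{n+m,0},\quad [L_n,G_\mu]=(\tfrac n2-\mu)G_{n+\mu},\quad G_\mu G_\nu+G_\nu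 G_\mu=2L_{\mu+\nu}+\tfrac C3(\mu^2-\tfrac14)\delta_{\mu+\nu,0}$$ with $C=\frac32-12\sigma^2$; and $\tilde\psi_\mu$ commutes with all $L_n$ and anticommutes with all $G_\nu$. So $\mathsf T(x;z)$ lies in the algebra $\mathsf F\oplus\mathsf{SVir}$ generated by $\tilde\psi,T,G$. (3) For $(x_1,x_2)=(1,-\beta)$ and for $(x_1,x_2)=(-1,\beta)$, all modes of $\mathsf T(x_1;z)$ commute with all modes of $\mathsf T(x_2;z)$. If moreover $\beta\ne-1$, then the modes (coefficients of $z^{-n-2}$) of $\frac{\beta}{1+\beta}\mathsf T(x_1;z)$ and of $\frac1{1+\beta}\mathsf T(x_2;z)$ satisfy the Virasoro relations with central charges $\frac{(2-\beta)(3\beta-1)}{1+\beta}$ and $\frac{(2\beta-1)(3-\beta)}{\beta(1+\beta)}$ respectively. -/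

import Mathlib

open scoped BigOperators

noncomputable section

namespace QSVir

/-! ### Fock space of the Heisenberg algebra

The two bosons `a` and `ã` are labelled by `false` and `true`.  The basis vector with index `(c, m)`
is `∏ (a_{-(k+1)})^{m (false, k)} ∏ (ã_{-(k+1)})^{m (true, k)} |c⟩`, where `a_0 |c⟩ = c |c⟩` with
`c ∈ ℤ` and `ã_0 |c⟩ = p |c⟩` for a fixed complex number `p`. -/

/-- Labels of the basis: the integer charge and the occupation numbers of the creation modes. -/
abbrev FockIndex : Type := ℤ × ((Bool × ℕ) →₀ ℕ)

/-- The Fock space. -/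
abbrev Fock : Type := FockIndex →₀ ℂ

/-- The basis vector with a given label. -/
def ket (b : FockIndex) : Fock := Finsupp.single b 1

/-- The linear operator with prescribed values on the basis vectors. -/
def ofBasis (f : FockIndex → Fock) : Module.End ℂ Fock := Finsupp.linearCombination ℂ f

/-- The creation operator `a_{-(k+1)}` (or `ã_{-(k+1)}`). -/
def create (s : Bool) (k : ℕ) : Module.End ℂ Fock :=
  ofBasis fun b => ket (b.1, b.2 + Finsupp.single (s, k) 1)

/-- The annihilation operator `a_{k+1}` (or `ã_{k+1}`), acting as `(k+1) ∂/∂a_{-(k+1)}`. -/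
def annihilate (s : Bool) (k : ℕ) : Module.End ℂ Fock :=
  ofBasis fun b =>
    (((k : ℂ) + 1) * (b.2 (s, k) : ℂ)) • ket (b.1, b.2 - Finsupp.single (s, k) 1)

/-- The zero modes: `a_0` is the charge and `ã_0` is the scalar `p`. -/
def zeroMode (p : ℂ) : Bool → Module.End ℂ Fock
  | false => ofBasis fun b => (b.1 : ℂ) • ket b
  | true => p • 1

/-- The modes `a_n` (`s = false`) and `ã_n` (`s = true`), for all `n : ℤ`. -/
def boson (p : ℂ) (s : Bool) : ℤ → Module.End ℂ Fock
  | Int.ofNat 0 => zeroMode p s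
  | Int.ofNat (k + 1) => annihilate s k
  | Int.negSucc k => create s k

/-! ### Operator-valued formal series in `z, z⁻¹` -/

/-- A formal series `A(z) = ∑ A_n z^n` with operator coefficients; `A n` is the coefficient of
`z^n`. -/
abbrev FieldSeries : Type := ℤ → Module.End ℂ Fock

/-- A family of operators whose sum is finite on every vector. -/
def LocallyFiniteSum (f : ℤ → Module.End ℂ Fock) : Prop :=
  ∀ v : Fock, {i : ℤ | f i v ≠ 0}.Finite

/-- The sum of a family of operators that is finite on every vector. -/
def locSum (f : ℤ → Module.End ℂ Fock) : Module.End ℂ Fock :=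
  ofBasis fun b => ∑ᶠ i : ℤ, f i (ket b)

/-- The summands of the coefficient of `z^n` in `A(z) B(z)`. -/
def mulTerm (A B : FieldSeries) (n i : ℤ) : Module.End ℂ Fock := A i * B (n - i)

/-- The product `A(z) B(z)`. -/
def mulField (A B : FieldSeries) : FieldSeries := fun n => locSum (mulTerm A B n)

/-- The product `A(z) B(z)` exists. -/
def MulExists (A B : FieldSeries) : Prop := ∀ n : ℤ, LocallyFiniteSum (mulTerm A B n)

/-- The derivative `A'(z)`. -/
def derivField (A : FieldSeries) : FieldSeries := fun n => ((n : ℂ) + 1) • A (n + 1)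

/-- The constant series `A(z) = 1`. -/
def oneField : FieldSeries := fun n => if n = 0 then 1 else 0

/-- Multiplication by `z²`. -/
def zSq (A : FieldSeries) : FieldSeries := fun n => A (n - 2)

/-! ### Normally ordered exponentials -/

/-- The exponent
`∑_{n ≠ 0} (coeff false n · a_n + coeff true n · ã_n) z^{-n}
  + charge · (χ + a_0 log z) + (log scale) · a_0 + tilde · ã_0`,
where `[a_0, χ] = 1`. The values `coeff _ 0` are not used. -/
structure Exponent where
  coeff : Bool → ℤ → ℂ
  charge : ℤ
  scale : ℂ
  tilde : ℂ

/-- The sum of two exponents, so that `: :e^A: :e^B: : = :e^(A+B):`. -/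
def Exponent.add (E F : Exponent) : Exponent where
  coeff s n := E.coeff s n + F.coeff s n
  charge := E.charge + F.charge
  scale := E.scale * F.scale
  tilde := E.tilde + F.tilde

/-- The exponential `∑_k P^k / k!` of a series `P` without constant term: only the terms with
`k ≤ N` contribute to the coefficient of order `N`. -/
def expSeries (P : PowerSeries (Module.End ℂ Fock)) : PowerSeries (Module.End ℂ Fock) :=
  PowerSeries.mk fun N =>
    ∑ k ∈ Finset.range (N + 1), ((k.factorial : ℂ)⁻¹) • PowerSeries.coeff N (P ^ k)

/-- The creation part of the exponent, as a series in `z`. -/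
def Exponent.creationSeries (E : Exponent) : PowerSeries (Module.End ℂ Fock) :=
  PowerSeries.mk fun
    | 0 => 0
    | k + 1 => ∑ s : Bool, E.coeff s (-((k : ℤ) + 1)) • create s k

/-- The annihilation part of the exponent, as a series in `z⁻¹`. -/
def Exponent.annihilationSeries (E : Exponent) : PowerSeries (Module.End ℂ Fock) :=
  PowerSeries.mk fun
    | 0 => 0
    | k + 1 => ∑ s : Bool, E.coeff s ((k : ℤ) + 1) • annihilate s k

/-- The exponential of the creation part. -/
def Exponent.creationPart (E : Exponent) : FieldSeries
  | Int.ofNat N => PowerSeries.coeff N (expSeries E.creationSeries)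
  | Int.negSucc _ => 0

/-- The exponential of the annihilation part, a series in `z⁻¹`. -/
def Exponent.annihilationPart (E : Exponent) : FieldSeries := fun n =>
  match -n with
  | Int.ofNat N => PowerSeries.coeff N (expSeries E.annihilationSeries)
  | Int.negSucc _ => 0

/-- The zero-mode factor `e^{charge · χ} z^{charge · a_0} scale^{a_0} e^{tilde · ã_0}`. -/
def Exponent.zeroPart (p : ℂ) (E : Exponent) : FieldSeries := fun n =>
  ofBasis fun b =>
    if E.charge * b.1 = n then
      (E.scale ^ b.1 * Complex.exp (E.tilde * p)) • ket (b.1 + E.charge, b.2)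
    else 0

/-- The normally ordered exponential: creation modes, then zero modes (`χ` to the left of `a_0`),
then annihilation modes. -/
def normalExp (p : ℂ) (E : Exponent) : FieldSeries :=
  mulField E.creationPart (mulField (E.zeroPart p) E.annihilationPart)

/-- All sums in the normally ordered exponential of `E` are finite on every vector. -/
def NormalExpExists (p : ℂ) (E : Exponent) : Prop :=
  MulExists (E.zeroPart p) E.annihilationPart ∧
    MulExists E.creationPart (mulField (E.zeroPart p) E.annihilationPart)

/-! ### The undeformed currents -/

/-- The derivative `φ'(z) = ∑ a_n z^{-n-1}` (`s = false`) or `φ̃'(z) = ∑ ã_n z^{-n-1}`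
(`s = true`) of the free bosonic field. -/
def dphi (p : ℂ) (s : Bool) : FieldSeries := fun n => boson p s (-n - 1)

/-- The exponent `k φ(z)`, with `φ(z) = χ + a_0 log z - ∑_{n ≠ 0} a_n z^{-n} / n`. -/
def phiExponent (k : ℤ) : Exponent where
  coeff s n := if s then 0 else -((k : ℂ) / (n : ℂ))
  charge := k
  scale := 1
  tilde := 0

/-- `√2`. -/
def rtTwo : ℂ := ((Real.sqrt 2 : ℝ) : ℂ)

/-- The fermion `ψ(z) = (:e^{φ(z)}: - :e^{-φ(z)}:) / √(-2)`, with `√(-2) = i √2`. -/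
def psi (p : ℂ) : FieldSeries :=
  (Complex.I * rtTwo)⁻¹ • (normalExp p (phiExponent 1) - normalExp p (phiExponent (-1)))

/-- The fermion `ψ̃(z) = (:e^{φ(z)}: + :e^{-φ(z)}:) / √2`. -/
def psit (p : ℂ) : FieldSeries :=
  rtTwo⁻¹ • (normalExp p (phiExponent 1) + normalExp p (phiExponent (-1)))

/-- The mode `A_μ` of `A(z) = ∑_μ A_μ z^{-μ-1/2}`, where `μ = r + 1/2`. -/
def fermiMode (A : FieldSeries) (r : ℤ) : Module.End ℂ Fock := A (-r - 1)

/-- Fermionic normal ordering of `A_μ A_ν` with `μ = r + 1/2`, `ν = t + 1/2`. -/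
def fermiNormal (A : FieldSeries) (r t : ℤ) : Module.End ℂ Fock :=
  if r ≤ t then fermiMode A r * fermiMode A t else -(fermiMode A t * fermiMode A r)

/-- The summands of the coefficient of `z^n` in the normally ordered product of `A'(z)` and `A(z)`,
that is, the terms `(-μ-1/2) A_μ A_ν`, normally ordered, with `-μ-3/2-ν-1/2 = n`. -/
def fermiTerm (A : FieldSeries) (n r : ℤ) : Module.End ℂ Fock :=
  (-((r : ℂ) + 1)) • fermiNormal A r (-n - 3 - r)

/-- The normally ordered product of `A'(z)` and `A(z)` for a fermion `A(z)`. -/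
def fermiBilinear (A : FieldSeries) : FieldSeries := fun n => locSum (fermiTerm A n)

/-- Bosonic normal ordering of `ã_n ã_m`. -/
def bosonNormal (p : ℂ) (n m : ℤ) : Module.End ℂ Fock :=
  if n ≤ m then boson p true n * boson p true m else boson p true m * boson p true n

/-- The summands of the coefficient of `z^n` in `:φ̃'(z)²:`. -/
def bosonTerm (p : ℂ) (n i : ℤ) : Module.End ℂ Fock := bosonNormal p i (-n - 2 - i)

/-- The series `:φ̃'(z)²:`. -/
def bosonSq (p : ℂ) : FieldSeries := fun n => locSum (bosonTerm p n)

/-- The parameter `σ = (1 - β) / (2 √β)`; here and below `rβ` is a square root of `β`. -/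
def sigma (β rβ : ℂ) : ℂ := (1 - β) / (2 * rβ)

/-- `T(z) = ½ :φ̃'(z)²: + σ φ̃''(z) + ½ :ψ'(z) ψ(z):`. -/
def currentT (β rβ p : ℂ) : FieldSeries :=
  (1 / 2 : ℂ) • bosonSq p + sigma β rβ • derivField (dphi p true)
    + (1 / 2 : ℂ) • fermiBilinear (psi p)

/-- `G(z) = φ̃'(z) ψ(z) + 2 σ ψ'(z)`. -/
def currentG (β rβ p : ℂ) : FieldSeries :=
  mulField (dphi p true) (psi p) + (2 * sigma β rβ) • derivField (psi p)

/-- `𝖳(x; z) = T(z) + (x²/β - 1/2) :ψ̃'(z) ψ̃(z): + (x/√(-β)) ψ̃(z) G(z)`, with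
`√(-β) = i √β`. -/
def sfT (β rβ p x : ℂ) : FieldSeries :=
  currentT β rβ p + (x ^ 2 / β - 1 / 2) • fermiBilinear (psit p)
    + (x / (Complex.I * rβ)) • mulField (psit p) (currentG β rβ p)

/-! ### The deformed currents -/

/-- `q = q₂^{1/2} = e^{(β-1)ħ/2}`. -/
def qq (β h : ℂ) : ℂ := Complex.exp ((β - 1) * h / 2)

/-- `q₁ = e^ħ`. -/
def q1 (h : ℂ) : ℂ := Complex.exp h

/-- `q₂ = e^{(β-1)ħ}`. -/
def q2 (β h : ℂ) : ℂ := Complex.exp ((β - 1) * h)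

/-- `q₃ = e^{-βħ}`. -/
def q3 (β h : ℂ) : ℂ := Complex.exp (-(β * h))

/-- For `n ≠ 0`, the coefficient of `a_n` (`s = false`) and of `ã_n` (`s = true`) in the deformed
Heisenberg generator `b_{i,n}`; here `ε = 1` for `i = 1` and `ε = -1` for `i = 2`. -/
def bCoeff (β rβ h : ℂ) (ε : ℤ) (s : Bool) (n : ℤ) : ℂ :=
  if 0 < n then
    if s then rβ / 2 * (1 - q1 h ^ n)
    else (ε : ℂ) * ((1 + q1 h ^ n) * (1 + q3 β h ^ n) / (2 * (1 + q2 β h ^ (-n))))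
  else
    if s then (1 - q3 β h ^ (-n)) / (rβ * (1 + q2 β h ^ n))
    else (ε : ℂ)

/-- The exponent of
`Λ⁺_i(ζz) = :exp(-∑_{n≠0} (q^n/n) b_{i,n} (ζz)^{-n}): e^{χ_i} (q⁻¹ζz)^{b_{i,0}} q₁^{(√β/2) ã_0}`,
with `χ_i = ε χ` and `b_{i,0} = ε a_0`. -/
def lambdaPlus (β rβ h : ℂ) (ε : ℤ) (ζ : ℂ) : Exponent where
  coeff s n := -(qq β h ^ n / (n : ℂ)) * bCoeff β rβ h ε s n * ζ ^ (-n)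
  charge := ε
  scale := ((qq β h)⁻¹ * ζ) ^ ε
  tilde := h * (rβ / 2)

/-- The exponent of
`Λ⁻_i(ζz) = :exp(∑_{n≠0} (q^{-n}/n) b_{i,n} (ζz)^{-n}): e^{-χ_i} (qζz)^{-b_{i,0}} q₁^{-(√β/2) ã_0}`.
-/
def lambdaMinus (β rβ h : ℂ) (ε : ℤ) (ζ : ℂ) : Exponent where
  coeff s n := qq β h ^ (-n) / (n : ℂ) * bCoeff β rβ h ε s n * ζ ^ (-n)
  charge := -ε
  scale := (qq β h * ζ) ^ (-ε)
  tilde := -(h * (rβ / 2))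

/-- The exponent of `:Λ⁺_1(ξz) Λ⁺_2(z):`. -/
def expPP (β rβ h ξ : ℂ) : Exponent :=
  (lambdaPlus β rβ h 1 ξ).add (lambdaPlus β rβ h (-1) 1)

/-- The exponent of `:Λ⁻_1(ξz) Λ⁻_2(z):`. -/
def expMM (β rβ h ξ : ℂ) : Exponent :=
  (lambdaMinus β rβ h 1 ξ).add (lambdaMinus β rβ h (-1) 1)

/-- The exponent of `:Λ⁺_1(ξz) Λ⁻_2(z):`. -/
def expPM (β rβ h ξ : ℂ) : Exponent :=
  (lambdaPlus β rβ h 1 ξ).add (lambdaMinus β rβ h (-1) 1)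

/-- The exponent of `:Λ⁻_1(ξz) Λ⁺_2(z):`. -/
def expMP (β rβ h ξ : ℂ) : Exponent :=
  (lambdaMinus β rβ h 1 ξ).add (lambdaPlus β rβ h (-1) 1)

/-- The current `𝒯(ξ; z)`. -/
def calT (β rβ p h ξ : ℂ) : FieldSeries :=
  qq β h • normalExp p (expPP β rβ h ξ)
    + (qq β h)⁻¹ • normalExp p (expMM β rβ h ξ)
    + zSq ((qq β h * (1 - q1 h * ξ) * (1 - q3 β h * ξ)) • normalExp p (expPM β rβ h ξ))
    + zSq (((qq β h)⁻¹ * (1 - (q1 h)⁻¹ * ξ) * (1 - (q3 β h)⁻¹ * ξ)) •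
        normalExp p (expMP β rβ h ξ))

/-! ### Relations between modes -/

/-- The Virasoro mode `A_n` of `A(z) = ∑ A_n z^{-n-2}`. -/
def virMode (A : FieldSeries) (n : ℤ) : Module.End ℂ Fock := A (-n - 2)

/-- The mode `G_μ` of `G(z) = ∑_μ G_μ z^{-μ-3/2}`, where `μ = r + 1/2`. -/
def superMode (A : FieldSeries) (r : ℤ) : Module.End ℂ Fock := A (-r - 2)

/-- The Virasoro relations with central charge `c`. -/
def IsVirasoro (c : ℂ) (L : ℤ → Module.End ℂ Fock) : Prop :=
  ∀ n m : ℤ, L n * L m - L m * L n = ((n : ℂ) - m) • L (n + m)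
    + (if n + m = 0 then c / 12 * ((n : ℂ) ^ 3 - n) else 0) • (1 : Module.End ℂ Fock)

/-- The relations of the (Neveu-Schwarz) super Virasoro algebra with central charge `C`; `G r`
stands for `G_{r+1/2}`. -/
def IsSuperVirasoro (C : ℂ) (L G : ℤ → Module.End ℂ Fock) : Prop :=
  IsVirasoro C L ∧
  (∀ n r : ℤ, L n * G r - G r * L n = ((n : ℂ) / 2 - ((r : ℂ) + 1 / 2)) • G (n + r)) ∧
  (∀ r t : ℤ, G r * G t + G t * G r = (2 : ℂ) • L (r + t + 1)
    + (if r + t + 1 = 0 then C / 3 * (((r : ℂ) + 1 / 2) ^ 2 - 1 / 4) else 0) •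
        (1 : Module.End ℂ Fock))

/-- The relations of the free fermion algebra; `f r` stands for the mode of index `r + 1/2`. -/
def IsFreeFermion (f : ℤ → Module.End ℂ Fock) : Prop :=
  ∀ r t : ℤ, f r * f t + f t * f r = (if r + t + 1 = 0 then 1 else 0)

end QSVir

end

open scoped BigOperators
noncomputable section
namespace QSVir

-- Everything is reduced to commutators with the bosonic modes and to vacuum matrix elements. The
-- commutator of `a_n` or `ã_n`, `n ≠ 0`, with a coefficient of a normally ordered exponential is a
-- scalar times another coefficient of the same exponential. Moving modes out of the bra and the ket
-- therefore expresses any matrix element through vacuum matrix elements of operators of the same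
-- family. This is `matrix_mem_of_vac`, for operators depending on a parameter and an arbitrary
-- subspace of functions of it. The zero subspace gives identities between operators
-- (`eq_zero_of_vac`); the subspaces of analytic functions and of correct second-order expansions
-- give analyticity and the `ħ`-expansion. Infinite sums are carried by `LocHasSum`, so that their
-- identities are checked term by term.
--
-- On the undeformed side, the equation `∂ :e^{kφ}: = k :φ' e^{kφ}:` determines the two-point
-- functions of vertex operators as expansions of `(z - w)^{kl}` (`two_point`). Hence `:e^{±φ}:` are
-- charged fermions, and the Taylor coefficients of `(z - w) :e^{kφ(z)}: :e^{-kφ(w)}:` along `z = w`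
-- turn fermion bilinears into bosons. The result is `sfT_eq`: with `J = x φ' + √β φ̃'`, the field
-- `2β 𝖳(x; z)` equals `:J²: + (1 - β) J' + (1 + x)(x - β) :e^{2φ}: + (x - 1)(x + β) :e^{-2φ}:`.
--
-- The same expression appears at order `ħ²` of `𝒯`. The terms `Λ⁺Λ⁺` and `Λ⁻Λ⁻` have zero charge
-- and exponents `±ħJ + O(ħ²)`. Their constant parts add to 2, their linear parts cancel, and their
-- quadratic parts give `:J²:`, `J'` and the constant (`jet_normalExp`). The mixed terms have
-- prefactors of order `ħ²`, with leading coefficients `(1 + x)(x - β)` and `(x - 1)(x + β)`, so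
-- only `:e^{±2φ}:` at `ħ = 0` matters.
--
-- For the super Virasoro algebra, `T` is the sum of commuting Virasoro fields of `ã` and of `ψ`,
-- and `[L, G]` is computed term by term. In `[L, L]` of the fermion and in `{G, G}`, the difference
-- of the two sides commutes with `ψ`, `ψ̃` and `ã`, so it is a scalar by a Schur argument
-- (`eq_smul_one_of_comm`), which is read off on `|0⟩`.
--
-- For `x = ±1` and `x = ∓β` only one vertex operator survives in `sfT_eq`, the same for both
-- members of a pair, and the two currents are orthogonal because `x₁x₂ + β = 0`. When `β ≠ -1`, the
-- vertex operator has weight one for each normalized Sugawara field. In general, the identities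
-- behind this close the Virasoro relations (`dressed_comm_dressed`), and the derivative formula for
-- the vertex operator cancels the cross terms (`dressed_comm_of_dot_eq_zero`).

local instance fockEndRing : Ring (Module.End ℂ Fock) := Module.End.instRing

/-! ### Commutators -/

theorem comm_swap (X Y : Module.End ℂ Fock) : ⁅X, Y⁆ = -⁅Y, X⁆ := by simp only [Ring.lie_def]; abel

theorem comm_self (X : Module.End ℂ Fock) : ⁅X, X⁆ = 0 := by simp only [Ring.lie_def]; abel

theorem comm_zero (X : Module.End ℂ Fock) : ⁅X, (0 : Module.End ℂ Fock)⁆ = 0 := by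
  simp [Ring.lie_def]

theorem zero_comm (X : Module.End ℂ Fock) : ⁅(0 : Module.End ℂ Fock), X⁆ = 0 := by
  simp [Ring.lie_def]

theorem comm_one (X : Module.End ℂ Fock) : ⁅X, (1 : Module.End ℂ Fock)⁆ = 0 := by
  simp [Ring.lie_def]

theorem comm_neg (X Y : Module.End ℂ Fock) : ⁅X, -Y⁆ = -⁅X, Y⁆ := by
  simp only [Ring.lie_def]; noncomm_ring

theorem comm_add (X Y Z : Module.End ℂ Fock) : ⁅X, Y + Z⁆ = ⁅X, Y⁆ + ⁅X, Z⁆ := by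
  simp only [Ring.lie_def]; noncomm_ring

theorem comm_sub (X Y Z : Module.End ℂ Fock) : ⁅X, Y - Z⁆ = ⁅X, Y⁆ - ⁅X, Z⁆ := by
  simp only [Ring.lie_def]; noncomm_ring

theorem add_comm_right (X Y Z : Module.End ℂ Fock) : ⁅X + Y, Z⁆ = ⁅X, Z⁆ + ⁅Y, Z⁆ := by
  simp only [Ring.lie_def]; noncomm_ring

theorem sub_comm_right (X Y Z : Module.End ℂ Fock) : ⁅X - Y, Z⁆ = ⁅X, Z⁆ - ⁅Y, Z⁆ := by
  simp only [Ring.lie_def]; noncomm_ring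

theorem comm_smul (a : ℂ) (X Y : Module.End ℂ Fock) :
    ⁅X, a • Y⁆ = a • ⁅X, Y⁆ := by
  simp [Ring.lie_def, smul_sub]

theorem smul_comm_right (a : ℂ) (X Y : Module.End ℂ Fock) :
    ⁅a • X, Y⁆ = a • ⁅X, Y⁆ := by
  simp [Ring.lie_def, smul_sub]

theorem comm_mul (X Y Z : Module.End ℂ Fock) : ⁅X, Y * Z⁆ = ⁅X, Y⁆ * Z + Y * ⁅X, Z⁆ := by
  simp only [Ring.lie_def]; noncomm_ring

theorem mul_comm_right (X Y Z : Module.End ℂ Fock) : ⁅X * Y, Z⁆ = X * ⁅Y, Z⁆ + ⁅X, Z⁆ * Y := by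
  simp only [Ring.lie_def]; noncomm_ring

theorem comm_comm (X Y Z : Module.End ℂ Fock) : ⁅X, ⁅Y, Z⁆⁆ = ⁅⁅X, Y⁆, Z⁆ + ⁅Y, ⁅X, Z⁆⁆ := by
  simp only [Ring.lie_def]; noncomm_ring

theorem mul_eq_of_comm_eq_zero {X Y : Module.End ℂ Fock} (h : ⁅X, Y⁆ = 0) : X * Y = Y * X := by
  rwa [Ring.lie_def, sub_eq_zero] at h

/-! ### Operators on the Fock space -/

theorem ofBasis_ket (f : FockIndex → Fock) (b : FockIndex) : ofBasis f (ket b) = f b := by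
  simp [ofBasis, ket]

theorem op_ext {X Y : Module.End ℂ Fock} (h : ∀ b, X (ket b) = Y (ket b)) : X = Y :=
  Finsupp.lhom_ext' fun b => LinearMap.ext_ring (h b)

theorem ket_apply (b b' : FockIndex) : ket b b' = if b = b' then 1 else 0 := by
  classical
  simp [ket, Finsupp.single_apply]

theorem ket_span (v : Fock) : v = v.sum fun b z => z • ket b := by
  conv_lhs => rw [← Finsupp.sum_single v]
  simp [ket]

theorem create_ket (s : Bool) (k : ℕ) (b : FockIndex) :
    create s k (ket b) = ket (b.1, b.2 + Finsupp.single (s, k) 1) := ofBasis_ket _ _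

theorem annihilate_ket (s : Bool) (k : ℕ) (b : FockIndex) :
    annihilate s k (ket b) =
      (((k : ℂ) + 1) * (b.2 (s, k) : ℂ)) • ket (b.1, b.2 - Finsupp.single (s, k) 1) :=
  ofBasis_ket _ _

theorem annihilate_vac (s : Bool) (k : ℕ) (c : ℤ) : annihilate s k (ket (c, 0)) = 0 := by
  simp [annihilate_ket]

theorem charge_ket (p : ℂ) (b : FockIndex) : zeroMode p false (ket b) = (b.1 : ℂ) • ket b :=
  ofBasis_ket _ _

theorem create_apply_add (s : Bool) (k : ℕ) (u : Fock) (c : ℤ) (m : (Bool × ℕ) →₀ ℕ) :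
    create s k u (c, m + Finsupp.single (s, k) 1) = u (c, m) := by
  induction u using Finsupp.induction_linear with
  | zero => simp
  | add f g hf hg => simp [hf, hg]
  | single b z =>
    have : (Finsupp.single b z : Fock) = z • ket b := by simp [ket]
    rw [this, map_smul, create_ket]
    simp [ket_apply, Prod.ext_iff]

theorem create_apply_of_eq_zero (s : Bool) (k : ℕ) (u : Fock) (b : FockIndex)
    (hb : b.2 (s, k) = 0) : create s k u b = 0 := by
  induction u using Finsupp.induction_linear with
  | zero => simp
  | add f g hf hg => simp [hf, hg]
  | single b' z =>
    have : (Finsupp.single b' z : Fock) = z • ket b' := by simp [ket]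
    rw [this, map_smul, create_ket]
    have h : ¬ ((b'.1, b'.2 + Finsupp.single (s, k) 1) = b) := by
      rintro rfl
      simp at hb
    simp [ket_apply, h]

/-- The factor on the right never vanishes, so every coordinate with an excited label can be
recovered from an annihilated vector. This is what allows excitations to be removed from the bra. -/
theorem annihilate_apply (s : Bool) (k : ℕ) (u : Fock) (c : ℤ) (m : (Bool × ℕ) →₀ ℕ) :
    annihilate s k u (c, m) =
      ((k : ℂ) + 1) * ((m (s, k) : ℂ) + 1) * u (c, m + Finsupp.single (s, k) 1) := by
  classical
  induction u using Finsupp.induction_linear with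
  | zero => simp
  | add f g hf hg => simp [hf, hg, mul_add]
  | single b z =>
    have : (Finsupp.single b z : Fock) = z • ket b := by simp [ket]
    rw [this, map_smul, annihilate_ket]
    obtain ⟨c', m'⟩ := b
    simp only [Finsupp.smul_apply, smul_eq_mul, ket_apply, Prod.mk.injEq]
    by_cases hm : m' = m + Finsupp.single (s, k) 1
    · subst hm
      simp
      split_ifs <;> ring
    · simp only [hm, and_false, if_false, mul_zero]
      by_cases h0 : m' (s, k) = 0
      · simp [h0]
      · rw [if_neg]
        · simp
        · rintro ⟨-, h⟩
          apply hm
          rw [← h]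
          ext x
          by_cases hx : x = (s, k)
          · subst hx; simp; omega
          · simp [Ne.symm hx]

/-! ### The Heisenberg relations -/

theorem boson_succ (p : ℂ) (s : Bool) (k : ℕ) : boson p s ((k : ℤ) + 1) = annihilate s k := rfl

theorem boson_neg_succ (p : ℂ) (s : Bool) (k : ℕ) : boson p s (-((k : ℤ) + 1)) = create s k := by
  have : -((k : ℤ) + 1) = Int.negSucc k := by omega
  rw [this]; rfl

theorem boson_zero (p : ℂ) (s : Bool) : boson p s 0 = zeroMode p s := rfl

theorem exists_eq_succ_of_pos {n : ℤ} (h : 0 < n) : ∃ k : ℕ, n = (k : ℤ) + 1 :=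
  ⟨(n - 1).toNat, by omega⟩

theorem exists_eq_neg_succ_of_neg {n : ℤ} (h : n < 0) : ∃ k : ℕ, n = -((k : ℤ) + 1) :=
  ⟨(-n - 1).toNat, by omega⟩

theorem create_create (s t : Bool) (k l : ℕ) : ⁅create s k, create t l⁆ = 0 := by
  refine op_ext fun b => ?_
  simp [Ring.lie_def, create_ket, add_right_comm]

theorem annihilate_annihilate (s t : Bool) (k l : ℕ) : ⁅annihilate s k, annihilate t l⁆ = 0 := by
  refine op_ext fun b => ?_
  ext ⟨c, m⟩
  simp only [Ring.lie_def, LinearMap.sub_apply, Module.End.mul_apply, Finsupp.sub_apply,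
    annihilate_apply, LinearMap.zero_apply, Finsupp.zero_apply, add_right_comm m]
  by_cases h : (s, k) = (t, l)
  · simp only [Prod.mk.injEq] at h
    obtain ⟨rfl, rfl⟩ := h
    ring
  · simp [h, Ne.symm h]
    ring

theorem annihilate_create (s t : Bool) (k l : ℕ) :
    ⁅annihilate s k, create t l⁆ = if s = t ∧ k = l then ((k : ℂ) + 1) • 1 else 0 := by
  refine op_ext fun b => ?_
  simp only [Ring.lie_def, LinearMap.sub_apply, Module.End.mul_apply, create_ket, annihilate_ket,
    map_smul]
  by_cases h : (s, k) = (t, l)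
  · simp only [Prod.mk.injEq] at h
    obtain ⟨rfl, rfl⟩ := h
    by_cases h0 : b.2 (s, k) = 0
    · simp [h0]
    · have : b.2 - Finsupp.single (s, k) 1 + Finsupp.single (s, k) 1 = b.2 := by
        refine tsub_add_cancel_of_le ?_
        simpa [Nat.one_le_iff_ne_zero] using h0
      simp only [this, Finsupp.add_apply, Finsupp.single_eq_same, add_tsub_cancel_right, ← sub_smul,
        and_self, if_true, LinearMap.smul_apply, Module.End.one_apply]
      congr 1
      push_cast
      ring
  · have h' : ¬ (s = t ∧ k = l) := by simpa using h
    have : b.2 + Finsupp.single (t, l) 1 - Finsupp.single (s, k) 1 =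
        b.2 - Finsupp.single (s, k) 1 + Finsupp.single (t, l) 1 := by
      ext x
      by_cases hx : x = (s, k)
      · subst hx
        simp [Ne.symm h]
      · simp [Ne.symm hx]
    simp [h', this]

theorem charge_create (p : ℂ) (s : Bool) (k : ℕ) : ⁅zeroMode p false, create s k⁆ = 0 := by
  refine op_ext fun b => ?_
  simp only [Ring.lie_def, LinearMap.sub_apply, Module.End.mul_apply, create_ket, charge_ket,
    map_smul, sub_self, LinearMap.zero_apply]

theorem charge_annihilate (p : ℂ) (s : Bool) (k : ℕ) : ⁅zeroMode p false, annihilate s k⁆ = 0 := by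
  refine op_ext fun b => ?_
  simp only [Ring.lie_def, LinearMap.sub_apply, Module.End.mul_apply, annihilate_ket, charge_ket,
    map_smul, LinearMap.zero_apply]
  rw [smul_comm, sub_self]

theorem zero_lie_boson (p : ℂ) (s t : Bool) (n : ℤ) : ⁅boson p s 0, boson p t n⁆ = 0 := by
  cases s with
  | true => simp [boson_zero, zeroMode, Ring.lie_def]
  | false =>
    rcases lt_trichotomy n 0 with h | h | h
    · obtain ⟨k, rfl⟩ := exists_eq_neg_succ_of_neg h
      rw [boson_neg_succ, boson_zero, charge_create]
    · subst h
      cases t with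
      | true => simp [boson_zero, zeroMode, Ring.lie_def]
      | false => exact comm_self _
    · obtain ⟨k, rfl⟩ := exists_eq_succ_of_pos h
      rw [boson_succ, boson_zero, charge_annihilate]

theorem boson_lie_boson (p : ℂ) (s t : Bool) (n m : ℤ) :
    ⁅boson p s n, boson p t m⁆ = if s = t ∧ n + m = 0 then (n : ℂ) • 1 else 0 := by
  rcases eq_or_ne n 0 with rfl | hn
  · rw [zero_lie_boson]; simp
  rcases eq_or_ne m 0 with rfl | hm
  · rw [comm_swap, zero_lie_boson]; simp [hn]
  rcases lt_or_gt_of_ne hn with hn | hn <;> rcases lt_or_gt_of_ne hm with hm | hm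
  · obtain ⟨k, rfl⟩ := exists_eq_neg_succ_of_neg hn
    obtain ⟨l, rfl⟩ := exists_eq_neg_succ_of_neg hm
    rw [boson_neg_succ, boson_neg_succ, create_create, if_neg]
    omega
  · obtain ⟨k, rfl⟩ := exists_eq_neg_succ_of_neg hn
    obtain ⟨l, rfl⟩ := exists_eq_succ_of_pos hm
    rw [comm_swap, boson_neg_succ, boson_succ, annihilate_create]
    by_cases h : t = s ∧ l = k
    · obtain ⟨rfl, rfl⟩ := h
      rw [if_pos ⟨rfl, rfl⟩, if_pos ⟨rfl, by omega⟩]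
      push_cast
      module
    · rw [if_neg h, if_neg, neg_zero]
      rintro ⟨rfl, h2⟩
      exact h ⟨rfl, by omega⟩
  · obtain ⟨k, rfl⟩ := exists_eq_succ_of_pos hn
    obtain ⟨l, rfl⟩ := exists_eq_neg_succ_of_neg hm
    rw [boson_neg_succ, boson_succ, annihilate_create]
    by_cases h : s = t ∧ k = l
    · obtain ⟨rfl, rfl⟩ := h
      simp
    · rw [if_neg h, if_neg]
      rintro ⟨rfl, h2⟩
      exact h ⟨rfl, by omega⟩
  · obtain ⟨k, rfl⟩ := exists_eq_succ_of_pos hn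
    obtain ⟨l, rfl⟩ := exists_eq_succ_of_pos hm
    rw [boson_succ, boson_succ, annihilate_annihilate, if_neg]
    omega

/-! ### Operators are determined by commutators and vacuum matrix elements -/

theorem exists_add_single_of_ne_zero {m : (Bool × ℕ) →₀ ℕ} (h : m ≠ 0) :
    ∃ s k m', m = m' + Finsupp.single (s, k) 1 := by
  obtain ⟨⟨s, k⟩, hx⟩ := Finsupp.ne_iff.1 h
  refine ⟨s, k, m - Finsupp.single (s, k) 1, (tsub_add_cancel_of_le ?_).symm⟩
  simpa [Nat.one_le_iff_ne_zero] using hx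

/-- Matrix elements, as functions of a parameter, lie in a given submodule if this holds for the
vacuum matrix elements of a family that is closed under commutators with the bosonic modes. -/
theorem matrix_mem_of_vac {Θ : Type*} (p : ℂ) (I : Submodule ℂ (Θ → ℂ))
    (V : Set (Θ → Module.End ℂ Fock))
    (hV : ∀ X ∈ V, ∀ (s : Bool) (n : ℤ), n ≠ 0 → (fun θ => ⁅boson p s n, X θ⁆) ∈ V)
    (hvac : ∀ X ∈ V, ∀ c c' : ℤ, (fun θ => X θ (ket (c, 0)) (c', 0)) ∈ I)
    (X : Θ → Module.End ℂ Fock) (hX : X ∈ V) (b b' : FockIndex) :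
    (fun θ => X θ (ket b) b') ∈ I := by
  -- The induction is on the total number of excitations in ket and bra, for all members of `V` at
  -- once, because each step replaces `X` by a commutator.
  suffices H : ∀ N : ℕ, ∀ m m' : (Bool × ℕ) →₀ ℕ, m.degree + m'.degree = N → ∀ X ∈ V,
      ∀ c c' : ℤ, (fun θ => X θ (ket (c, m)) (c', m')) ∈ I from
    H _ b.2 b'.2 rfl X hX b.1 b'.1
  intro N
  induction N using Nat.strong_induction_on with
  | _ N ih =>
    intro m m' h X hX c c'
    by_cases hm : m = 0
    · subst hm
      by_cases hm' : m' = 0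
      · subst hm'
        exact hvac X hX c c'
      obtain ⟨s, k, m', rfl⟩ := exists_add_single_of_ne_zero hm'
      -- Only the bra is excited. Since annihilation operators kill the vacuum, the annihilated
      -- image of `X |c⟩` is a commutator applied to `|c⟩`.
      have h1 := ih m'.degree (by simp at h; omega) 0 m' (by simp) _
        (hV X hX s ((k : ℤ) + 1) (by omega)) c c'
      convert I.smul_mem ((((k : ℂ) + 1) * ((m' (s, k) : ℂ) + 1))⁻¹) h1 using 1
      funext θ
      have h2 : ((k : ℂ) + 1) * ((m' (s, k) : ℂ) + 1) ≠ 0 :=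
        mul_ne_zero (Nat.cast_add_one_ne_zero k) (Nat.cast_add_one_ne_zero _)
      simp only [boson_succ, Ring.lie_def, LinearMap.sub_apply, Module.End.mul_apply,
        annihilate_vac, map_zero, sub_zero, annihilate_apply, Pi.smul_apply, smul_eq_mul]
      rw [inv_mul_cancel_left₀ h2]
    · obtain ⟨s, k, m, rfl⟩ := exists_add_single_of_ne_zero hm
      have h1 := ih (m.degree + m'.degree) (by simp at h; omega) m m' rfl _
        (hV X hX s (-((k : ℤ) + 1)) (by omega)) c c'
      -- An excitation of the ket is moved to the left of `X`. There the creation operator either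
      -- gives zero or removes an excitation of the bra, so the total degree drops in both terms.
      have key : ∀ θ, X θ (ket (c, m + Finsupp.single (s, k) 1)) (c', m') =
          create s k (X θ (ket (c, m))) (c', m') -
            ⁅boson p s (-((k : ℤ) + 1)), X θ⁆ (ket (c, m)) (c', m') := by
        intro θ
        simp only [boson_neg_succ, Ring.lie_def, create_ket, LinearMap.sub_apply,
          Module.End.mul_apply, Finsupp.sub_apply, sub_sub_cancel]
      simp only [key]
      refine I.sub_mem ?_ h1
      by_cases h0 : m' (s, k) = 0
      · simp only [create_apply_of_eq_zero s k _ (c', m') h0]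
        exact I.zero_mem
      · obtain ⟨m', rfl⟩ : ∃ m'', m' = m'' + Finsupp.single (s, k) 1 := by
          refine ⟨m' - Finsupp.single (s, k) 1, (tsub_add_cancel_of_le ?_).symm⟩
          simpa [Nat.one_le_iff_ne_zero] using h0
        simp only [create_apply_add]
        exact ih (m.degree + m'.degree) (by simp at h; omega) m m' rfl X hX c c'

/-- A family of operators closed under commutators with the bosonic modes vanishes if its vacuum
matrix elements do. -/
theorem eq_zero_of_vac {ι : Type*} (p : ℂ) (X : ι → Module.End ℂ Fock)
    (hX : ∀ i (s : Bool) (n : ℤ), n ≠ 0 → ⁅boson p s n, X i⁆ ∈ Submodule.span ℂ (Set.range X))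
    (hvac : ∀ i, ∀ c c' : ℤ, X i (ket (c, 0)) (c', 0) = 0) (i : ι) : X i = 0 := by
  refine op_ext fun b => Finsupp.ext fun b' => ?_
  -- With a one-point parameter space and the zero subspace, membership means vanishing. The closed
  -- family is the linear span of the given operators.
  have h := matrix_mem_of_vac (Θ := Unit) p ⊥
    {Y | Y () ∈ Submodule.span ℂ (Set.range X)} ?_ ?_ (fun _ => X i)
    (Submodule.subset_span ⟨i, rfl⟩) b b'
  · simpa using congrFun ((Submodule.mem_bot ℂ).1 h) ()
  · intro Y hY s n hn
    simp only [Set.mem_ofPred_eq] at hY ⊢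
    generalize Y () = Z at hY
    induction hY using Submodule.span_induction with
    | mem x h =>
      obtain ⟨i, rfl⟩ := h
      exact hX i s n hn
    | zero => simp [comm_zero]
    | add x y _ _ hx hy => rw [comm_add]; exact Submodule.add_mem _ hx hy
    | smul a x _ hx => rw [comm_smul]; exact Submodule.smul_mem _ a hx
  · intro Y hY c c'
    simp only [Set.mem_ofPred_eq] at hY
    rw [Submodule.mem_bot]
    funext u
    simp only [Pi.zero_apply]
    generalize Y () = Z at hY
    induction hY using Submodule.span_induction with
    | mem x h =>
      obtain ⟨i, rfl⟩ := h
      exact hvac i c c'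
    | zero => simp
    | add x y _ _ hx hy => simp [hx, hy]
    | smul a x _ hx => simp [hx]

/-- An operator commuting with all bosonic modes vanishes if its vacuum matrix elements do. -/
theorem eq_zero_of_comm_of_vac (p : ℂ) (X : Module.End ℂ Fock)
    (hX : ∀ (s : Bool) (n : ℤ), n ≠ 0 → ⁅boson p s n, X⁆ = 0)
    (hvac : ∀ c c' : ℤ, X (ket (c, 0)) (c', 0) = 0) : X = 0 :=
  eq_zero_of_vac p (fun _ : Unit => X) (fun _ s n hn => by rw [hX s n hn]; exact zero_mem _)
    (fun _ => hvac) ()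

/-- A vector killed by all annihilation operators has only vacuum components. -/
theorem apply_eq_zero_of_annihilate {u : Fock} (hu : ∀ s k, annihilate s k u = 0) (c : ℤ)
    {m : (Bool × ℕ) →₀ ℕ} (hm : m ≠ 0) : u (c, m) = 0 := by
  obtain ⟨s, k, m, rfl⟩ := exists_add_single_of_ne_zero hm
  have h := annihilate_apply s k u c m
  rw [hu, Finsupp.zero_apply] at h
  have h2 : ((k : ℂ) + 1) * ((m (s, k) : ℂ) + 1) ≠ 0 :=
    mul_ne_zero (Nat.cast_add_one_ne_zero k) (Nat.cast_add_one_ne_zero _)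
  exact (mul_eq_zero.1 h.symm).resolve_left h2

/-- The modes of negative index have no vacuum component. -/
theorem boson_neg_apply_vac (p : ℂ) (s : Bool) {n : ℤ} (hn : n < 0) (u : Fock) (c : ℤ) :
    boson p s n u (c, 0) = 0 := by
  obtain ⟨k, rfl⟩ := exists_eq_neg_succ_of_neg hn
  rw [boson_neg_succ]
  exact create_apply_of_eq_zero s k u (c, 0) rfl

theorem boson_pos_vac (p : ℂ) (s : Bool) {n : ℤ} (hn : 0 < n) (c : ℤ) :
    boson p s n (ket (c, 0)) = 0 := by
  obtain ⟨k, rfl⟩ := exists_eq_succ_of_pos hn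
  rw [boson_succ, annihilate_vac]

theorem charge_apply (p : ℂ) (u : Fock) (b : FockIndex) :
    boson p false 0 u b = (b.1 : ℂ) * u b := by
  rw [boson_zero]
  induction u using Finsupp.induction_linear with
  | zero => simp
  | add f g hf hg => simp [hf, hg, mul_add]
  | single b' z =>
    have : (Finsupp.single b' z : Fock) = z • ket b' := by simp [ket]
    rw [this, map_smul, charge_ket]
    by_cases h : b' = b
    · subst h; simp [ket_apply]; ring
    · simp [ket_apply, h]

/-- An operator of charge `q` only changes the charge by `q`. -/
theorem apply_eq_zero_of_charge {p : ℂ} {X : Module.End ℂ Fock} {q : ℤ}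
    (h : ⁅boson p false 0, X⁆ = (q : ℂ) • X) {b b' : FockIndex} (hb : b'.1 ≠ b.1 + q) :
    X (ket b) b' = 0 := by
  have h1 := congrArg (fun Y : Module.End ℂ Fock => Y (ket b) b') h
  simp only [Ring.lie_def, LinearMap.sub_apply, Module.End.mul_apply, Finsupp.sub_apply,
    boson_zero, charge_ket, map_smul, Finsupp.smul_apply, smul_eq_mul,
    LinearMap.smul_apply] at h1
  rw [← boson_zero, charge_apply] at h1
  have h2 : ((b'.1 : ℂ) - b.1 - q) * X (ket b) b' = 0 := by linear_combination h1
  refine (mul_eq_zero.1 h2).resolve_left fun h3 => hb ?_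
  have h4 : ((b'.1 : ℤ) : ℂ) = ((b.1 + q : ℤ) : ℂ) := by push_cast; linear_combination h3
  exact_mod_cast h4

/-! ### Sums of operators that are finite on every vector -/

/-- The family `f` is finite on every vector and its sum is `X`. -/
def LocHasSum {ι : Type*} (f : ι → Module.End ℂ Fock) (X : Module.End ℂ Fock) : Prop :=
  ∀ v, (Function.support fun i => f i v).Finite ∧ ∑ᶠ i, f i v = X v

theorem locHasSum_ofBasis {ι : Type*} {f : ι → Module.End ℂ Fock}
    (h : ∀ v, (Function.support fun i => f i v).Finite) :
    LocHasSum f (ofBasis fun b => ∑ᶠ i, f i (ket b)) := by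
  intro v
  refine ⟨h v, ?_⟩
  induction v using Finsupp.induction_linear with
  | zero => simp
  | add u w hu hw =>
    simp only [map_add]
    rw [finsum_add_distrib (h u) (h w), hu, hw]
  | single b z =>
    have : (Finsupp.single b z : Fock) = z • ket b := by simp [ket]
    rw [this]
    simp only [map_smul]
    rw [← smul_finsum' z (h (ket b)), ofBasis_ket]

theorem LocallyFiniteSum.locHasSum {f : ℤ → Module.End ℂ Fock} (h : LocallyFiniteSum f) :
    LocHasSum f (locSum f) := locHasSum_ofBasis h

namespace LocHasSum

variable {ι κ : Type*} {f g : ι → Module.End ℂ Fock} {X Y : Module.End ℂ Fock}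

/-- The main device for operator identities: two expressions are equal once both are sums of the
same locally finite family. -/
theorem unique (h : LocHasSum f X) (h' : LocHasSum f Y) : X = Y :=
  LinearMap.ext fun v => (h v).2.symm.trans (h' v).2

theorem congr (h : LocHasSum f X) (hfg : ∀ i, f i = g i) : LocHasSum g X :=
  (funext hfg : f = g) ▸ h

theorem add (h : LocHasSum f X) (h' : LocHasSum g Y) : LocHasSum (fun i => f i + g i) (X + Y) := by
  intro v
  refine ⟨((h v).1.union (h' v).1).subset fun i hi => ?_, ?_⟩
  · by_contra hc
    simp only [Set.mem_union, Function.mem_support, not_or, not_not] at hc hi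
    exact hi (by simp [hc.1, hc.2])
  · simp only [LinearMap.add_apply]
    rw [finsum_add_distrib (h v).1 (h' v).1, (h v).2, (h' v).2]

theorem mul_left (h : LocHasSum f X) (A : Module.End ℂ Fock) :
    LocHasSum (fun i => A * f i) (A * X) := by
  intro v
  refine ⟨(h v).1.subset fun i hi hc => hi (by simp [hc]), ?_⟩
  simp only [Module.End.mul_apply]
  rw [← (h v).2]
  exact ((A : Fock →+ Fock).map_finsum (h v).1).symm

theorem mul_right (h : LocHasSum f X) (A : Module.End ℂ Fock) :
    LocHasSum (fun i => f i * A) (X * A) := fun v => h (A v)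

theorem smul (h : LocHasSum f X) (a : ℂ) : LocHasSum (fun i => a • f i) (a • X) := by
  simpa [smul_mul_assoc] using h.mul_left (a • 1)

theorem neg (h : LocHasSum f X) : LocHasSum (fun i => -f i) (-X) := by
  simpa using h.smul (-1)

theorem sub (h : LocHasSum f X) (h' : LocHasSum g Y) : LocHasSum (fun i => f i - g i) (X - Y) := by
  simpa [sub_eq_add_neg] using h.add h'.neg

theorem comm_left (h : LocHasSum f X) (A : Module.End ℂ Fock) :
    LocHasSum (fun i => ⁅A, f i⁆) ⁅A, X⁆ := by
  simp only [Ring.lie_def]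
  exact (h.mul_left A).sub (h.mul_right A)

theorem comm_right (h : LocHasSum f X) (A : Module.End ℂ Fock) :
    LocHasSum (fun i => ⁅f i, A⁆) ⁅X, A⁆ := by
  simp only [Ring.lie_def]
  exact (h.mul_right A).sub (h.mul_left A)

theorem reindex (h : LocHasSum f X) (e : κ ≃ ι) : LocHasSum (fun i => f (e i)) X := by
  intro v
  refine ⟨((h v).1.preimage e.injective.injOn).subset fun i hi => hi, ?_⟩
  rw [← (h v).2]
  exact finsum_comp_equiv e (f := fun i => f i v)

theorem shift {f : ℤ → Module.End ℂ Fock} (h : LocHasSum f X) (n : ℤ) :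
    LocHasSum (fun i => f (i + n)) X := h.reindex (Equiv.addRight n)

theorem reflect {f : ℤ → Module.End ℂ Fock} (h : LocHasSum f X) (n : ℤ) :
    LocHasSum (fun i => f (n - i)) X := h.reindex (Equiv.subLeft n)

theorem of_finset (s : Finset ι) (h : ∀ i ∉ s, f i = 0) : LocHasSum f (∑ i ∈ s, f i) := by
  intro v
  have hs : (Function.support fun i => f i v) ⊆ s := by
    intro i hi
    by_contra hc
    exact hi (by simp [h i hc])
  refine ⟨s.finite_toSet.subset hs, ?_⟩
  rw [finsum_eq_sum_of_support_subset _ hs, LinearMap.sum_apply]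

theorem single (i : ι) (h : ∀ j, j ≠ i → f j = 0) : LocHasSum f (f i) := by
  have := of_finset (f := f) {i} (fun j hj => h j (by simpa using hj))
  simpa using this

theorem zero : LocHasSum (fun _ : ι => 0) 0 := by
  simpa using of_finset (f := fun _ : ι => (0 : Module.End ℂ Fock)) ∅ (fun _ _ => rfl)

/-- Writes an isolated operator as a locally finite sum, so that contraction terms can be included
in a termwise comparison. -/
theorem ite_eq [DecidableEq ι] (i : ι) (Z : ι → Module.End ℂ Fock) :
    LocHasSum (fun j => if j = i then Z j else 0) (Z i) := by
  have := single (f := fun j => if j = i then Z j else 0) i (fun j hj => if_neg hj)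
  simpa using this

theorem apply_eq_sum (h : LocHasSum f X) (v : Fock) (s : Finset ι) (hs : ∀ i ∉ s, f i v = 0) :
    X v = ∑ i ∈ s, f i v := by
  rw [← (h v).2]
  refine finsum_eq_sum_of_support_subset _ fun i hi => ?_
  by_contra hc
  exact hi (hs i hc)

theorem apply_eq_single (h : LocHasSum f X) (v : Fock) (i : ι) (hs : ∀ j, j ≠ i → f j v = 0) :
    X v = f i v := by
  rw [h.apply_eq_sum v {i} (fun j hj => hs j (by simpa using hj)), Finset.sum_singleton]

theorem apply_eq_zero (h : LocHasSum f X) (v : Fock) (hs : ∀ j, f j v = 0) : X v = 0 := by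
  rw [h.apply_eq_sum v ∅ (fun j _ => hs j), Finset.sum_empty]

/-- Coordinates of the sum. -/
theorem coord_eq_sum (h : LocHasSum f X) (v : Fock) (b : FockIndex) (s : Finset ι)
    (hs : ∀ i ∉ s, f i v b = 0) : X v b = ∑ i ∈ s, f i v b := by
  classical
  -- Outside `s` only this one coordinate vanishes, so `s` is enlarged by the support of the family
  -- on `v`; the added terms do not contribute.
  rw [h.apply_eq_sum v (s ∪ (h v).1.toFinset) ?_, Finsupp.finsetSum_apply]
  · refine (Finset.sum_subset Finset.subset_union_left fun i _ hi => hs i hi).symm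
  · intro i hi
    simp only [Finset.mem_union, Set.Finite.mem_toFinset, Function.mem_support, not_or,
      not_not] at hi
    exact hi.2

theorem coord_eq_single (h : LocHasSum f X) (v : Fock) (b : FockIndex) (i : ι)
    (hs : ∀ j, j ≠ i → f j v b = 0) : X v b = f i v b := by
  rw [h.coord_eq_sum v b {i} (fun j hj => hs j (by simpa using hj)), Finset.sum_singleton]

theorem coord_eq_zero (h : LocHasSum f X) (v : Fock) (b : FockIndex) (hs : ∀ j, f j v b = 0) :
    X v b = 0 := by
  rw [h.coord_eq_sum v b ∅ (fun j _ => hs j), Finset.sum_empty]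

/-- Iterated sums. -/
theorem curry {F : ι × κ → Module.End ℂ Fock} {G : ι → Module.End ℂ Fock} (h : LocHasSum F X)
    (hG : ∀ i, LocHasSum (fun j => F (i, j)) (G i)) : LocHasSum G X := by
  intro v
  refine ⟨((h v).1.image Prod.fst).subset fun i hi => ?_, ?_⟩
  · by_contra hc
    refine hi ((hG i).apply_eq_zero v fun j => ?_)
    by_contra hj
    exact hc ⟨(i, j), hj, rfl⟩
  · rw [← (h v).2, finsum_curry _ (h v).1]
    exact finsum_congr fun i => (hG i v).2.symm

theorem locSum_eq {f : ℤ → Module.End ℂ Fock} (h : LocHasSum f X) : locSum f = X :=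
  LocHasSum.unique (LocallyFiniteSum.locHasSum fun v => (h v).1) h

end LocHasSum

theorem finite_of_bounds {P : ℤ → Prop} (N M : ℤ) (h1 : ∀ i, i < N → ¬ P i)
    (h2 : ∀ i, M < i → ¬ P i) : {i | P i}.Finite :=
  (Set.finite_Icc N M).subset fun i hi =>
    ⟨not_lt.1 fun h => h1 i h hi, not_lt.1 fun h => h2 i h hi⟩

theorem locallyFiniteSum_of_bounds {f : ℤ → Module.End ℂ Fock}
    (h1 : ∀ v, ∃ N, ∀ i, i < N → f i v = 0) (h2 : ∀ v, ∃ M, ∀ i, M < i → f i v = 0) :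
    LocallyFiniteSum f := by
  intro v
  obtain ⟨N, hN⟩ := h1 v
  obtain ⟨M, hM⟩ := h2 v
  exact finite_of_bounds N M (fun i hi => not_not.2 (hN i hi)) (fun i hi => not_not.2 (hM i hi))

/-! ### Fields bounded below -/

/-- On every vector, only finitely many negative powers of `z` occur. -/
def BddBelowField (A : FieldSeries) : Prop := ∀ v, ∃ N : ℤ, ∀ n, n < N → A n v = 0

namespace BddBelowField

variable {A B : FieldSeries}

theorem add (hA : BddBelowField A) (hB : BddBelowField B) : BddBelowField (A + B) := by
  intro v
  obtain ⟨N, hN⟩ := hA v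
  obtain ⟨M, hM⟩ := hB v
  refine ⟨min N M, fun n hn => ?_⟩
  simp [hN n (by omega), hM n (by omega)]

theorem smul (hA : BddBelowField A) (a : ℂ) : BddBelowField (a • A) := by
  intro v
  obtain ⟨N, hN⟩ := hA v
  exact ⟨N, fun n hn => by simp [hN n hn]⟩

theorem sub (hA : BddBelowField A) (hB : BddBelowField B) : BddBelowField (A - B) := by
  have := hA.add (hB.smul (-1))
  simpa [sub_eq_add_neg] using this

end BddBelowField

theorem exists_boson_apply_eq_zero (p : ℂ) (s : Bool) (v : Fock) :
    ∃ M : ℤ, ∀ n, M < n → boson p s n v = 0 := by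
  induction v using Finsupp.induction_linear with
  | zero => exact ⟨0, fun n _ => map_zero _⟩
  | add u w hu hw =>
    obtain ⟨N, hN⟩ := hu
    obtain ⟨M, hM⟩ := hw
    exact ⟨max N M, fun n hn => by rw [map_add, hN n (by omega), hM n (by omega), add_zero]⟩
  | single b z =>
    have hz : (Finsupp.single b z : Fock) = z • ket b := by simp [ket]
    refine ⟨(b.2.support.sup fun x => x.2 + 1 : ℕ), fun n hn => ?_⟩
    obtain ⟨k, rfl⟩ := exists_eq_succ_of_pos (n := n) (by omega)
    have : b.2 (s, k) = 0 := by
      by_contra hc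
      have := Finset.le_sup (f := fun x : Bool × ℕ => x.2 + 1) (Finsupp.mem_support_iff.2 hc)
      simp only at this
      omega
    rw [hz, map_smul, boson_succ, annihilate_ket, this]
    simp

theorem dphi_bddBelow (p : ℂ) (s : Bool) : BddBelowField (dphi p s) := by
  intro v
  obtain ⟨M, hM⟩ := exists_boson_apply_eq_zero p s v
  exact ⟨-M - 1, fun n hn => hM _ (by omega)⟩

/-- The product of two fields exists if the second is bounded below and the terms with very
negative index of the first vanish. -/
theorem mulExists_of_bounds {A B : FieldSeries} (hB : BddBelowField B)
    (h : ∀ n v, ∃ N, ∀ i, i < N → A i (B (n - i) v) = 0) : MulExists A B := by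
  refine fun n => locallyFiniteSum_of_bounds (h n) fun v => ?_
  obtain ⟨N, hN⟩ := hB v
  exact ⟨n - N, fun i hi => by simp [mulTerm, hN (n - i) (by omega)]⟩

theorem MulExists.locHasSum {A B : FieldSeries} (h : MulExists A B) (n : ℤ) :
    LocHasSum (fun i => A i * B (n - i)) (mulField A B n) := (h n).locHasSum

/-- Commutators with the product of two fields. -/
theorem comm_mulField {A B : FieldSeries} (h : MulExists A B) {X : Module.End ℂ Fock} {a b : ℂ}
    {k : ℤ} (hA : ∀ i, ⁅X, A i⁆ = a • A (i - k)) (hB : ∀ i, ⁅X, B i⁆ = b • B (i - k)) (n : ℤ) :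
    ⁅X, mulField A B n⁆ = (a + b) • mulField A B (n - k) := by
  have h1 := ((h.locHasSum (n - k)).shift (-k)).smul a
  have h2 := (h.locHasSum (n - k)).smul b
  refine LocHasSum.unique ((h.locHasSum n).comm_left X) ?_
  rw [add_smul]
  refine (h1.add h2).congr fun i => ?_
  rw [comm_mul, hA, hB, smul_mul_assoc, mul_smul_comm, ← sub_eq_add_neg,
    show n - k - (i - k) = n - i by omega, show n - k - i = n - i - k by omega]

/-! ### The exponential of an operator-valued power series -/

section ExpSeries

variable {P : PowerSeries (Module.End ℂ Fock)}

open PowerSeries in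
-- Each factor has positive order. Hence the truncation in `expSeries` loses nothing.
theorem coeff_pow_eq_zero (hP : coeff 0 P = 0) {N k : ℕ} (h : N < k) : coeff N (P ^ k) = 0 := by
  induction k generalizing N with
  | zero => omega
  | succ k ih =>
    rw [pow_succ, coeff_mul]
    refine Finset.sum_eq_zero fun x hx => ?_
    rw [Finset.HasAntidiagonal.mem_antidiagonal] at hx
    rcases Nat.eq_zero_or_pos x.2 with h0 | h0
    · rw [h0, hP, mul_zero]
    · rw [ih (by omega), zero_mul]

open PowerSeries in
-- The commutator with `X` is a derivation whose value on `P` is the central series `κ t^n`, so it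
-- acts on powers like an ordinary derivative.
theorem comm_coeff_pow {X : Module.End ℂ Fock} {κ : ℂ} {n : ℕ}
    (h : ∀ m, ⁅X, coeff m P⁆ = if m = n then κ • 1 else 0) (k N : ℕ) :
    ⁅X, coeff N (P ^ (k + 1))⁆ =
      if n ≤ N then ((k + 1) * κ) • coeff (N - n) (P ^ k) else 0 := by
  induction k generalizing N with
  | zero =>
    simp only [zero_add, pow_one, h, pow_zero, coeff_one, Nat.cast_zero, one_mul]
    by_cases h1 : N = n
    · subst h1; simp
    · rw [if_neg h1]
      split_ifs with h2 h3
      · omega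
      · simp
      · rfl
  | succ k ih =>
    have hsum : ∀ (Y : PowerSeries (Module.End ℂ Fock)),
        ∑ x ∈ Finset.HasAntidiagonal.antidiagonal N, coeff x.1 Y * (if x.2 = n then κ • 1 else 0) =
          if n ≤ N then κ • coeff (N - n) Y else 0 := by
      intro Y
      split_ifs with hn
      · rw [Finset.sum_eq_single (N - n, n)]
        · simp
        · rintro ⟨a, b⟩ hx hne
          rw [Finset.HasAntidiagonal.mem_antidiagonal] at hx
          rw [if_neg, mul_zero]
          rintro rfl
          exact hne (Prod.ext_iff.2 ⟨by simp; omega, by simp⟩)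
        · intro hx
          exact absurd (Finset.HasAntidiagonal.mem_antidiagonal.2 (by simp; omega)) hx
      · refine Finset.sum_eq_zero fun x hx => ?_
        rw [Finset.HasAntidiagonal.mem_antidiagonal] at hx
        rw [if_neg (by omega), mul_zero]
    have hsum2 : ∑ x ∈ Finset.HasAntidiagonal.antidiagonal N,
        (if n ≤ x.1 then (((k : ℂ) + 1) * κ) • coeff (x.1 - n) (P ^ k) else 0) * coeff x.2 P =
          if n ≤ N then (((k : ℂ) + 1) * κ) • coeff (N - n) (P ^ (k + 1)) else 0 := by
      split_ifs with hn
      · rw [pow_succ, coeff_mul, Finset.smul_sum]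
        symm
        refine Finset.sum_of_injOn (fun x => (x.1 + n, x.2)) ?_ ?_ ?_ ?_
        · rintro ⟨a, b⟩ _ ⟨c, d⟩ _ hx
          simpa using hx
        · rintro ⟨a, b⟩ hx
          simp at hx ⊢
          omega
        · rintro ⟨a, b⟩ hx hx'
          rw [Finset.HasAntidiagonal.mem_antidiagonal] at hx
          simp only at hx
          rw [if_neg, zero_mul]
          intro hle
          exact hx' ⟨(a - n, b), by simp; omega, by simp; omega⟩
        · rintro ⟨a, b⟩ _
          simp
      · refine Finset.sum_eq_zero fun x hx => ?_
        rw [Finset.HasAntidiagonal.mem_antidiagonal] at hx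
        rw [if_neg (by omega), zero_mul]
    have hc : ∀ (s : Finset (ℕ × ℕ)) (f : ℕ × ℕ → Module.End ℂ Fock),
        ⁅X, ∑ x ∈ s, f x⁆ = ∑ x ∈ s, ⁅X, f x⁆ := by
      intro s f
      simp only [Ring.lie_def, Finset.mul_sum, Finset.sum_mul, Finset.sum_sub_distrib]
    rw [pow_succ, coeff_mul, hc]
    simp only [comm_mul, ih, h, Finset.sum_add_distrib]
    rw [hsum, hsum2]
    split_ifs
    · push_cast
      module
    · simp

open PowerSeries in
-- The coefficientwise form of `[X, e^P] = κ t^n e^P`, valid because `[X, P]` is central.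
theorem comm_coeff_expSeries (hP : coeff 0 P = 0) {X : Module.End ℂ Fock} {κ : ℂ} {n : ℕ}
    (hn : n ≠ 0) (h : ∀ m, ⁅X, coeff m P⁆ = if m = n then κ • 1 else 0) (N : ℕ) :
    ⁅X, coeff N (expSeries P)⁆ = if n ≤ N then κ • coeff (N - n) (expSeries P) else 0 := by
  have hc : ∀ (s : Finset ℕ) (f : ℕ → Module.End ℂ Fock),
      ⁅X, ∑ x ∈ s, f x⁆ = ∑ x ∈ s, ⁅X, f x⁆ := by
    intro s f
    simp only [Ring.lie_def, Finset.mul_sum, Finset.sum_mul, Finset.sum_sub_distrib]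
  have hk : ∀ k : ℕ, (((k + 1).factorial : ℂ)⁻¹) * ((k + 1) * κ) = κ * (k.factorial : ℂ)⁻¹ := by
    intro k
    have : (k : ℂ) + 1 ≠ 0 := Nat.cast_add_one_ne_zero k
    have := Nat.cast_ne_zero (R := ℂ).2 k.factorial_ne_zero
    rw [Nat.factorial_succ]
    push_cast
    field_simp
  rw [expSeries, coeff_mk, hc, Finset.sum_range_succ']
  simp only [comm_smul, comm_coeff_pow h]
  have h0 : ⁅X, coeff N (P ^ 0)⁆ = 0 := by
    rw [pow_zero, coeff_one]
    split_ifs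
    · exact comm_one X
    · exact comm_zero X
  rw [h0, smul_zero, add_zero]
  split_ifs with hN
  · simp only [smul_smul, hk]
    rw [coeff_mk, Finset.smul_sum]
    simp only [smul_smul]
    symm
    -- The truncations at degrees `N` and `N - n` have different lengths; the extra powers start
    -- beyond degree `N - n`.
    refine Finset.sum_subset (fun k hk => ?_) fun k hk hk' => ?_
    · simp at hk ⊢; omega
    · rw [coeff_pow_eq_zero hP (by simp at hk'; omega), smul_zero]
  · simp

open PowerSeries in
theorem comm_coeff_expSeries_eq_zero {X : Module.End ℂ Fock} (h : ∀ m, ⁅X, coeff m P⁆ = 0)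
    (N : ℕ) : ⁅X, coeff N (expSeries P)⁆ = 0 := by
  have hc : ∀ {α : Type} (s : Finset α) (f : α → Module.End ℂ Fock),
      ⁅X, ∑ x ∈ s, f x⁆ = ∑ x ∈ s, ⁅X, f x⁆ := by
    intro α s f
    simp only [Ring.lie_def, Finset.mul_sum, Finset.sum_mul, Finset.sum_sub_distrib]
  have hp : ∀ k N, ⁅X, coeff N (P ^ k)⁆ = 0 := by
    intro k
    induction k with
    | zero =>
      intro N
      rw [pow_zero, coeff_one]
      split_ifs
      · exact comm_one X
      · exact comm_zero X
    | succ k ih =>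
      intro N
      rw [pow_succ, coeff_mul, hc]
      exact Finset.sum_eq_zero fun x _ => by rw [comm_mul, ih, h, zero_mul, mul_zero, add_zero]
  rw [expSeries, coeff_mk, hc]
  exact Finset.sum_eq_zero fun x _ => by rw [comm_smul, hp, smul_zero]

open PowerSeries in
theorem coeff_zero_expSeries (P : PowerSeries (Module.End ℂ Fock)) :
    coeff 0 (expSeries P) = 1 := by
  simp [expSeries]

open PowerSeries in
theorem coeff_expSeries_induction (C : Module.End ℂ Fock → Prop) (h0 : C 0)
    (hadd : ∀ X Y, C X → C Y → C (X + Y)) (hsmul : ∀ (a : ℂ) X, C X → C (a • X)) {N : ℕ}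
    (hN : N ≠ 0) (h : ∀ k, C (coeff N (P ^ (k + 1)))) : C (coeff N (expSeries P)) := by
  have hs : ∀ (s : Finset ℕ) (f : ℕ → Module.End ℂ Fock), (∀ x ∈ s, C (f x)) →
      C (∑ x ∈ s, f x) := fun s f hf => Finset.sum_induction f C hadd h0 hf
  rw [expSeries, coeff_mk]
  refine hs _ _ fun k _ => hsmul _ _ ?_
  cases k with
  | zero => simpa [coeff_one, hN] using h0
  | succ k => exact h k

end ExpSeries

/-! ### The factors of a normally ordered exponential -/

open PowerSeries in
theorem coeff_creation_zero (E : Exponent) : coeff 0 E.creationSeries = 0 := by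
  simp [Exponent.creationSeries]

open PowerSeries in
theorem coeff_annihilation_zero (E : Exponent) : coeff 0 E.annihilationSeries = 0 := by
  simp [Exponent.annihilationSeries]

open PowerSeries in
theorem coeff_creation_succ (E : Exponent) (k : ℕ) : coeff (k + 1) E.creationSeries =
    ∑ s : Bool, E.coeff s (-((k : ℤ) + 1)) • create s k := by
  simp [Exponent.creationSeries]

open PowerSeries in
theorem coeff_annihilation_succ (E : Exponent) (k : ℕ) : coeff (k + 1) E.annihilationSeries =
    ∑ s : Bool, E.coeff s ((k : ℤ) + 1) • annihilate s k := by
  simp [Exponent.annihilationSeries]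

open PowerSeries in
theorem creationPart_natCast (E : Exponent) (N : ℕ) :
    E.creationPart (N : ℤ) = coeff N (expSeries E.creationSeries) := rfl

theorem creationPart_neg (E : Exponent) {n : ℤ} (hn : n < 0) : E.creationPart n = 0 := by
  obtain ⟨k, rfl⟩ := exists_eq_neg_succ_of_neg hn
  rw [show -((k : ℤ) + 1) = Int.negSucc k by omega]
  rfl

open PowerSeries in
theorem annihilationPart_neg_natCast (E : Exponent) (N : ℕ) :
    E.annihilationPart (-(N : ℤ)) = coeff N (expSeries E.annihilationSeries) := by
  simp only [Exponent.annihilationPart, neg_neg]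

theorem annihilationPart_pos (E : Exponent) {n : ℤ} (hn : 0 < n) : E.annihilationPart n = 0 := by
  obtain ⟨k, rfl⟩ := exists_eq_succ_of_pos hn
  simp only [Exponent.annihilationPart]
  rw [show -((k : ℤ) + 1) = Int.negSucc k by omega]

open PowerSeries in
theorem boson_comm_creation (p : ℂ) (E : Exponent) (s : Bool) (n : ℤ) (m : ℕ) :
    ⁅boson p s n, coeff m E.creationSeries⁆ =
      if 0 < n ∧ (m : ℤ) = n then (n * E.coeff s (-n)) • 1 else 0 := by
  cases m with
  | zero => rw [coeff_creation_zero, comm_zero, if_neg]; omega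
  | succ k =>
    rw [coeff_creation_succ, Fintype.sum_bool, comm_add, comm_smul, comm_smul,
      ← boson_neg_succ p, ← boson_neg_succ p, boson_lie_boson, boson_lie_boson]
    by_cases h : 0 < n ∧ ((k + 1 : ℕ) : ℤ) = n
    · obtain ⟨h1, rfl⟩ := h
      cases s <;> simp [smul_smul, mul_comm]
    · have : ¬ (n + -((k : ℤ) + 1) = 0) := by push_cast at h; omega
      rw [if_neg (fun h => this h.2), if_neg (fun h => this h.2), if_neg h]
      simp

open PowerSeries in
theorem boson_comm_annihilation (p : ℂ) (E : Exponent) (s : Bool) (n : ℤ) (m : ℕ) :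
    ⁅boson p s n, coeff m E.annihilationSeries⁆ =
      if n < 0 ∧ (m : ℤ) = -n then (n * E.coeff s (-n)) • 1 else 0 := by
  cases m with
  | zero => rw [coeff_annihilation_zero, comm_zero, if_neg]; omega
  | succ k =>
    rw [coeff_annihilation_succ, Fintype.sum_bool, comm_add, comm_smul, comm_smul,
      ← boson_succ p, ← boson_succ p, boson_lie_boson, boson_lie_boson]
    by_cases h : n < 0 ∧ ((k + 1 : ℕ) : ℤ) = -n
    · obtain ⟨h1, h2⟩ := h
      obtain rfl : n = -((k + 1 : ℕ) : ℤ) := by omega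
      cases s <;> simp [smul_smul, mul_comm] <;> omega
    · have : ¬ (n + ((k : ℤ) + 1) = 0) := by push_cast at h; omega
      rw [if_neg (fun h => this h.2), if_neg (fun h => this h.2), if_neg h]
      simp

/-- Commutators with the creation part of a normally ordered exponential. -/
theorem boson_comm_creationPart (p : ℂ) (E : Exponent) (s : Bool) (n i : ℤ) :
    ⁅boson p s n, E.creationPart i⁆ =
      (if 0 < n then (n : ℂ) * E.coeff s (-n) else 0) • E.creationPart (i - n) := by
  rcases lt_or_ge i 0 with hi | hi
  · rw [creationPart_neg E hi, comm_zero]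
    split_ifs with h
    · rw [creationPart_neg E (by omega), smul_zero]
    · rw [zero_smul]
  · obtain ⟨N, rfl⟩ := Int.eq_ofNat_of_zero_le hi
    rw [creationPart_natCast]
    split_ifs with h
    · obtain ⟨n, rfl⟩ := Int.eq_ofNat_of_zero_le h.le
      have h1 : ∀ m, ⁅boson p s n, PowerSeries.coeff m E.creationSeries⁆ =
          if m = n then ((n : ℂ) * E.coeff s (-n)) • 1 else 0 := by
        intro m
        rw [boson_comm_creation]
        simp [show 0 < n by omega]
      rw [comm_coeff_expSeries (coeff_creation_zero E) (by omega) h1]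
      split_ifs with h2
      · rw [show (N : ℤ) - n = ((N - n : ℕ) : ℤ) by omega, creationPart_natCast]
        simp
      · rw [creationPart_neg E (by omega), smul_zero]
    · rw [zero_smul]
      refine comm_coeff_expSeries_eq_zero (fun m => ?_) N
      rw [boson_comm_creation, if_neg (fun h' => h h'.1)]

/-- Commutators with the annihilation part of a normally ordered exponential. -/
theorem boson_comm_annihilationPart (p : ℂ) (E : Exponent) (s : Bool) (n i : ℤ) :
    ⁅boson p s n, E.annihilationPart i⁆ =
      (if n < 0 then (n : ℂ) * E.coeff s (-n) else 0) • E.annihilationPart (i - n) := by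
  rcases lt_or_ge 0 i with hi | hi
  · rw [annihilationPart_pos E hi, comm_zero]
    split_ifs with h
    · rw [annihilationPart_pos E (by omega), smul_zero]
    · rw [zero_smul]
  · obtain ⟨N, rfl⟩ := Int.exists_eq_neg_ofNat hi
    rw [annihilationPart_neg_natCast]
    split_ifs with h
    · obtain ⟨n, rfl⟩ := Int.exists_eq_neg_ofNat h.le
      have h1 : ∀ m, ⁅boson p s (-(n : ℤ)), PowerSeries.coeff m E.annihilationSeries⁆ =
          if m = n then (((-(n : ℤ) : ℤ) : ℂ) * E.coeff s (-(-(n : ℤ)))) • 1 else 0 := by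
        intro m
        rw [boson_comm_annihilation]
        simp [show 0 < n by omega]
      rw [comm_coeff_expSeries (coeff_annihilation_zero E) (by omega) h1]
      split_ifs with h2
      · rw [show -(N : ℤ) - -(n : ℤ) = -((N - n : ℕ) : ℤ) by omega, annihilationPart_neg_natCast]
      · rw [annihilationPart_pos E (by omega), smul_zero]
    · rw [zero_smul]
      refine comm_coeff_expSeries_eq_zero (fun m => ?_) N
      rw [boson_comm_annihilation, if_neg (fun h' => h h'.1)]

/-! ### Normally ordered exponentials -/

theorem zeroPart_ket (p : ℂ) (E : Exponent) (n : ℤ) (b : FockIndex) :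
    E.zeroPart p n (ket b) = if E.charge * b.1 = n then
      (E.scale ^ b.1 * Complex.exp (E.tilde * p)) • ket (b.1 + E.charge, b.2) else 0 :=
  ofBasis_ket _ _

theorem create_comm_zeroPart (p : ℂ) (E : Exponent) (s : Bool) (k : ℕ) (n : ℤ) :
    ⁅create s k, E.zeroPart p n⁆ = 0 := by
  refine op_ext fun b => ?_
  simp only [Ring.lie_def, LinearMap.sub_apply, Module.End.mul_apply, create_ket, zeroPart_ket]
  split_ifs
  · simp [create_ket]
  · simp

theorem annihilate_comm_zeroPart (p : ℂ) (E : Exponent) (s : Bool) (k : ℕ) (n : ℤ) :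
    ⁅annihilate s k, E.zeroPart p n⁆ = 0 := by
  refine op_ext fun b => ?_
  simp only [Ring.lie_def, LinearMap.sub_apply, Module.End.mul_apply, annihilate_ket, map_smul,
    zeroPart_ket]
  split_ifs
  · simp only [map_smul, annihilate_ket]
    rw [smul_comm, sub_self, LinearMap.zero_apply]
  · simp

theorem charge_comm_zeroPart (p : ℂ) (E : Exponent) (n : ℤ) :
    ⁅boson p false 0, E.zeroPart p n⁆ = (E.charge : ℂ) • E.zeroPart p n := by
  refine op_ext fun b => ?_
  simp only [Ring.lie_def, LinearMap.sub_apply, Module.End.mul_apply, boson_zero, charge_ket,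
    map_smul, zeroPart_ket, LinearMap.smul_apply]
  split_ifs
  · simp only [map_smul, charge_ket]
    push_cast
    module
  · simp

theorem boson_comm_zeroPart (p : ℂ) (E : Exponent) (s : Bool) {n : ℤ} (hn : n ≠ 0) (i : ℤ) :
    ⁅boson p s n, E.zeroPart p i⁆ = 0 := by
  rcases lt_or_gt_of_ne hn with h | h
  · obtain ⟨k, rfl⟩ := exists_eq_neg_succ_of_neg h
    rw [boson_neg_succ, create_comm_zeroPart]
  · obtain ⟨k, rfl⟩ := exists_eq_succ_of_pos h
    rw [boson_succ, annihilate_comm_zeroPart]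

theorem zeroPart_mul_annihilationPart (p : ℂ) (E : Exponent) (i j : ℤ) :
    E.zeroPart p i * E.annihilationPart j = E.annihilationPart j * E.zeroPart p i := by
  rcases lt_or_ge 0 j with hj | hj
  · rw [annihilationPart_pos E hj, mul_zero, zero_mul]
  · obtain ⟨N, rfl⟩ := Int.exists_eq_neg_ofNat hj
    rw [annihilationPart_neg_natCast]
    refine mul_eq_of_comm_eq_zero (comm_coeff_expSeries_eq_zero (fun m => ?_) N)
    cases m with
    | zero => rw [coeff_annihilation_zero, comm_zero]
    | succ k =>
      rw [coeff_annihilation_succ, Fintype.sum_bool, comm_add, comm_smul, comm_smul, comm_swap,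
        annihilate_comm_zeroPart, comm_swap, annihilate_comm_zeroPart]
      simp

theorem creationPart_zero (E : Exponent) : E.creationPart 0 = 1 := coeff_zero_expSeries _

theorem annihilationPart_zero (E : Exponent) : E.annihilationPart 0 = 1 := coeff_zero_expSeries _

theorem creationPart_apply_vac (E : Exponent) {n : ℤ} (hn : n ≠ 0) (u : Fock) (c : ℤ) :
    E.creationPart n u (c, 0) = 0 := by
  rcases lt_or_gt_of_ne hn with h | h
  · simp [creationPart_neg E h]
  · obtain ⟨N, rfl⟩ := Int.eq_ofNat_of_zero_le h.le
    rw [creationPart_natCast]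
    revert u
    refine coeff_expSeries_induction (fun X => ∀ u : Fock, X u (c, 0) = 0) (by simp)
      (fun X Y hX hY u => by simp [hX u, hY u]) (fun a X hX u => by simp [hX u]) (by omega)
      fun k u => ?_
    -- The leftmost factor is split off: a creation operator has no vacuum component in its image.
    rw [pow_succ', PowerSeries.coeff_mul, LinearMap.sum_apply, Finsupp.finsetSum_apply]
    refine Finset.sum_eq_zero fun x _ => ?_
    rcases x with ⟨_ | i, j⟩
    · simp [coeff_creation_zero]
    · have : ∀ s w, create s i w (c, 0) = 0 := fun s w =>
        create_apply_of_eq_zero s i w (c, 0) rfl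
      simp [coeff_creation_succ, this]

theorem annihilationPart_vac (E : Exponent) {n : ℤ} (hn : n ≠ 0) (c : ℤ) :
    E.annihilationPart n (ket (c, 0)) = 0 := by
  rcases lt_or_gt_of_ne hn with h | h
  · obtain ⟨N, rfl⟩ := Int.exists_eq_neg_ofNat h.le
    rw [annihilationPart_neg_natCast]
    refine coeff_expSeries_induction (fun X => X (ket (c, 0)) = 0) (by simp)
      (fun X Y hX hY => by simp [hX, hY]) (fun a X hX => by simp [hX]) (by omega)
      fun k => ?_
    rw [pow_succ, PowerSeries.coeff_mul, LinearMap.sum_apply]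
    refine Finset.sum_eq_zero fun x _ => ?_
    rcases x with ⟨j, _ | i⟩
    · simp [coeff_annihilation_zero]
    · simp [coeff_annihilation_succ, annihilate_vac]
  · simp [annihilationPart_pos E h]

/-- By induction on the number of excitations: moving one creation operator `a_{-(k+1)}` to the left
costs a term with index shifted by `k + 1`, so the lower bound drops by at most `k + 1`. -/
theorem annihilationPart_bddBelow (p : ℂ) (E : Exponent) : BddBelowField E.annihilationPart := by
  intro v
  induction v using Finsupp.induction_linear with
  | zero => exact ⟨0, fun n _ => map_zero _⟩
  | add u w hu hw =>
    obtain ⟨N, hN⟩ := hu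
    obtain ⟨M, hM⟩ := hw
    exact ⟨min N M, fun n hn => by rw [map_add, hN n (by omega), hM n (by omega), add_zero]⟩
  | single b z =>
    have hz : (Finsupp.single b z : Fock) = z • ket b := by simp [ket]
    suffices H : ∀ d : ℕ, ∀ m : (Bool × ℕ) →₀ ℕ, m.degree = d →
        ∃ N : ℤ, ∀ n, n < N → E.annihilationPart n (ket (b.1, m)) = 0 by
      obtain ⟨N, hN⟩ := H _ b.2 rfl
      exact ⟨N, fun n hn => by rw [hz, map_smul, hN n hn, smul_zero]⟩
    intro d
    induction d with
    | zero =>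
      intro m hm
      rw [Finsupp.degree_eq_zero_iff] at hm
      subst hm
      exact ⟨0, fun n hn => annihilationPart_vac E hn.ne b.1⟩
    | succ d ih =>
      intro m hm
      obtain ⟨s, k, m, rfl⟩ := exists_add_single_of_ne_zero (m := m) (by rintro rfl; simp at hm)
      obtain ⟨N, hN⟩ := ih m (by simpa using hm)
      refine ⟨N - (k + 1), fun n hn => ?_⟩
      have h := congrArg (fun X : Module.End ℂ Fock => X (ket (b.1, m)))
        (boson_comm_annihilationPart p E s (-((k : ℤ) + 1)) n)
      simp only [boson_neg_succ, Ring.lie_def, LinearMap.sub_apply, Module.End.mul_apply,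
        create_ket, LinearMap.smul_apply] at h
      rw [hN n (by omega), hN (n - -((k : ℤ) + 1)) (by omega), map_zero, smul_zero, zero_sub,
        neg_eq_zero] at h
      exact h

theorem finite_zeroPart (p : ℂ) (E : Exponent) (v : Fock) : {i | E.zeroPart p i v ≠ 0}.Finite := by
  induction v using Finsupp.induction_linear with
  | zero => simp
  | add u w hu hw =>
    refine (hu.union hw).subset fun i hi => ?_
    by_contra hc
    simp only [Set.mem_union, Set.mem_ofPred_eq, not_or, not_not] at hc hi
    exact hi (by simp [hc.1, hc.2])
  | single b z =>
    have hz : (Finsupp.single b z : Fock) = z • ket b := by simp [ket]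
    refine (Set.finite_singleton (E.charge * b.1)).subset fun i hi => ?_
    by_contra hc
    refine hi ?_
    rw [hz, map_smul, zeroPart_ket, if_neg (fun h => hc h.symm), smul_zero]

/-- Once the two factors are interchanged, only the finitely many zero-mode coefficients acting
nontrivially on the vector occur. -/
theorem zeroPart_mulExists (p : ℂ) (E : Exponent) : MulExists (E.zeroPart p) E.annihilationPart := by
  intro n v
  refine (finite_zeroPart p E v).subset fun i hi hc => hi ?_
  rw [mulTerm, zeroPart_mul_annihilationPart, Module.End.mul_apply, hc, map_zero]

theorem zeroPart_mul_bddBelow (p : ℂ) (E : Exponent) :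
    BddBelowField (mulField (E.zeroPart p) E.annihilationPart) := by
  intro v
  choose N hN using fun i => annihilationPart_bddBelow p E (E.zeroPart p i v)
  obtain ⟨M, hM⟩ : ∃ M : ℤ, ∀ i ∈ (finite_zeroPart p E v).toFinset, M ≤ i + N i := by
    obtain ⟨M, hM⟩ := ((finite_zeroPart p E v).toFinset.image fun i => i + N i).bddBelow
    exact ⟨M, fun i hi => hM (Finset.mem_coe.2 (Finset.mem_image_of_mem (fun i => i + N i) hi))⟩
  refine ⟨M, fun n hn => ?_⟩
  refine ((zeroPart_mulExists p E).locHasSum n).apply_eq_zero v fun i => ?_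
  rw [zeroPart_mul_annihilationPart, Module.End.mul_apply]
  by_cases hi : E.zeroPart p i v = 0
  · rw [hi, map_zero]
  · have := hM i (by simpa using hi)
    exact hN i _ (by omega)

theorem creationPart_mulExists (p : ℂ) (E : Exponent) :
    MulExists E.creationPart (mulField (E.zeroPart p) E.annihilationPart) :=
  mulExists_of_bounds (zeroPart_mul_bddBelow p E) fun n v =>
    ⟨0, fun i hi => by rw [creationPart_neg E hi, LinearMap.zero_apply]⟩

theorem normalExpExists (p : ℂ) (E : Exponent) : NormalExpExists p E :=
  ⟨zeroPart_mulExists p E, creationPart_mulExists p E⟩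

theorem normalExp_bddBelow (p : ℂ) (E : Exponent) : BddBelowField (normalExp p E) := by
  intro v
  obtain ⟨N, hN⟩ := zeroPart_mul_bddBelow p E v
  refine ⟨N, fun n hn => ((creationPart_mulExists p E).locHasSum n).apply_eq_zero v fun i => ?_⟩
  rcases lt_or_ge i 0 with hi | hi
  · rw [creationPart_neg E hi, zero_mul, LinearMap.zero_apply]
  · rw [Module.End.mul_apply, hN _ (by omega), map_zero]

/-- A mode with `n > 0` meets only the creation factor, one with `n < 0` only the annihilation
factor, and both cases give the same formula. This is the closure property required by
`matrix_mem_of_vac`. -/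
theorem boson_comm_normalExp (p : ℂ) (E : Exponent) (s : Bool) {n : ℤ} (hn : n ≠ 0) (i : ℤ) :
    ⁅boson p s n, normalExp p E i⁆ = ((n : ℂ) * E.coeff s (-n)) • normalExp p E (i - n) := by
  have h1 := comm_mulField (zeroPart_mulExists p E) (X := boson p s n) (k := n) (a := 0)
    (fun i => by rw [boson_comm_zeroPart p E s hn, zero_smul])
    (boson_comm_annihilationPart p E s n)
  rw [normalExp, comm_mulField (creationPart_mulExists p E) (boson_comm_creationPart p E s n) h1]
  congr 1
  rcases lt_or_gt_of_ne hn with h | h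
  · rw [if_neg (by omega), if_pos h]; ring
  · rw [if_pos h, if_neg (by omega)]; ring

theorem charge_comm_normalExp (p : ℂ) (E : Exponent) (i : ℤ) :
    ⁅boson p false 0, normalExp p E i⁆ = (E.charge : ℂ) • normalExp p E i := by
  have h1 := comm_mulField (zeroPart_mulExists p E) (X := boson p false 0) (k := 0)
    (fun i => by rw [charge_comm_zeroPart, sub_zero])
    (boson_comm_annihilationPart p E false 0)
  rw [normalExp, comm_mulField (creationPart_mulExists p E)
    (boson_comm_creationPart p E false 0) h1]
  simp

/-- Between vacua the creation and annihilation factors reduce to their constant terms, and only the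
zero-mode factor remains. -/
theorem normalExp_vac (p : ℂ) (E : Exponent) (n c c' : ℤ) :
    normalExp p E n (ket (c, 0)) (c', 0) = if c' = c + E.charge ∧ E.charge * c = n then
      E.scale ^ c * Complex.exp (E.tilde * p) else 0 := by
  have h1 : ∀ i, mulField (E.zeroPart p) E.annihilationPart i (ket (c, 0)) =
      E.zeroPart p i (ket (c, 0)) := by
    intro i
    rw [((zeroPart_mulExists p E).locHasSum i).apply_eq_single _ i]
    · rw [sub_self, annihilationPart_zero, mul_one]
    · intro j hj
      rw [Module.End.mul_apply, annihilationPart_vac E (by omega), map_zero]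
  rw [normalExp, ((creationPart_mulExists p E).locHasSum n).coord_eq_single _ _ 0]
  · rw [creationPart_zero, one_mul, sub_zero, h1, zeroPart_ket]
    by_cases h : E.charge * c = n
    · by_cases h' : c' = c + E.charge
      · simp [h, h', ket_apply]
      · simp [h, h', Ne.symm h', ket_apply]
    · simp [h]
  · intro j hj
    rw [Module.End.mul_apply, creationPart_apply_vac E hj]

/-! ### The vertex operators `:e^{kφ(z)}:` -/

/-- The vertex operator `:e^{kφ(z)}:`. -/
def vertexOp (p : ℂ) (k : ℤ) : FieldSeries := normalExp p (phiExponent k)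

/-- The commutator of `a_n` (or `ã_n`) with the exponent `kφ(z)` is `z^n` times this number. -/
def vertexWeight (k : ℤ) (s : Bool) : ℂ := if s then 0 else (k : ℂ)

theorem vertexOp_bddBelow (p : ℂ) (k : ℤ) : BddBelowField (vertexOp p k) := normalExp_bddBelow _ _

theorem boson_comm_vertexOp (p : ℂ) (k : ℤ) (s : Bool) (n i : ℤ) :
    ⁅boson p s n, vertexOp p k i⁆ = vertexWeight k s • vertexOp p k (i - n) := by
  rcases eq_or_ne n 0 with rfl | hn
  · cases s with
    | true => simp [boson_zero, zeroMode, Ring.lie_def, vertexWeight]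
    | false => simp [vertexOp, charge_comm_normalExp, phiExponent, vertexWeight]
  · rw [vertexOp, boson_comm_normalExp p _ s hn]
    congr 1
    cases s with
    | true => simp [phiExponent, vertexWeight]
    | false =>
      have : (n : ℂ) ≠ 0 := Int.cast_ne_zero.2 hn
      simp [phiExponent, vertexWeight]
      field_simp

theorem vertexOp_vac (p : ℂ) (k n c c' : ℤ) :
    vertexOp p k n (ket (c, 0)) (c', 0) = if c' = c + k ∧ k * c = n then 1 else 0 := by
  rw [vertexOp, normalExp_vac]
  simp [phiExponent]

/-- The terms of the normally ordered product of `a(z)` (or `ã(z)`) with `:e^{kφ(z)}:`. -/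
def bosonVertexTerm (p : ℂ) (s : Bool) (k n l : ℤ) : Module.End ℂ Fock :=
  if l < 0 then boson p s l * vertexOp p k (n + l) else vertexOp p k (n + l) * boson p s l

/-- The coefficients of the normally ordered product of `∑ a_l z^{-l}` (or `∑ ã_l z^{-l}`) with
`:e^{kφ(z)}:`. -/
def bosonVertex (p : ℂ) (s : Bool) (k n : ℤ) : Module.End ℂ Fock :=
  locSum (bosonVertexTerm p s k n)

theorem bosonVertex_hasSum (p : ℂ) (s : Bool) (k n : ℤ) :
    LocHasSum (bosonVertexTerm p s k n) (bosonVertex p s k n) := by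
  refine LocallyFiniteSum.locHasSum (locallyFiniteSum_of_bounds (fun v => ?_) fun v => ?_)
  · obtain ⟨N, hN⟩ := vertexOp_bddBelow p k v
    refine ⟨min 0 (N - n), fun i hi => ?_⟩
    rw [bosonVertexTerm, if_pos (by omega), Module.End.mul_apply, hN _ (by omega), map_zero]
  · obtain ⟨M, hM⟩ := exists_boson_apply_eq_zero p s v
    refine ⟨max 0 M, fun i hi => ?_⟩
    rw [bosonVertexTerm, if_neg (by omega), Module.End.mul_apply, hM _ (by omega), map_zero]

theorem boson_comm_bosonVertex (p : ℂ) (s t : Bool) (k m n : ℤ) :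
    ⁅boson p t m, bosonVertex p s k n⁆ =
      (if t = s then (m : ℂ) else 0) • vertexOp p k (n - m) +
        vertexWeight k t • bosonVertex p s k (n - m) := by
  refine LocHasSum.unique ((bosonVertex_hasSum p s k n).comm_left _) ?_
  have h1 := LocHasSum.ite_eq (-m)
    (fun l => (if t = s then (m : ℂ) else 0) • vertexOp p k (n + l))
  rw [← sub_eq_add_neg] at h1
  refine (h1.add ((bosonVertex_hasSum p s k (n - m)).smul (vertexWeight k t))).congr fun l => ?_
  have h2 : ⁅boson p t m, boson p s l⁆ = if l = -m then
      (if t = s then (m : ℂ) else 0) • (1 : Module.End ℂ Fock) else 0 := by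
    rw [boson_lie_boson]
    by_cases h : t = s <;> by_cases h' : l = -m
    · subst h'; simp [h]
    · rw [if_neg (by omega), if_neg h']
    · simp [h]
    · simp [h]
  rw [bosonVertexTerm, bosonVertexTerm]
  generalize (if t = s then (m : ℂ) else 0) = z at h2 ⊢
  by_cases h3 : l = -m <;> by_cases h4 : l < 0 <;>
    simp only [h4, if_true, if_false, comm_mul, h2, boson_comm_vertexOp,
      show n + l - m = n - m + l by omega] <;> simp [h3, add_comm]

theorem bosonVertex_vac (p : ℂ) (k n c c' : ℤ) :
    bosonVertex p false k n (ket (c, 0)) (c', 0) =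
      if c' = c + k ∧ k * c = n then (c : ℂ) else 0 := by
  rw [(bosonVertex_hasSum p false k n).coord_eq_single _ _ 0]
  · rw [bosonVertexTerm, if_neg (lt_irrefl _), Module.End.mul_apply, boson_zero, charge_ket,
      map_smul, Finsupp.smul_apply, add_zero, vertexOp_vac]
    simp
  · intro l hl
    rw [bosonVertexTerm]
    split_ifs with h
    · rw [Module.End.mul_apply, boson_neg_apply_vac p false h]
    · rw [Module.End.mul_apply, boson_pos_vac p false (by omega), map_zero, Finsupp.zero_apply]

/-- The derivative of a vertex operator: `z ∂ :e^{kφ}: = k z :φ' e^{kφ}:`. -/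
theorem smul_vertexOp (p : ℂ) (k n : ℤ) :
    (n : ℂ) • vertexOp p k n = (k : ℂ) • bosonVertex p false k n := by
  rw [← sub_eq_zero]
  refine eq_zero_of_vac p
    (fun n : ℤ => (n : ℂ) • vertexOp p k n - (k : ℂ) • bosonVertex p false k n) ?_ ?_ n
  · intro n s m hm
    -- The contraction term of `boson_comm_bosonVertex` changes the factor `n` into `n - m`, so the
    -- family of differences is closed.
    have : ⁅boson p s m, (n : ℂ) • vertexOp p k n - (k : ℂ) • bosonVertex p false k n⁆ =
        vertexWeight k s • (((n - m : ℤ) : ℂ) • vertexOp p k (n - m) -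
          (k : ℂ) • bosonVertex p false k (n - m)) := by
      rw [comm_sub, comm_smul, comm_smul, boson_comm_vertexOp, boson_comm_bosonVertex]
      cases s
      · simp only [vertexWeight, if_true, Bool.false_eq_true, if_false]
        push_cast
        module
      · simp [vertexWeight]
    rw [this]
    exact Submodule.smul_mem _ _ (Submodule.subset_span ⟨n - m, rfl⟩)
  · intro n c c'
    simp only [LinearMap.sub_apply, LinearMap.smul_apply, Finsupp.sub_apply, Finsupp.smul_apply,
      vertexOp_vac, bosonVertex_vac, smul_eq_mul]
    split_ifs with h
    · rw [← h.2]; push_cast; ring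
    · simp

/-- On `|c⟩` the derivative formula reads `(j - kc) V_j |c⟩ = k ∑_{l<0} a_l V_{j+l} |c⟩`. Below `kc`
the left factor is nonzero, and induction upwards from the region where all coefficients vanish
gives zero. -/
theorem vertexOp_apply_vac_of_lt (p : ℂ) (k : ℤ) {c j : ℤ} (h : j < k * c) :
    vertexOp p k j (ket (c, 0)) = 0 := by
  obtain ⟨N, hN⟩ := vertexOp_bddBelow p k (ket (c, 0))
  suffices H : ∀ d : ℕ, ∀ j : ℤ, j < N + d → j < k * c → vertexOp p k j (ket (c, 0)) = 0 from
    H (j - N + 1).toNat j (by omega) h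
  intro d
  induction d with
  | zero => exact fun j hj _ => hN j (by simpa using hj)
  | succ d ih =>
    intro j hj hjc
    have h1 := congrArg (fun X : Module.End ℂ Fock => X (ket (c, 0))) (smul_vertexOp p k j)
    simp only [LinearMap.smul_apply] at h1
    rw [(bosonVertex_hasSum p false k j).apply_eq_single _ 0] at h1
    · rw [bosonVertexTerm, if_neg (lt_irrefl _), Module.End.mul_apply, boson_zero, charge_ket,
        map_smul, add_zero, smul_smul, ← sub_eq_zero, ← sub_smul, smul_eq_zero] at h1
      refine h1.resolve_left fun h2 => ?_
      have : ((j : ℤ) : ℂ) = ((k * c : ℤ) : ℂ) := by push_cast; linear_combination h2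
      have := Int.cast_injective this
      omega
    · intro l hl
      rw [bosonVertexTerm]
      split_ifs with h
      · rw [Module.End.mul_apply, ih _ (by push_cast at hj; omega) (by omega), map_zero]
      · rw [Module.End.mul_apply, boson_pos_vac p false (by omega), map_zero]

/-- Annihilation operators send the left side to lower coefficients, which vanish on `|c⟩`. So it is
a combination of vacua, determined by the vacuum matrix elements. -/
theorem vertexOp_apply_vac (p : ℂ) (k c : ℤ) :
    vertexOp p k (k * c) (ket (c, 0)) = ket (c + k, 0) := by
  ext ⟨c', m⟩
  by_cases hm : m = 0
  · subst hm
    rw [vertexOp_vac, ket_apply]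
    simp [eq_comm]
  · rw [apply_eq_zero_of_annihilate _ c' hm, ket_apply, if_neg]
    · intro h
      exact hm (by simpa using (congrArg Prod.snd h).symm)
    · intro s i
      have h := congrArg (fun X : Module.End ℂ Fock => X (ket (c, 0)))
        (boson_comm_vertexOp p k s ((i : ℤ) + 1) (k * c))
      simp only [Ring.lie_def, LinearMap.sub_apply, Module.End.mul_apply, boson_succ,
        annihilate_vac, map_zero, sub_zero, LinearMap.smul_apply] at h
      rw [h, vertexOp_apply_vac_of_lt p k (by omega), smul_zero]

/-! ### Two-point functions -/

/-- This is the recursion of the coefficients of `(1 - t)^{kl}`. It comes from the derivative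
formula for the right vertex operator, with its creation modes commuted through the left one. -/
theorem two_point_step (p : ℂ) (k l i c c' : ℤ) (M : ℕ) :
    ((M : ℂ) + 1) * vertexOp p k i (vertexOp p l (l * c + (M + 1)) (ket (c, 0))) (c', 0) =
      ((M : ℂ) - k * l) *
        vertexOp p k (i + 1) (vertexOp p l (l * c + M) (ket (c, 0))) (c', 0) := by
  set g : ℤ → ℕ → ℂ := fun i M =>
    vertexOp p k i (vertexOp p l (l * c + M) (ket (c, 0))) (c', 0) with hg
  -- The zero mode of the derivative formula cancels the part `lc` of the index. The remaining
  -- creation modes vanish against the bra except for their commutators with the left operator.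
  have key : ∀ (i : ℤ) (M : ℕ),
      (M : ℂ) * g i M = -(k * l) * ∑ m ∈ Finset.range M, g (i + m + 1) (M - 1 - m) := by
    intro i M
    have h1 := congrArg (fun X : Module.End ℂ Fock => (vertexOp p k i * X) (ket (c, 0)) (c', 0))
      (smul_vertexOp p l (l * c + M))
    simp only [mul_smul_comm, LinearMap.smul_apply, Finsupp.smul_apply, smul_eq_mul] at h1
    rw [((bosonVertex_hasSum p false l (l * c + M)).mul_left (vertexOp p k i)).coord_eq_sum _ _
      (insert 0 ((Finset.range M).image fun m : ℕ => -((m : ℤ) + 1))), Finset.sum_insert,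
      Finset.sum_image] at h1
    · have h2 : ∀ m ∈ Finset.range M, ((vertexOp p k i * bosonVertexTerm p false l (l * c + M)
          (-((m : ℤ) + 1))) (ket (c, 0))) (c', 0) = -k * g (i + m + 1) (M - 1 - m) := by
        intro m hm
        rw [Finset.mem_range] at hm
        have h3 := boson_comm_vertexOp p k false (-((m : ℤ) + 1)) i
        rw [Ring.lie_def, sub_eq_iff_eq_add, eq_comm, ← eq_sub_iff_add_eq'] at h3
        rw [bosonVertexTerm, if_pos (by omega), ← mul_assoc, h3]
        simp only [vertexWeight, Bool.false_eq_true, if_false, LinearMap.sub_apply,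
          Module.End.mul_apply, LinearMap.smul_apply, Finsupp.sub_apply, Finsupp.smul_apply,
          smul_eq_mul, hg]
        rw [boson_neg_apply_vac p false (by omega), zero_sub, neg_mul,
          show i - -((m : ℤ) + 1) = i + m + 1 by omega,
          show l * c + (M : ℤ) + -((m : ℤ) + 1) = l * c + ((M - 1 - m : ℕ) : ℤ) by omega]
      rw [Finset.sum_congr rfl h2, ← Finset.mul_sum, bosonVertexTerm, if_neg (lt_irrefl _)] at h1
      simp only [add_zero, Module.End.mul_apply, boson_zero, charge_ket, map_smul,
        Finsupp.smul_apply, smul_eq_mul] at h1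
      push_cast at h1
      simp only [hg] at h1 ⊢
      linear_combination h1
    · intro a _ b _ h
      simpa using h
    · simp
      omega
    · intro j hj
      simp only [Finset.mem_insert, Finset.mem_image, Finset.mem_range, not_or, not_exists,
        not_and] at hj
      rw [Module.End.mul_apply, bosonVertexTerm]
      split_ifs with h
      · have := hj.2 (-j - 1).toNat
        rw [Module.End.mul_apply, vertexOp_apply_vac_of_lt p l (by omega), map_zero, map_zero,
          Finsupp.zero_apply]
      · rw [Module.End.mul_apply, boson_pos_vac p false (by omega), map_zero, map_zero,
          Finsupp.zero_apply]
  -- The sums for `(i, M + 1)` and `(i + 1, M)` agree except for one term, so subtraction leaves a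
  -- two-term recursion.
  have h1 := key i (M + 1)
  have h2 := key (i + 1) M
  rw [Finset.sum_range_succ'] at h1
  have h3 : ∀ m ∈ Finset.range M, g (i + ((m + 1 : ℕ) : ℤ) + 1) (M + 1 - 1 - (m + 1)) =
      g (i + 1 + m + 1) (M - 1 - m) := by
    intro m _
    congr 1
    · push_cast; ring
    · omega
  rw [Finset.sum_congr rfl h3] at h1
  simp only [Nat.cast_zero, add_zero, Nat.add_sub_cancel, Nat.sub_zero] at h1
  push_cast at h1
  simp only [hg] at h1 h2 ⊢
  push_cast at h1
  linear_combination h1 - h2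

/-- The two-point function of vertex operators: the expansion of `(z - w)^{kl}`. -/
theorem two_point (p : ℂ) (k l : ℤ) (γ : ℕ → ℂ) (h0 : γ 0 = 1)
    (hγ : ∀ M : ℕ, ((M : ℂ) + 1) * γ (M + 1) = ((M : ℂ) - k * l) * γ M) (i j c c' : ℤ) :
    vertexOp p k i (vertexOp p l j (ket (c, 0))) (c', 0) =
      if c' = c + k + l ∧ i + j = (k + l) * c + k * l ∧ l * c ≤ j then γ (j - l * c).toNat
      else 0 := by
  rcases lt_or_ge j (l * c) with hj | hj
  · rw [vertexOp_apply_vac_of_lt p l hj, if_neg (by omega)]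
    simp
  obtain ⟨M, hM⟩ := Int.eq_ofNat_of_zero_le (sub_nonneg.2 hj)
  obtain rfl : j = l * c + M := by omega
  -- The sequence `γ` enters only through its recursion, which treats positive and negative `kl`
  -- uniformly. Each step moves one unit of index from the right operator to the left one, until the
  -- right one acts at its lowest level.
  have key : ∀ (M : ℕ) (i : ℤ),
      vertexOp p k i (vertexOp p l (l * c + M) (ket (c, 0))) (c', 0) =
        γ M * vertexOp p k (i + M) (ket (c + l, 0)) (c', 0) := by
    intro M
    induction M with
    | zero =>
      intro i
      rw [h0, Nat.cast_zero, add_zero, add_zero, vertexOp_apply_vac, one_mul]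
    | succ M ih =>
      intro i
      have h1 := two_point_step p k l i c c' M
      rw [ih, ← mul_assoc, ← hγ, mul_assoc] at h1
      have h2 := mul_left_cancel₀ (Nat.cast_add_one_ne_zero M) h1
      rw [Nat.cast_add, Nat.cast_one, h2]
      congr 4
      ring
  rw [key, vertexOp_vac]
  have hiff : (k * (c + l) = i + M) ↔ (i + (l * c + M) = (k + l) * c + k * l) := by
    constructor <;> intro h <;> linear_combination -h
  simp only [hiff]
  by_cases h : c' = c + k + l ∧ i + (l * c + M) = (k + l) * c + k * l
  · rw [if_pos ⟨by omega, h.2⟩, if_pos ⟨h.1, h.2, hj⟩]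
    simp
  · rw [if_neg (fun h' => h ⟨by omega, h'.2⟩), if_neg (fun h' => h ⟨h'.1, h'.2.1⟩), mul_zero]

/-- The expansion coefficients of `(1 - t)^a`. -/
theorem choose_recursion (a M : ℕ) : ((M : ℂ) + 1) * ((-1) ^ (M + 1) * (a.choose (M + 1) : ℂ)) =
    ((M : ℂ) - a) * ((-1) ^ M * (a.choose M : ℂ)) := by
  rcases le_or_gt M a with h | h
  · have h1 := congrArg (Nat.cast (R := ℂ)) (Nat.choose_succ_right_eq a M)
    push_cast [Nat.cast_sub h] at h1
    linear_combination (-1) ^ (M + 1) * h1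
  · simp [Nat.choose_eq_zero_of_lt h, Nat.choose_eq_zero_of_lt (Nat.lt_succ_of_lt h)]

theorem boson_comm_vertexOp_mul (p : ℂ) (k l : ℤ) (s : Bool) (n i j : ℤ) :
    ⁅boson p s n, vertexOp p k i * vertexOp p l j⁆ =
      vertexWeight k s • (vertexOp p k (i - n) * vertexOp p l j) +
        vertexWeight l s • (vertexOp p k i * vertexOp p l (j - n)) := by
  rw [comm_mul, boson_comm_vertexOp, boson_comm_vertexOp, smul_mul_assoc, mul_smul_comm]

/-- Locality of vertex operators without singularity. -/
theorem vertexOp_mul_comm (p : ℂ) {k l : ℤ} {a : ℕ} (h : k * l = a) (i j : ℤ) :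
    vertexOp p k i * vertexOp p l j = (-1 : ℂ) ^ a • (vertexOp p l j * vertexOp p k i) := by
  rw [← sub_eq_zero]
  refine eq_zero_of_vac p (fun x : ℤ × ℤ => vertexOp p k x.1 * vertexOp p l x.2 -
    (-1 : ℂ) ^ a • (vertexOp p l x.2 * vertexOp p k x.1)) ?_ ?_ (i, j)
  · rintro ⟨i, j⟩ s n -
    have : ⁅boson p s n, vertexOp p k i * vertexOp p l j -
        (-1 : ℂ) ^ a • (vertexOp p l j * vertexOp p k i)⁆ =
        vertexWeight k s • (vertexOp p k (i - n) * vertexOp p l j -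
          (-1 : ℂ) ^ a • (vertexOp p l j * vertexOp p k (i - n))) +
        vertexWeight l s • (vertexOp p k i * vertexOp p l (j - n) -
          (-1 : ℂ) ^ a • (vertexOp p l (j - n) * vertexOp p k i)) := by
      rw [comm_sub, comm_smul, boson_comm_vertexOp_mul, boson_comm_vertexOp_mul]
      module
    simp only [this]
    exact Submodule.add_mem _
      (Submodule.smul_mem _ _ (Submodule.subset_span ⟨(i - n, j), rfl⟩))
      (Submodule.smul_mem _ _ (Submodule.subset_span ⟨(i, j - n), rfl⟩))
  · rintro ⟨i, j⟩ c c'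
    have hr : ∀ M : ℕ, ((M : ℂ) + 1) * ((-1) ^ (M + 1) * (a.choose (M + 1) : ℂ)) =
        ((M : ℂ) - k * l) * ((-1) ^ M * (a.choose M : ℂ)) := by
      intro M
      rw [choose_recursion]
      congr 2
      exact_mod_cast h.symm
    have hr' := hr
    simp only [mul_comm (k : ℂ)] at hr'
    simp only [LinearMap.sub_apply, LinearMap.smul_apply, Module.End.mul_apply, Finsupp.sub_apply,
      Finsupp.smul_apply]
    rw [two_point p k l (fun M => (-1) ^ M * (a.choose M : ℂ)) (by simp) hr,
      two_point p l k (fun M => (-1) ^ M * (a.choose M : ℂ)) (by simp) hr', smul_eq_mul]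
    by_cases h1 : c' = c + k + l ∧ i + j = (k + l) * c + k * l
    · have h2 : c' = c + l + k ∧ j + i = (l + k) * c + l * k :=
        ⟨by omega, by linear_combination h1.2⟩
      -- The two expansion degrees add up to `a`. The comparison is then `(z - w)^a = (-1)^a (w -
      -- z)^a`, that is, the symmetry of binomial coefficients.
      have hs : (j - l * c) + (i - k * c) = a := by rw [← h]; linear_combination h1.2
      by_cases h3 : l * c ≤ j
      · obtain ⟨M, hM⟩ := Int.eq_ofNat_of_zero_le (sub_nonneg.2 h3)
        rw [if_pos ⟨h1.1, h1.2, h3⟩, hM, Int.toNat_natCast]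
        by_cases h4 : k * c ≤ i
        · obtain ⟨M', hM'⟩ := Int.eq_ofNat_of_zero_le (sub_nonneg.2 h4)
          rw [if_pos ⟨h2.1, h2.2, h4⟩, hM', Int.toNat_natCast]
          obtain rfl : a = M + M' := by omega
          rw [Nat.choose_symm_add]
          have : (-1 : ℂ) ^ M' * (-1) ^ M' = 1 := by rw [← mul_pow]; simp
          rw [pow_add]
          linear_combination (-(-1) ^ M * ((M + M').choose M' : ℂ)) * this
        · rw [if_neg (fun h' => h4 h'.2.2), Nat.choose_eq_zero_of_lt (by omega)]
          simp
      · obtain ⟨M', hM'⟩ := Int.eq_ofNat_of_zero_le (a := i - k * c) (by omega)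
        rw [if_neg (fun h' => h3 h'.2.2), if_pos ⟨h2.1, h2.2, by omega⟩, hM', Int.toNat_natCast,
          Nat.choose_eq_zero_of_lt (by omega)]
        simp
    · have h2 : ¬ (c' = c + l + k ∧ j + i = (l + k) * c + l * k) := fun h' =>
        h1 ⟨by omega, by linear_combination h'.2⟩
      rw [if_neg (fun h' => h1 ⟨h'.1, h'.2.1⟩), if_neg (fun h' => h2 ⟨h'.1, h'.2.1⟩)]
      simp

/-- Here `kl = -1`, and every coefficient of `1 / (1 - t)` is 1. -/
theorem two_point_neg_one (p : ℂ) {k : ℤ} (hk : k * k = 1) (i j c c' : ℤ) :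
    vertexOp p k i (vertexOp p (-k) j (ket (c, 0))) (c', 0) =
      if c' = c ∧ i + j = -1 ∧ -k * c ≤ j then 1 else 0 := by
  have hk' : (k : ℂ) * k = 1 := by exact_mod_cast hk
  rw [two_point p k (-k) (fun _ => 1) rfl]
  · have h1 : (c' = c + k + -k) ↔ c' = c := by omega
    have h2 : (i + j = (k + -k) * c + k * -k) ↔ i + j = -1 := by
      rw [mul_neg, hk]; simp
    simp only [h1, h2]
  · intro M
    push_cast
    linear_combination -hk'

/-- The charged free fermions. -/
theorem vertexOp_anticomm (p : ℂ) {k : ℤ} (hk : k * k = 1) (i j : ℤ) :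
    vertexOp p k i * vertexOp p (-k) j + vertexOp p (-k) j * vertexOp p k i =
      if i + j = -1 then 1 else 0 := by
  rw [← sub_eq_zero]
  refine eq_zero_of_vac p (fun x : ℤ × ℤ => vertexOp p k x.1 * vertexOp p (-k) x.2 +
    vertexOp p (-k) x.2 * vertexOp p k x.1 - if x.1 + x.2 = -1 then 1 else 0) ?_ ?_ (i, j)
  · rintro ⟨i, j⟩ s n -
    have hw : vertexWeight (-k) s = -vertexWeight k s := by
      simp only [vertexWeight]
      split_ifs <;> simp
    have h1 : ∀ P : Prop, [Decidable P] →
        ⁅boson p s n, if P then (1 : Module.End ℂ Fock) else 0⁆ = 0 := by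
      intro P _
      split_ifs
      · exact comm_one _
      · exact comm_zero _
    have : ⁅boson p s n, vertexOp p k i * vertexOp p (-k) j +
        vertexOp p (-k) j * vertexOp p k i - if i + j = -1 then 1 else 0⁆ =
        vertexWeight k s • (vertexOp p k (i - n) * vertexOp p (-k) j +
          vertexOp p (-k) j * vertexOp p k (i - n) - if i - n + j = -1 then 1 else 0) -
        vertexWeight k s • (vertexOp p k i * vertexOp p (-k) (j - n) +
          vertexOp p (-k) (j - n) * vertexOp p k i - if i + (j - n) = -1 then 1 else 0) := by
      rw [comm_sub, comm_add, boson_comm_vertexOp_mul, boson_comm_vertexOp_mul, h1, hw,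
        show i - n + j = i + (j - n) by omega]
      module
    simp only [this]
    exact Submodule.sub_mem _
      (Submodule.smul_mem _ _ (Submodule.subset_span ⟨(i - n, j), rfl⟩))
      (Submodule.smul_mem _ _ (Submodule.subset_span ⟨(i, j - n), rfl⟩))
  · rintro ⟨i, j⟩ c c'
    have hk2 : -k * -k = 1 := by linear_combination hk
    have h2 := two_point_neg_one p hk2 j i c c'
    rw [neg_neg] at h2
    simp only [LinearMap.sub_apply, LinearMap.add_apply, Module.End.mul_apply, Finsupp.sub_apply,
      Finsupp.add_apply]
    rw [two_point_neg_one p hk, h2]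
    by_cases hij : i + j = -1
    · rw [if_pos hij, Module.End.one_apply, ket_apply]
      by_cases hc : c' = c
      · subst hc
        have e : -k * c' = -(k * c') := by ring
        rw [e]
        generalize k * c' = d
        -- The expansions of `1 / (z - w)` in the two regions have complementary supports, so
        -- exactly one of the two products contributes. This is the delta function.
        by_cases hd : -d ≤ j
        · rw [if_pos ⟨rfl, hij, hd⟩, if_neg (by omega)]; simp
        · rw [if_neg (by omega), if_pos ⟨rfl, by omega, by omega⟩]; simp
      · rw [if_neg (fun h => hc h.1), if_neg (fun h => hc h.1), if_neg]
        · simp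
        · simpa using Ne.symm hc
    · rw [if_neg hij, if_neg (fun h => hij h.2.1), if_neg (fun h => hij (by omega))]
      simp

/-! ### Bilinears in the bosons -/

/-- The terms of `∑ :b_l b'_{n-l}:`. -/
def bosonPairTerm (p : ℂ) (s t : Bool) (n l : ℤ) : Module.End ℂ Fock :=
  if l < 0 then boson p s l * boson p t (n - l) else boson p t (n - l) * boson p s l

/-- The normally ordered sum `∑ :b_l b'_{n-l}:`. -/
def bosonPair (p : ℂ) (s t : Bool) (n : ℤ) : Module.End ℂ Fock := locSum (bosonPairTerm p s t n)

theorem bosonPair_hasSum (p : ℂ) (s t : Bool) (n : ℤ) :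
    LocHasSum (bosonPairTerm p s t n) (bosonPair p s t n) := by
  refine LocallyFiniteSum.locHasSum (locallyFiniteSum_of_bounds (fun v => ?_) fun v => ?_)
  · obtain ⟨M, hM⟩ := exists_boson_apply_eq_zero p t v
    refine ⟨min 0 (n - M), fun i hi => ?_⟩
    rw [bosonPairTerm, if_pos (by omega), Module.End.mul_apply, hM _ (by omega), map_zero]
  · obtain ⟨M, hM⟩ := exists_boson_apply_eq_zero p s v
    refine ⟨max 0 M, fun i hi => ?_⟩
    rw [bosonPairTerm, if_neg (by omega), Module.End.mul_apply, hM _ (by omega), map_zero]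

theorem boson_lie_boson_ite (p : ℂ) (s t : Bool) (m l : ℤ) :
    ⁅boson p t m, boson p s l⁆ = if l = -m then
      (if t = s then (m : ℂ) else 0) • (1 : Module.End ℂ Fock) else 0 := by
  rw [boson_lie_boson]
  by_cases h : t = s <;> by_cases h' : l = -m
  · subst h'; simp [h]
  · rw [if_neg (by omega), if_neg h']
  · simp [h]
  · simp [h]

theorem boson_comm_bosonPair (p : ℂ) (r s t : Bool) (m n : ℤ) :
    ⁅boson p r m, bosonPair p s t n⁆ = (if r = s then (m : ℂ) else 0) • boson p t (n + m) +
      (if r = t then (m : ℂ) else 0) • boson p s (n + m) := by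
  refine LocHasSum.unique ((bosonPair_hasSum p s t n).comm_left _) ?_
  have h1 := LocHasSum.ite_eq (-m)
    (fun l => (if r = s then (m : ℂ) else 0) • boson p t (n - l))
  have h2 := LocHasSum.ite_eq (n + m)
    (fun l => (if r = t then (m : ℂ) else 0) • boson p s l)
  rw [sub_neg_eq_add] at h1
  refine (h1.add h2).congr fun l => ?_
  rw [bosonPairTerm]
  have e : (n - l = -m) ↔ (l = n + m) := by omega
  by_cases h4 : l < 0 <;>
    simp only [h4, if_true, if_false, comm_mul, boson_lie_boson_ite, e] <;>
    by_cases h3 : l = -m <;> by_cases h5 : l = n + m <;> simp [h3, h5, add_comm]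

/-- The eigenvalue of a zero mode on a vacuum vector. -/
def zeroValue (p : ℂ) (c : ℤ) (s : Bool) : ℂ := if s then p else (c : ℂ)

theorem boson_zero_vac (p : ℂ) (s : Bool) (b : FockIndex) :
    boson p s 0 (ket b) = zeroValue p b.1 s • ket b := by
  cases s with
  | true => simp [boson_zero, zeroMode, zeroValue]
  | false => simp [boson_zero, charge_ket, zeroValue]

theorem boson_vac_coord (p : ℂ) (s : Bool) (n c c' : ℤ) : boson p s n (ket (c, 0)) (c', 0) =
    if c' = c ∧ n = 0 then zeroValue p c s else 0 := by
  rcases lt_trichotomy n 0 with h | h | h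
  · rw [boson_neg_apply_vac p s h, if_neg (by omega)]
  · subst h
    rw [boson_zero_vac, Finsupp.smul_apply, ket_apply]
    by_cases h : c' = c
    · simp [h]
    · rw [if_neg, if_neg]
      · simp
      · tauto
      · simpa using Ne.symm h
  · rw [boson_pos_vac p s h, if_neg (by omega), Finsupp.zero_apply]

theorem bosonPair_vac (p : ℂ) (s t : Bool) (n c c' : ℤ) :
    bosonPair p s t n (ket (c, 0)) (c', 0) =
      if c' = c ∧ n = 0 then zeroValue p c s * zeroValue p c t else 0 := by
  rw [(bosonPair_hasSum p s t n).coord_eq_single _ _ 0]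
  · rw [bosonPairTerm, if_neg (lt_irrefl _), Module.End.mul_apply, boson_zero_vac, map_smul,
      Finsupp.smul_apply, sub_zero, boson_vac_coord, smul_eq_mul, mul_ite, mul_zero]
  · intro l hl
    rw [bosonPairTerm]
    split_ifs with h
    · rw [Module.End.mul_apply, boson_neg_apply_vac p s h]
    · rw [Module.End.mul_apply, boson_pos_vac p s (by omega), map_zero, Finsupp.zero_apply]

/-- The two ordering conventions differ only on pairs of commuting modes, so they give the same
terms. -/
theorem bosonTerm_eq (p : ℂ) (n i : ℤ) : bosonTerm p n i = bosonPairTerm p true true (-n - 2) i := by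
  have h : i + (-n - 2 - i) ≠ 0 → boson p true i * boson p true (-n - 2 - i) =
      boson p true (-n - 2 - i) * boson p true i := fun h =>
    mul_eq_of_comm_eq_zero (by rw [boson_lie_boson, if_neg (fun h' => h h'.2)])
  rw [bosonTerm, bosonNormal, bosonPairTerm]
  by_cases h0 : i + (-n - 2 - i) = 0
  · rcases lt_trichotomy i 0 with h1 | h1 | h1
    · rw [if_pos (by omega), if_pos h1]
    · rw [show -n - 2 - i = i by omega]
      simp
    · rw [if_neg (by omega), if_neg (by omega)]
  · split_ifs <;> first | rfl | exact h h0 | exact (h h0).symm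

theorem bosonTerm_locallyFinite (p : ℂ) (n : ℤ) : LocallyFiniteSum (bosonTerm p n) := by
  rw [show bosonTerm p n = bosonPairTerm p true true (-n - 2) from funext (bosonTerm_eq p n)]
  exact fun v => (bosonPair_hasSum p true true (-n - 2) v).1

theorem bosonSq_eq (p : ℂ) (n : ℤ) : bosonSq p n = bosonPair p true true (-n - 2) := by
  rw [bosonSq, bosonPair]
  exact congrArg locSum (funext (bosonTerm_eq p n))

/-! ### Bosonization -/

/-- The coefficient of `z^i w^j` in `(z - w) :e^{kφ(z)}: :e^{-kφ(w)}:`. -/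
def vertexPair (p : ℂ) (k i j : ℤ) : Module.End ℂ Fock :=
  vertexOp p k (i - 1) * vertexOp p (-k) j - vertexOp p k i * vertexOp p (-k) (j - 1)

theorem vertexWeight_neg (k : ℤ) (s : Bool) : vertexWeight (-k) s = -vertexWeight k s := by
  simp only [vertexWeight]
  split_ifs <;> simp

theorem boson_comm_vertexPair (p : ℂ) (k : ℤ) (s : Bool) (m i j : ℤ) :
    ⁅boson p s m, vertexPair p k i j⁆ =
      vertexWeight k s • (vertexPair p k (i - m) j - vertexPair p k i (j - m)) := by
  simp only [vertexPair]
  rw [comm_sub, boson_comm_vertexOp_mul, boson_comm_vertexOp_mul, vertexWeight_neg,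
    show i - 1 - m = i - m - 1 by omega, show j - 1 - m = j - m - 1 by omega]
  module

/-- The factor `z - w` kills the delta function, so the two fermions may be written in either order
up to sign. One order bounds the index from below, the other from above. -/
theorem vertexPair_locallyFinite (p : ℂ) {k : ℤ} (hk : k * k = 1) (f : ℤ → ℂ) (n : ℤ) :
    LocallyFiniteSum fun i => f i • vertexPair p k i (n - i) := by
  refine locallyFiniteSum_of_bounds (fun v => ?_) fun v => ?_
  · obtain ⟨N, hN⟩ := vertexOp_bddBelow p k v
    refine ⟨N, fun i hi => ?_⟩
    rw [vertexPair, eq_sub_of_add_eq (vertexOp_anticomm p hk (i - 1) (n - i)),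
      eq_sub_of_add_eq (vertexOp_anticomm p hk i (n - i - 1)),
      show i - 1 + (n - i) = i + (n - i - 1) by omega, sub_sub_sub_cancel_left]
    simp [hN i hi, hN (i - 1) (by omega)]
  · obtain ⟨N, hN⟩ := vertexOp_bddBelow p (-k) v
    refine ⟨n - N, fun i hi => ?_⟩
    simp [vertexPair, hN (n - i) (by omega), hN (n - i - 1) (by omega)]

/-- The moments `∑_i f(i) N_{i, n - i}` of `N(z, w) = (z - w) :e^{kφ(z)}: :e^{-kφ(w)}:`. -/
def vertexMoment (p : ℂ) (k : ℤ) (f : ℤ → ℂ) (n : ℤ) : Module.End ℂ Fock :=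
  locSum fun i => f i • vertexPair p k i (n - i)

theorem vertexMoment_hasSum (p : ℂ) {k : ℤ} (hk : k * k = 1) (f : ℤ → ℂ) (n : ℤ) :
    LocHasSum (fun i => f i • vertexPair p k i (n - i)) (vertexMoment p k f n) :=
  (vertexPair_locallyFinite p hk f n).locHasSum

/-- The weight `f` is replaced by a difference, which lowers the degree of a polynomial. Hence the
moments of `1`, `i` and `i(i - 1)/2` can be found in this order, each from the preceding ones and a
vacuum value. -/
theorem boson_comm_vertexMoment (p : ℂ) {k : ℤ} (hk : k * k = 1) (f : ℤ → ℂ) (s : Bool)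
    (m n : ℤ) : ⁅boson p s m, vertexMoment p k f n⁆ =
      vertexWeight k s • vertexMoment p k (fun i => f (i + m) - f i) (n - m) := by
  have h1 := ((vertexMoment_hasSum p hk (fun i => f (i + m)) (n - m)).shift (-m)).sub
    (vertexMoment_hasSum p hk f (n - m))
  have h2 := vertexMoment_hasSum p hk (fun i => f (i + m) - f i) (n - m)
  have h3 := (vertexMoment_hasSum p hk (fun i => f (i + m)) (n - m)).sub
    (vertexMoment_hasSum p hk f (n - m))
  have h4 := h2.unique (h3.congr fun i => by rw [sub_smul])
  rw [h4]
  refine LocHasSum.unique ((vertexMoment_hasSum p hk f n).comm_left _)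
    ((h1.smul (vertexWeight k s)).congr fun i => ?_)
  rw [comm_smul, boson_comm_vertexPair, neg_add_cancel_right, ← sub_eq_add_neg,
    show n - m - (i - m) = n - i by omega, show n - m - i = n - i - m by omega]
  module

/-- The factor `z - w` cancels the pole of the two-point function, leaving a single monomial, at `i
= kc`. -/
theorem vertexMoment_vac (p : ℂ) {k : ℤ} (hk : k * k = 1) (f : ℤ → ℂ) (n c c' : ℤ) :
    vertexMoment p k f n (ket (c, 0)) (c', 0) = if c' = c ∧ n = 0 then f (k * c) else 0 := by
  have key : ∀ i, (f i • vertexPair p k i (n - i)) (ket (c, 0)) (c', 0) =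
      if c' = c ∧ n = 0 ∧ i = k * c then f i else 0 := by
    intro i
    rw [vertexPair]
    simp only [LinearMap.sub_apply, LinearMap.smul_apply, Module.End.mul_apply, Finsupp.sub_apply,
      Finsupp.smul_apply, two_point_neg_one p hk, neg_mul, smul_eq_mul]
    generalize k * c = d
    by_cases hc : c' = c
    · by_cases hn : n = 0
      · rcases lt_trichotomy i d with h | h | h
        · rw [if_pos (by omega), if_pos (by omega), if_neg (by omega)]; simp
        · rw [if_pos (by omega), if_neg (by omega), if_pos (by omega)]; simp
        · rw [if_neg (by omega), if_neg (by omega), if_neg (by omega)]; simp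
      · rw [if_neg (by omega), if_neg (by omega), if_neg (by omega)]; simp
    · rw [if_neg (by omega), if_neg (by omega), if_neg (by omega)]; simp
  rw [(vertexMoment_hasSum p hk f n).coord_eq_single _ _ (k * c), key]
  · simp
  · intro j hj
    rw [key, if_neg (fun h => hj h.2.2)]

theorem boson_comm_ite (p : ℂ) (s : Bool) (n : ℤ) (P : Prop) [Decidable P] (a : ℂ) :
    ⁅boson p s n, if P then a • (1 : Module.End ℂ Fock) else 0⁆ = 0 := by
  split_ifs
  · rw [comm_smul, comm_one, smul_zero]
  · exact comm_zero _

theorem ite_smul_one_vac (P : Prop) [Decidable P] (a : ℂ) (c c' : ℤ) :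
    (if P then a • (1 : Module.End ℂ Fock) else 0) (ket (c, 0)) (c', 0) =
      if c' = c ∧ P then a else 0 := by
  by_cases hP : P <;> by_cases hc : c' = c
  · simp [hP, hc, ket_apply]
  · simp [hP, hc, ket_apply, Ne.symm hc]
  · simp [hP]
  · simp [hP]

/-- Since `(z - w) :e^{kφ(z)}: :e^{-kφ(w)}:` is `:e^{k(φ(z) - φ(w))}:`, its value at `z = w` is 1.
The next two lemmas extract its first and second Taylor coefficients. -/
theorem vertexMoment_const (p : ℂ) {k : ℤ} (hk : k * k = 1) (a : ℂ) (n : ℤ) :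
    vertexMoment p k (fun _ => a) n = if n = 0 then a • 1 else 0 := by
  rw [← sub_eq_zero]
  refine eq_zero_of_comm_of_vac p _ (fun s m _ => ?_) fun c c' => ?_
  · rw [comm_sub, boson_comm_vertexMoment p hk, boson_comm_ite, sub_zero]
    have := (vertexMoment_hasSum p hk (fun _ => a - a) (n - m)).unique
      (LocHasSum.zero.congr fun i => by simp)
    rw [this, smul_zero]
  · rw [LinearMap.sub_apply, Finsupp.sub_apply, vertexMoment_vac p hk, ite_smul_one_vac, sub_self]

theorem vertexMoment_id (p : ℂ) {k : ℤ} (hk : k * k = 1) (n : ℤ) :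
    vertexMoment p k (fun i => (i : ℂ)) n = (k : ℂ) • boson p false (-n) := by
  rw [← sub_eq_zero]
  refine eq_zero_of_comm_of_vac p _ (fun s m _ => ?_) fun c c' => ?_
  · rw [comm_sub, boson_comm_vertexMoment p hk, comm_smul, boson_lie_boson]
    have h1 : (fun i : ℤ => (((i + m : ℤ) : ℂ)) - (i : ℂ)) = fun _ => (m : ℂ) := by
      funext i; push_cast; ring
    rw [h1, vertexMoment_const p hk]
    cases s
    · by_cases h : n = m
      · subst h; simp [vertexWeight]
      · rw [if_neg (by omega), if_neg (by omega)]; simp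
    · simp [vertexWeight]
  · rw [LinearMap.sub_apply, Finsupp.sub_apply, vertexMoment_vac p hk, LinearMap.smul_apply,
      Finsupp.smul_apply, boson_vac_coord]
    by_cases h : c' = c ∧ n = 0
    · rw [if_pos h, if_pos (by omega)]
      simp [zeroValue]
    · rw [if_neg h, if_neg (by omega)]
      simp

theorem vertexMoment_lin (p : ℂ) {k : ℤ} (hk : k * k = 1) (f g : ℤ → ℂ) (a b : ℂ) (n : ℤ) :
    vertexMoment p k (fun i => a * f i + b * g i) n =
      a • vertexMoment p k f n + b • vertexMoment p k g n :=
  (vertexMoment_hasSum p hk _ n).unique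
    ((((vertexMoment_hasSum p hk f n).smul a).add ((vertexMoment_hasSum p hk g n).smul b)).congr
      fun i => by module)

theorem vertexMoment_triangle (p : ℂ) {k : ℤ} (hk : k * k = 1) (n : ℤ) :
    vertexMoment p k (fun i => (i : ℂ) * (i - 1) / 2) n =
      (1 / 2 : ℂ) • bosonPair p false false (-n) +
        ((k : ℂ) * (n - 1) / 2) • boson p false (-n) := by
  have hk' : (k : ℂ) * k = 1 := by exact_mod_cast hk
  rw [← sub_eq_zero]
  refine eq_zero_of_comm_of_vac p _ (fun s m _ => ?_) fun c c' => ?_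
  · rw [comm_sub, boson_comm_vertexMoment p hk, comm_add, comm_smul, comm_smul, boson_lie_boson,
      boson_comm_bosonPair]
    have h1 : (fun i : ℤ => (((i + m : ℤ) : ℂ)) * (((i + m : ℤ) : ℂ) - 1) / 2 -
        (i : ℂ) * ((i : ℂ) - 1) / 2) =
        fun i : ℤ => (m : ℂ) * (i : ℂ) + ((m : ℂ) * (m - 1) / 2) * 1 := by
      funext i; push_cast; ring
    rw [h1, vertexMoment_lin p hk (fun i => (i : ℂ)) (fun _ => 1), vertexMoment_id p hk, vertexMoment_const p hk]
    cases s
    · rw [show -(n - m) = -n + m by omega]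
      by_cases h : n = m
      · subst h
        simp only [vertexWeight, Bool.false_eq_true, if_false, sub_self, if_true, smul_add,
          smul_smul, true_and, add_neg_cancel]
        linear_combination (norm := module) ((n : ℂ) • hk') • (boson p false (-n + n))
      · rw [if_neg (show ¬ (n - m = 0) by omega)]
        simp only [vertexWeight, Bool.false_eq_true, if_false, if_true, smul_add, smul_smul,
          true_and, show ¬ (m + -n = 0) by omega, smul_zero, add_zero]
        linear_combination (norm := module) ((m : ℂ) • hk') • (boson p false (-n + m))
    · simp [vertexWeight]
  · simp only [LinearMap.sub_apply, LinearMap.add_apply, Finsupp.sub_apply, Finsupp.add_apply,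
      LinearMap.smul_apply, Finsupp.smul_apply, vertexMoment_vac p hk, boson_vac_coord,
      bosonPair_vac]
    by_cases h : c' = c ∧ n = 0
    · rw [if_pos h, if_pos (by omega), if_pos (by omega), h.2]
      simp only [zeroValue, Bool.false_eq_true, if_false, smul_eq_mul]
      push_cast
      linear_combination ((c : ℂ) ^ 2 / 2) * hk'
    · rw [if_neg h, if_neg (by omega), if_neg (by omega)]
      simp

/-- The normally ordered product of the modes of the charged fermions `:e^{±kφ}:`. -/
def chargedNormal (p : ℂ) (k i j : ℤ) : Module.End ℂ Fock :=
  if j ≤ i then vertexOp p k i * vertexOp p (-k) j else -(vertexOp p (-k) j * vertexOp p k i)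

theorem chargedNormal_eq (p : ℂ) {k : ℤ} (hk : k * k = 1) (i j : ℤ) :
    chargedNormal p k i j = vertexOp p k i * vertexOp p (-k) j -
      if i + j = -1 ∧ i < 0 then 1 else 0 := by
  have h := vertexOp_anticomm p hk i j
  rw [chargedNormal]
  by_cases h1 : j ≤ i
  · rw [if_pos h1, if_neg (by omega), sub_zero]
  · rw [if_neg h1, eq_sub_of_add_eq h]
    by_cases h2 : i + j = -1
    · rw [if_pos h2, if_pos (by omega)]
      abel
    · rw [if_neg h2, if_neg (by omega)]
      abel

/-- Multiplication of the normally ordered product by `z - w` gives the regular product minus 1, the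
constant being the contribution of the contraction `1 / (z - w)`. -/
theorem chargedNormal_sub (p : ℂ) {k : ℤ} (hk : k * k = 1) (i j : ℤ) :
    chargedNormal p k (i - 1) j - chargedNormal p k i (j - 1) =
      vertexPair p k i j - if i = 0 ∧ j = 0 then 1 else 0 := by
  rw [chargedNormal_eq p hk, chargedNormal_eq p hk, vertexPair]
  by_cases h : i = 0 ∧ j = 0
  · rw [if_pos (by omega), if_neg (by omega), if_pos h]
    abel
  · by_cases h2 : i - 1 + j = -1 ∧ i < 0
    · rw [if_pos (by omega), if_pos (by omega), if_neg h]
      abel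
    · rw [if_neg (by omega), if_neg (by omega), if_neg h]
      abel

/-- Summation by parts. -/
theorem chargedNormal_hasSum (p : ℂ) {k : ℤ} (hk : k * k = 1) (f : ℤ → ℂ) (n : ℤ) :
    LocHasSum (fun i => (f (i + 1) - f i) • chargedNormal p k i (n - 1 - i))
      (vertexMoment p k f n - if n = 0 then f 0 • 1 else 0) := by
  have hfin : ∀ g : ℤ → ℂ, LocallyFiniteSum fun i => g i • chargedNormal p k i (n - 1 - i) := by
    intro g
    refine locallyFiniteSum_of_bounds (fun v => ?_) fun v => ?_
    · obtain ⟨N, hN⟩ := vertexOp_bddBelow p k v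
      refine ⟨min N (min 0 n), fun i hi => ?_⟩
      rw [chargedNormal, if_neg (by omega)]
      simp [hN i (by omega)]
    · obtain ⟨N, hN⟩ := vertexOp_bddBelow p (-k) v
      refine ⟨max (n - N) (max 0 n), fun i hi => ?_⟩
      rw [chargedNormal, if_pos (by omega)]
      simp [hN (n - 1 - i) (by omega)]
  have h1 := (hfin fun i => f (i + 1)).locHasSum
  have h2 := (hfin f).locHasSum
  have h3 := (h1.shift (-1)).sub h2
  have h4 := LocHasSum.ite_eq (0 : ℤ) (fun i => if n = 0 then f i • (1 : Module.End ℂ Fock) else 0)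
  have h5 := h3.unique (((vertexMoment_hasSum p hk f n).sub h4).congr fun i => ?_)
  · rw [← h5]
    exact (h1.sub h2).congr fun i => by rw [sub_smul]
  · rw [neg_add_cancel_right, ← sub_eq_add_neg, show n - 1 - (i - 1) = n - i by omega, ← smul_sub,
      show n - 1 - i = n - i - 1 by omega, chargedNormal_sub p hk, smul_sub]
    congr 1
    by_cases h : i = 0
    · subst h
      by_cases hn : n = 0 <;> simp [hn]
    · simp [h]

/-- Summation by parts with `f(i) = i`, whose increments are 1. -/
theorem chargedNormal_sum (p : ℂ) {k : ℤ} (hk : k * k = 1) (n : ℤ) :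
    LocHasSum (fun i => chargedNormal p k i (n - i)) ((k : ℂ) • boson p false (-n - 1)) := by
  have h := chargedNormal_hasSum p hk (fun i => (i : ℂ)) (n + 1)
  rw [vertexMoment_id p hk] at h
  simp only [Int.cast_zero, zero_smul, ite_self, sub_zero, neg_add'] at h
  refine h.congr fun i => ?_
  push_cast
  rw [add_sub_cancel_left, one_smul, add_sub_cancel_right]

/-- Summation by parts with the triangular numbers `i(i - 1)/2`, whose increments are `i`. -/
theorem chargedNormal_sum_mul (p : ℂ) {k : ℤ} (hk : k * k = 1) (n : ℤ) :
    LocHasSum (fun i : ℤ => (i : ℂ) • chargedNormal p k i (n + 1 - i))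
      ((1 / 2 : ℂ) • bosonPair p false false (-n - 2) +
        ((k : ℂ) * (n + 1) / 2) • boson p false (-n - 2)) := by
  have h := chargedNormal_hasSum p hk (fun i => (i : ℂ) * (i - 1) / 2) (n + 2)
  rw [vertexMoment_triangle p hk] at h
  simp only [Int.cast_zero, zero_mul, zero_div, zero_smul, ite_self, sub_zero, neg_add'] at h
  have e : (k : ℂ) * (((n + 2 : ℤ) : ℂ) - 1) / 2 = (k : ℂ) * (n + 1) / 2 := by push_cast; ring
  rw [e] at h
  refine h.congr fun i => ?_
  rw [show n + 2 - 1 - i = n + 1 - i by omega]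
  congr 1
  push_cast
  ring

/-! ### Products of two fermions of equal charge -/

theorem vertexOp_mul_swap (p : ℂ) {k : ℤ} (hk : k * k = 1) (i j : ℤ) :
    vertexOp p k i * vertexOp p k j = -(vertexOp p k j * vertexOp p k i) := by
  rw [vertexOp_mul_comm p (a := 1) (by simpa using hk)]
  simp

theorem vertexOp_square_locallyFinite (p : ℂ) {k : ℤ} (hk : k * k = 1) (f : ℤ → ℂ) (n : ℤ) :
    LocallyFiniteSum fun i => f i • (vertexOp p k i * vertexOp p k (n - i)) := by
  refine locallyFiniteSum_of_bounds (fun v => ?_) fun v => ?_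
  · obtain ⟨N, hN⟩ := vertexOp_bddBelow p k v
    refine ⟨N, fun i hi => ?_⟩
    rw [vertexOp_mul_swap p hk]
    simp [hN i hi]
  · obtain ⟨N, hN⟩ := vertexOp_bddBelow p k v
    refine ⟨n - N, fun i hi => ?_⟩
    simp [hN (n - i) (by omega)]

/-- The reflection `i ↦ n - i` changes the sign of every term by anticommutativity, so the sum
equals its own negative. -/
theorem vertexOp_square_sum (p : ℂ) {k : ℤ} (hk : k * k = 1) (n : ℤ) :
    LocHasSum (fun i => vertexOp p k i * vertexOp p k (n - i)) 0 := by
  have h := (vertexOp_square_locallyFinite p hk (fun _ => 1) n).locHasSum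
  simp only [one_smul] at h
  have h1 := h.unique ((h.reflect n).neg.congr fun i => by
    rw [sub_sub_cancel, vertexOp_mul_swap p hk, neg_neg])
  rw [eq_neg_iff_add_eq_zero, ← two_smul ℂ] at h1
  rwa [(smul_eq_zero.1 h1).resolve_left two_ne_zero] at h

/-- The product `:e^{kφ}:' :e^{kφ}:` is `:e^{2kφ}:` for `k = ±1`. -/
theorem vertexOp_square_sum_mul (p : ℂ) {k : ℤ} (hk : k * k = 1) (n : ℤ) :
    LocHasSum (fun i : ℤ => (i : ℂ) • (vertexOp p k i * vertexOp p k (n + 1 - i)))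
      (vertexOp p (2 * k) n) := by
  have hD := fun m => (vertexOp_square_locallyFinite p hk (fun i => (i : ℂ)) m).locHasSum
  set D : ℤ → Module.End ℂ Fock := fun m =>
    locSum fun i => (i : ℂ) • (vertexOp p k i * vertexOp p k (m - i)) with hDdef
  suffices H : D (n + 1) - vertexOp p (2 * k) (n + 1 - 1) = 0 by
    rw [add_sub_cancel_right, sub_eq_zero] at H
    rw [← H]
    exact hD (n + 1)
  have hw : ∀ s, vertexWeight (2 * k) s = 2 * vertexWeight k s := by
    intro s
    simp only [vertexWeight]
    split_ifs <;> simp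
  have hcomm : ∀ s m n, ⁅boson p s m, D n⁆ = (2 * vertexWeight k s) • D (n - m) := by
    intro s m n
    refine LocHasSum.unique ((hD n).comm_left _) ?_
    -- Shifting the weight `i` by `m` produces `m` times the unweighted sum, which is zero.
    have h1 := (hD (n - m)).add ((vertexOp_square_sum p hk (n - m)).smul (m : ℂ))
    have h2 := ((h1.shift (-m)).smul (vertexWeight k s)).add
      ((hD (n - m)).smul (vertexWeight k s))
    rw [smul_zero, add_zero, ← add_smul, ← two_mul] at h2
    refine h2.congr fun i => ?_
    rw [comm_smul, boson_comm_vertexOp_mul, ← sub_eq_add_neg,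
      show n - m - (i - m) = n - i by omega, show n - m - i = n - i - m by omega]
    push_cast
    module
  refine eq_zero_of_vac p (fun n : ℤ => D n - vertexOp p (2 * k) (n - 1)) ?_ ?_ (n + 1)
  · intro n s m _
    have : ⁅boson p s m, D n - vertexOp p (2 * k) (n - 1)⁆ =
        (2 * vertexWeight k s) • (D (n - m) - vertexOp p (2 * k) (n - m - 1)) := by
      rw [comm_sub, hcomm, boson_comm_vertexOp, hw, smul_sub, sub_right_comm n 1 m]
    simp only [this]
    exact Submodule.smul_mem _ _ (Submodule.subset_span ⟨n - m, rfl⟩)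
  · intro n c c'
    have h2pt := two_point p k k (fun M => (-1) ^ M * ((Nat.choose 1 M : ℕ) : ℂ)) (by simp)
      (fun M => by
        rw [choose_recursion]
        have : ((k : ℂ)) * k = 1 := by exact_mod_cast hk
        rw [this, Nat.cast_one])
    simp only [LinearMap.sub_apply, Finsupp.sub_apply, vertexOp_vac]
    have hkc : k * c ≠ k * c + 1 := by omega
    have e1 : (c' = c + 2 * k ∧ 2 * k * c = n - 1) ↔ (c' = c + k + k ∧ n = (k + k) * c + k * k) := by
      rw [hk]
      constructor <;> rintro ⟨h1, h2⟩ <;> refine ⟨by omega, by linear_combination -h2⟩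
    -- The two-point function is that of `z - w`, with two nonzero coefficients, so only two indices
    -- contribute.
    rw [(hD n).coord_eq_sum _ _ {k * c, k * c + 1}, Finset.sum_pair hkc]
    · simp only [LinearMap.smul_apply, Module.End.mul_apply, Finsupp.smul_apply, h2pt,
        add_sub_cancel, smul_eq_mul, e1]
      by_cases h : c' = c + k + k ∧ n = (k + k) * c + k * k
      · have hn : n = k * c + k * c + 1 := by rw [h.2, hk]; ring
        have e2 : n - k * c - k * c = 1 := by omega
        have e3 : n - (k * c + 1) - k * c = 0 := by omega
        rw [if_pos ⟨h.1, h.2, by omega⟩, if_pos ⟨h.1, h.2, by omega⟩, if_pos h, e2, e3]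
        simp
      · rw [if_neg (fun h' => h ⟨h'.1, h'.2.1⟩), if_neg (fun h' => h ⟨h'.1, h'.2.1⟩), if_neg h]
        simp
    · intro i hi
      simp only [Finset.mem_insert, Finset.mem_singleton, not_or] at hi
      simp only [LinearMap.smul_apply, Module.End.mul_apply, Finsupp.smul_apply, h2pt,
        add_sub_cancel]
      split_ifs with h
      · have hn : n = k * c + k * c + 1 := by rw [h.2.1, hk]; ring
        rw [Nat.choose_eq_zero_of_lt (by omega)]
        simp
      · simp

/-! ### The fermions -/

theorem rtTwo_mul_self : rtTwo * rtTwo = 2 := by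
  rw [rtTwo, ← Complex.ofReal_mul, Real.mul_self_sqrt (by norm_num)]
  norm_num

theorem rtTwo_ne_zero : rtTwo ≠ 0 := fun h => by
  have := rtTwo_mul_self
  rw [h] at this
  norm_num at this

theorem rtTwo_inv_sq : rtTwo⁻¹ * rtTwo⁻¹ = 1 / 2 := by
  rw [← mul_inv, rtTwo_mul_self, one_div]

theorem I_rtTwo_inv_sq : (Complex.I * rtTwo)⁻¹ * (Complex.I * rtTwo)⁻¹ = -(1 / 2) := by
  rw [mul_inv, mul_mul_mul_comm, rtTwo_inv_sq, ← mul_inv, Complex.I_mul_I]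
  norm_num

theorem rtTwo_inv_mul : rtTwo⁻¹ * (Complex.I * rtTwo)⁻¹ = -(Complex.I / 2) := by
  rw [mul_inv, mul_left_comm, rtTwo_inv_sq, Complex.inv_I]
  ring

theorem psi_apply (p : ℂ) (i : ℤ) :
    psi p i = (Complex.I * rtTwo)⁻¹ • (vertexOp p 1 i - vertexOp p (-1) i) := rfl

theorem psit_apply (p : ℂ) (i : ℤ) :
    psit p i = rtTwo⁻¹ • (vertexOp p 1 i + vertexOp p (-1) i) := rfl

theorem psi_bddBelow (p : ℂ) : BddBelowField (psi p) :=
  ((vertexOp_bddBelow p 1).sub (vertexOp_bddBelow p (-1))).smul _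

theorem psit_bddBelow (p : ℂ) : BddBelowField (psit p) :=
  ((vertexOp_bddBelow p 1).add (vertexOp_bddBelow p (-1))).smul _

theorem vertexOp_one_swap (p : ℂ) (i j : ℤ) :
    vertexOp p 1 i * vertexOp p 1 j = -(vertexOp p 1 j * vertexOp p 1 i) :=
  vertexOp_mul_swap p (by norm_num) i j

theorem vertexOp_neg_one_swap (p : ℂ) (i j : ℤ) :
    vertexOp p (-1) i * vertexOp p (-1) j = -(vertexOp p (-1) j * vertexOp p (-1) i) :=
  vertexOp_mul_swap p (by norm_num) i j

theorem vertexOp_pair_swap (p : ℂ) (i j : ℤ) :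
    vertexOp p 1 i * vertexOp p (-1) j =
      (if i + j = -1 then 1 else 0) - vertexOp p (-1) j * vertexOp p 1 i :=
  eq_sub_of_add_eq (vertexOp_anticomm p (by norm_num) i j)

theorem psi_anticomm (p : ℂ) (i j : ℤ) :
    psi p i * psi p j + psi p j * psi p i = if i + j = -1 then 1 else 0 := by
  simp only [psi_apply, smul_mul_smul_comm, I_rtTwo_inv_sq, ← smul_add, mul_sub, sub_mul]
  rw [vertexOp_one_swap p i j, vertexOp_neg_one_swap p i j, vertexOp_pair_swap p i j,
    vertexOp_pair_swap p j i, add_comm j i]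
  split_ifs <;> module

theorem psit_anticomm (p : ℂ) (i j : ℤ) :
    psit p i * psit p j + psit p j * psit p i = if i + j = -1 then 1 else 0 := by
  simp only [psit_apply, smul_mul_smul_comm, rtTwo_inv_sq, ← smul_add, mul_add, add_mul]
  rw [vertexOp_one_swap p i j, vertexOp_neg_one_swap p i j, vertexOp_pair_swap p i j,
    vertexOp_pair_swap p j i, add_comm j i]
  split_ifs <;> module

theorem psit_mul_psi (p : ℂ) (i j : ℤ) : psit p i * psi p j = -(psi p j * psit p i) := by
  simp only [psi_apply, psit_apply, smul_mul_smul_comm, rtTwo_inv_mul,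
    mul_comm (Complex.I * rtTwo)⁻¹, mul_add, add_mul, mul_sub, sub_mul]
  rw [vertexOp_one_swap p i j, vertexOp_neg_one_swap p i j, vertexOp_pair_swap p i j,
    vertexOp_pair_swap p j i, add_comm j i]
  split_ifs <;> module

theorem boson_true_comm_psi (p : ℂ) (n i : ℤ) : ⁅boson p true n, psi p i⁆ = 0 := by
  rw [psi_apply, comm_smul, comm_sub, boson_comm_vertexOp, boson_comm_vertexOp]
  simp [vertexWeight]

theorem boson_true_comm_psit (p : ℂ) (n i : ℤ) : ⁅boson p true n, psit p i⁆ = 0 := by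
  rw [psit_apply, comm_smul, comm_add, boson_comm_vertexOp, boson_comm_vertexOp]
  simp [vertexWeight]

/-- Separates the parts of charge `±2`, which anticommute and need no ordering, from the neutral
parts, where fermionic ordering matches `chargedNormal` under `i = -r - 1`. -/
theorem fermiNormal_psi (p : ℂ) (r t : ℤ) : fermiNormal (psi p) r t = (-(1 / 2) : ℂ) •
    (vertexOp p 1 (-r - 1) * vertexOp p 1 (-t - 1) +
      vertexOp p (-1) (-r - 1) * vertexOp p (-1) (-t - 1) -
      chargedNormal p 1 (-r - 1) (-t - 1) - chargedNormal p (-1) (-r - 1) (-t - 1)) := by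
  rw [fermiNormal, chargedNormal, chargedNormal, neg_neg]
  simp only [fermiMode, psi_apply, smul_mul_smul_comm, I_rtTwo_inv_sq, mul_sub, sub_mul]
  by_cases h : r ≤ t
  · rw [if_pos h, if_pos (by omega), if_pos (by omega)]
    module
  · rw [if_neg h, if_neg (by omega), if_neg (by omega), vertexOp_one_swap p (-r - 1),
      vertexOp_neg_one_swap p (-r - 1)]
    module

theorem fermiNormal_psit (p : ℂ) (r t : ℤ) : fermiNormal (psit p) r t = (1 / 2 : ℂ) •
    (vertexOp p 1 (-r - 1) * vertexOp p 1 (-t - 1) +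
      vertexOp p (-1) (-r - 1) * vertexOp p (-1) (-t - 1) +
      chargedNormal p 1 (-r - 1) (-t - 1) + chargedNormal p (-1) (-r - 1) (-t - 1)) := by
  rw [fermiNormal, chargedNormal, chargedNormal, neg_neg]
  simp only [fermiMode, psit_apply, smul_mul_smul_comm, rtTwo_inv_sq, mul_add, add_mul]
  by_cases h : r ≤ t
  · rw [if_pos h, if_pos (by omega), if_pos (by omega)]
    module
  · rw [if_neg h, if_neg (by omega), if_neg (by omega), vertexOp_one_swap p (-r - 1),
      vertexOp_neg_one_swap p (-r - 1)]
    module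

theorem square_sums (p : ℂ) (n : ℤ) :
    LocHasSum (fun i : ℤ => (i : ℂ) • (vertexOp p 1 i * vertexOp p 1 (n + 1 - i) +
      vertexOp p (-1) i * vertexOp p (-1) (n + 1 - i))) (vertexOp p 2 n + vertexOp p (-2) n) := by
  have h1 := vertexOp_square_sum_mul p (k := 1) (by norm_num) n
  have h2 := vertexOp_square_sum_mul p (k := -1) (by norm_num) n
  exact (h1.add h2).congr fun i => by rw [smul_add]

theorem charged_sums (p : ℂ) (n : ℤ) :
    LocHasSum (fun i : ℤ => (i : ℂ) • (chargedNormal p 1 i (n + 1 - i) +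
      chargedNormal p (-1) i (n + 1 - i))) (bosonPair p false false (-n - 2)) := by
  have h1 := chargedNormal_sum_mul p (k := 1) (by norm_num) n
  have h2 := chargedNormal_sum_mul p (k := -1) (by norm_num) n
  have h3 := (h1.add h2).congr (fun i => (smul_add _ _ _).symm)
  convert h3 using 1
  push_cast
  module

theorem fermiTerm_psi_hasSum (p : ℂ) (n : ℤ) : LocHasSum (fermiTerm (psi p) n)
    ((1 / 2 : ℂ) • (bosonPair p false false (-n - 2) - (vertexOp p 2 n + vertexOp p (-2) n))) := by
  have h := (((charged_sums p n).sub (square_sums p n)).smul (1 / 2)).reflect (-1)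
  refine h.congr fun r => ?_
  rw [fermiTerm, fermiNormal_psi, show -(-n - 3 - r) - 1 = n + 1 - (-1 - r) by omega,
    show -r - 1 = -1 - r by omega]
  push_cast
  module

theorem fermiTerm_psit_hasSum (p : ℂ) (n : ℤ) : LocHasSum (fermiTerm (psit p) n)
    ((1 / 2 : ℂ) • (bosonPair p false false (-n - 2) + (vertexOp p 2 n + vertexOp p (-2) n))) := by
  have h := (((charged_sums p n).add (square_sums p n)).smul (1 / 2)).reflect (-1)
  refine h.congr fun r => ?_
  rw [fermiTerm, fermiNormal_psit, show -(-n - 3 - r) - 1 = n + 1 - (-1 - r) by omega,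
    show -r - 1 = -1 - r by omega]
  push_cast
  module

theorem fermiBilinear_psi (p : ℂ) (n : ℤ) : fermiBilinear (psi p) n =
    (1 / 2 : ℂ) • (bosonPair p false false (-n - 2) - (vertexOp p 2 n + vertexOp p (-2) n)) :=
  (fermiTerm_psi_hasSum p n).locSum_eq

theorem fermiBilinear_psit (p : ℂ) (n : ℤ) : fermiBilinear (psit p) n =
    (1 / 2 : ℂ) • (bosonPair p false false (-n - 2) + (vertexOp p 2 n + vertexOp p (-2) n)) :=
  (fermiTerm_psit_hasSum p n).locSum_eq

theorem psit_psi_charged (p : ℂ) (i j : ℤ) : psit p i * psi p j = (-(Complex.I / 2)) •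
    (vertexOp p 1 i * vertexOp p 1 j - vertexOp p (-1) i * vertexOp p (-1) j -
      chargedNormal p 1 i j + chargedNormal p (-1) i j) := by
  rw [chargedNormal_eq p (by norm_num), chargedNormal_eq p (by norm_num), neg_neg]
  simp only [psi_apply, psit_apply, smul_mul_smul_comm, rtTwo_inv_mul, add_mul, mul_sub]
  module

/-- Bosonization: `ψ̃(z) ψ(z) = i φ'(z)`. -/
theorem psit_psi_hasSum (p : ℂ) (n : ℤ) :
    LocHasSum (fun i => psit p i * psi p (n - i)) (Complex.I • boson p false (-n - 1)) := by
  have h1 := vertexOp_square_sum p (k := 1) (by norm_num) n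
  have h2 := vertexOp_square_sum p (k := -1) (by norm_num) n
  have h3 := chargedNormal_sum p (k := 1) (by norm_num) n
  have h4 := chargedNormal_sum p (k := -1) (by norm_num) n
  have h5 := ((((h1.sub h2).sub h3).add h4).smul (-(Complex.I / 2))).congr
    fun i => (psit_psi_charged p i (n - i)).symm
  convert h5 using 1
  push_cast
  module

/-- Bosonization of `ψ̃(z) ψ'(z)`. -/
theorem psit_psi_deriv_hasSum (p : ℂ) (n : ℤ) :
    LocHasSum (fun i => psit p i * derivField (psi p) (n - i))
      ((Complex.I / 2) • (vertexOp p 2 n - vertexOp p (-2) n +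
        ((n : ℂ) + 1) • boson p false (-n - 2))) := by
  have h0 := psit_psi_hasSum p (n + 1)
  have h1 := vertexOp_square_sum_mul p (k := 1) (by norm_num) n
  have h2 := vertexOp_square_sum_mul p (k := -1) (by norm_num) n
  have h3 := chargedNormal_sum_mul p (k := 1) (by norm_num) n
  have h4 := chargedNormal_sum_mul p (k := -1) (by norm_num) n
  have h5 := (h0.smul ((n : ℂ) + 1)).sub
    ((((h1.sub h2).sub h3).add h4).smul (-(Complex.I / 2)))
  have h6 := h5.congr (g := fun i => psit p i * derivField (psi p) (n - i)) fun i => by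
    rw [derivField, mul_smul_comm, show n - i + 1 = n + 1 - i by omega, psit_psi_charged]
    push_cast
    module
  convert h6 using 1
  rw [show -(n + 1) - 1 = -n - 2 by omega]
  norm_num
  module

/-! ### The supercurrent -/

theorem dphi_mul_psi (p : ℂ) (k j : ℤ) : dphi p true k * psi p j = psi p j * dphi p true k :=
  mul_eq_of_comm_eq_zero (boson_true_comm_psi p _ j)

theorem psit_mul_dphi (p : ℂ) (i k : ℤ) : psit p i * dphi p true k = dphi p true k * psit p i :=
  (mul_eq_of_comm_eq_zero (boson_true_comm_psit p _ i)).symm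

theorem dphi_psi_mulExists (p : ℂ) : MulExists (dphi p true) (psi p) := by
  refine mulExists_of_bounds (psi_bddBelow p) fun n v => ?_
  obtain ⟨N, hN⟩ := dphi_bddBelow p true v
  exact ⟨N, fun i hi => by
    rw [← Module.End.mul_apply, dphi_mul_psi, Module.End.mul_apply, hN i hi, map_zero]⟩

theorem dphi_psi_bddBelow (p : ℂ) : BddBelowField (mulField (dphi p true) (psi p)) := by
  intro v
  obtain ⟨N, hN⟩ := dphi_bddBelow p true v
  obtain ⟨M, hM⟩ := psi_bddBelow p v
  refine ⟨N + M, fun n hn => ((dphi_psi_mulExists p).locHasSum n).apply_eq_zero v fun i => ?_⟩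
  rcases lt_or_ge i N with hi | hi
  · rw [dphi_mul_psi, Module.End.mul_apply, hN i hi, map_zero]
  · rw [Module.End.mul_apply, hM _ (by omega), map_zero]

theorem currentG_apply (β rβ p : ℂ) (n : ℤ) : currentG β rβ p n =
    mulField (dphi p true) (psi p) n + (2 * sigma β rβ) • derivField (psi p) n := rfl

theorem currentG_bddBelow (β rβ p : ℂ) : BddBelowField (currentG β rβ p) := by
  refine (dphi_psi_bddBelow p).add (BddBelowField.smul (fun v => ?_) _)
  obtain ⟨N, hN⟩ := psi_bddBelow p v
  exact ⟨N - 1, fun n hn => by simp [derivField, hN (n + 1) (by omega)]⟩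

theorem psit_mul_currentG (β rβ p : ℂ) (i n : ℤ) :
    psit p i * currentG β rβ p n = -(currentG β rβ p n * psit p i) := by
  have h : psit p i * mulField (dphi p true) (psi p) n =
      -(mulField (dphi p true) (psi p) n * psit p i) := by
    have h1 := (dphi_psi_mulExists p).locHasSum n
    refine (h1.mul_left (psit p i)).unique ((h1.mul_right (psit p i)).neg.congr fun k => ?_)
    rw [← mul_assoc (psit p i), psit_mul_dphi, mul_assoc (dphi p true k) (psit p i), psit_mul_psi,
      mul_neg, mul_assoc]
  rw [currentG_apply, mul_add, add_mul, h, derivField, mul_smul_comm, mul_smul_comm, psit_mul_psi,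
    smul_mul_assoc, smul_mul_assoc]
  module

theorem psit_currentG_mulExists (β rβ p : ℂ) : MulExists (psit p) (currentG β rβ p) := by
  refine mulExists_of_bounds (currentG_bddBelow β rβ p) fun n v => ?_
  obtain ⟨N, hN⟩ := psit_bddBelow p v
  exact ⟨N, fun i hi => by
    rw [← Module.End.mul_apply, psit_mul_currentG, LinearMap.neg_apply, Module.End.mul_apply,
      hN i hi, map_zero, neg_zero]⟩

/-- Associativity of a triple product. The three fields commute or anticommute, so each bounds its
own index from below and the double sum is locally finite. Summing over the index of `ψ̃` first
gives the bosonization of `ψ̃ψ`, over that of `φ̃'` first the product on the left. -/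
theorem psit_dphi_psi_hasSum (p : ℂ) (n : ℤ) :
    LocHasSum (fun i => psit p i * mulField (dphi p true) (psi p) (n - i))
      (Complex.I • bosonPair p true false (-n - 2)) := by
  have hfin : ∀ v, (Function.support fun x : ℤ × ℤ =>
      (psit p x.1 * (dphi p true x.2 * psi p (n - x.1 - x.2))) v).Finite := by
    intro v
    obtain ⟨N, hN⟩ := psit_bddBelow p v
    obtain ⟨M, hM⟩ := dphi_bddBelow p true v
    obtain ⟨L, hL⟩ := psi_bddBelow p v
    refine ((Set.finite_Icc N (n - M - L)).prod (Set.finite_Icc M (n - N - L))).subset ?_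
    rintro ⟨i, k⟩ hx
    have h1 : N ≤ i := by
      by_contra hc
      refine hx ?_
      change (psit p i * (dphi p true k * psi p (n - i - k))) v = 0
      rw [← mul_assoc, psit_mul_dphi, mul_assoc, psit_mul_psi]
      simp [hN i (by omega)]
    have h2 : M ≤ k := by
      by_contra hc
      refine hx ?_
      change (psit p i * (dphi p true k * psi p (n - i - k))) v = 0
      rw [dphi_mul_psi]
      simp [hM k (by omega)]
    have h3 : L ≤ n - i - k := by
      by_contra hc
      refine hx ?_
      simp [hL (n - i - k) (by omega)]
    simp only [Set.mem_prod, Set.mem_Icc]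
    omega
  have hX := locHasSum_ofBasis hfin
  set X := ofBasis fun b => ∑ᶠ x : ℤ × ℤ,
    (psit p x.1 * (dphi p true x.2 * psi p (n - x.1 - x.2))) (ket b)
  have h1 := hX.curry fun i => ((dphi_psi_mulExists p).locHasSum (n - i)).mul_left (psit p i)
  have h2 : LocHasSum (fun k => dphi p true k * (Complex.I • boson p false (-(n - k) - 1))) X := by
    refine (hX.reindex (Equiv.prodComm ℤ ℤ)).curry fun k => ?_
    refine ((psit_psi_hasSum p (n - k)).mul_left (dphi p true k)).congr fun i => ?_
    simp only [Equiv.prodComm_apply, Prod.swap_prod_mk]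
    rw [← mul_assoc, ← mul_assoc, psit_mul_dphi, show n - k - i = n - i - k by omega]
  have h3 := ((bosonPair_hasSum p true false (-n - 2)).smul Complex.I).reflect (-1)
  have h4 := h2.unique (h3.congr fun k => ?_)
  · rw [h4] at h1
    exact h1
  · have hc : boson p true (-1 - k) * boson p false (-n - 2 - (-1 - k)) =
        boson p false (-n - 2 - (-1 - k)) * boson p true (-1 - k) :=
      mul_eq_of_comm_eq_zero (by rw [boson_lie_boson, if_neg (by simp)])
    rw [bosonPairTerm, ← hc, ite_self, dphi, mul_smul_comm,
      show -n - 2 - (-1 - k) = -(n - k) - 1 by omega, show -1 - k = -k - 1 by omega]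

theorem psit_currentG_eq (β rβ p : ℂ) (n : ℤ) : mulField (psit p) (currentG β rβ p) n =
    Complex.I • bosonPair p true false (-n - 2) + (Complex.I * sigma β rβ) •
      (vertexOp p 2 n - vertexOp p (-2) n + ((n : ℂ) + 1) • boson p false (-n - 2)) := by
  refine ((psit_currentG_mulExists β rβ p).locHasSum n).unique ?_
  have h := (psit_dphi_psi_hasSum p n).add
    ((psit_psi_deriv_hasSum p n).smul (2 * sigma β rβ))
  rw [smul_smul, show 2 * sigma β rβ * (Complex.I / 2) = Complex.I * sigma β rβ by ring] at h
  exact h.congr fun i => by rw [currentG_apply, mul_add, mul_smul_comm]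

theorem currentT_eq (β rβ p : ℂ) (n : ℤ) : currentT β rβ p n =
    (1 / 2 : ℂ) • bosonPair p true true (-n - 2) +
      (sigma β rβ * ((n : ℂ) + 1)) • boson p true (-n - 2) +
      (1 / 2 : ℂ) • fermiBilinear (psi p) n := by
  have : currentT β rβ p n = (1 / 2 : ℂ) • bosonSq p n +
      sigma β rβ • derivField (dphi p true) n + (1 / 2 : ℂ) • fermiBilinear (psi p) n := rfl
  rw [this, bosonSq_eq, derivField, dphi, smul_smul, show -(n + 1) - 1 = -n - 2 by omega]

/-- Bosonization of `𝖳(x; z)`. -/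
theorem sfT_eq {β rβ : ℂ} (hβ : β ≠ 0) (hr : rβ ^ 2 = β) (p x : ℂ) (n : ℤ) :
    (2 * β) • sfT β rβ p x n = x ^ 2 • bosonPair p false false (-n - 2) +
      (2 * x * rβ) • bosonPair p true false (-n - 2) + β • bosonPair p true true (-n - 2) +
      ((1 - β) * ((n : ℂ) + 1)) • (x • boson p false (-n - 2) + rβ • boson p true (-n - 2)) +
      ((1 + x) * (x - β)) • vertexOp p 2 n + ((x - 1) * (x + β)) • vertexOp p (-2) n := by
  have hrβ : rβ ≠ 0 := by
    rintro rfl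
    exact hβ (by rw [← hr]; simp)
  have h : sfT β rβ p x n = currentT β rβ p n + (x ^ 2 / β - 1 / 2) • fermiBilinear (psit p) n +
      (x / (Complex.I * rβ)) • mulField (psit p) (currentG β rβ p) n := rfl
  rw [h, currentT_eq, fermiBilinear_psi, fermiBilinear_psit, psit_currentG_eq, sigma]
  have hI := Complex.I_ne_zero
  have hI2 := Complex.I_sq
  subst hr
  match_scalars <;> field_simp <;> ring_nf

/-! ### Virasoro algebras built from the two bosons -/

/-- The modes of a linear combination of the two bosons. -/
def current (p : ℂ) (u : Bool → ℂ) (n : ℤ) : Module.End ℂ Fock :=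
  u false • boson p false n + u true • boson p true n

/-- The bilinear form on linear combinations of the two bosons. -/
def dot (u w : Bool → ℂ) : ℂ := u false * w false + u true * w true

/-- The terms of the normally ordered square of a current. -/
def quadTerm (p : ℂ) (u : Bool → ℂ) (n l : ℤ) : Module.End ℂ Fock :=
  if l < 0 then current p u l * current p u (n - l) else current p u (n - l) * current p u l

/-- The modes of the normally ordered square of a current. -/
def quad (p : ℂ) (u : Bool → ℂ) (n : ℤ) : Module.End ℂ Fock :=
  u false ^ 2 • bosonPair p false false n + (2 * u false * u true) • bosonPair p true false n +
    u true ^ 2 • bosonPair p true true n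

theorem bosonPair_swap (p : ℂ) (n : ℤ) : bosonPair p false true n = bosonPair p true false n := by
  rw [← sub_eq_zero]
  refine eq_zero_of_comm_of_vac p _ (fun s m _ => ?_) fun c c' => ?_
  · rw [comm_sub, boson_comm_bosonPair, boson_comm_bosonPair]
    abel
  · rw [LinearMap.sub_apply, Finsupp.sub_apply, bosonPair_vac, bosonPair_vac,
      mul_comm (zeroValue p c false), sub_self]

theorem quad_hasSum (p : ℂ) (u : Bool → ℂ) (n : ℤ) : LocHasSum (quadTerm p u n) (quad p u n) := by
  have h := ((((bosonPair_hasSum p false false n).smul (u false ^ 2)).add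
    ((bosonPair_hasSum p false true n).smul (u false * u true))).add
    ((bosonPair_hasSum p true false n).smul (u false * u true))).add
    ((bosonPair_hasSum p true true n).smul (u true ^ 2))
  have e : quad p u n = u false ^ 2 • bosonPair p false false n +
      (u false * u true) • bosonPair p false true n +
      (u false * u true) • bosonPair p true false n + u true ^ 2 • bosonPair p true true n := by
    rw [bosonPair_swap, quad]
    module
  rw [e]
  refine h.congr fun l => ?_
  simp only [quadTerm, bosonPairTerm, current]
  split_ifs <;>
  · simp only [add_mul, mul_add, smul_mul_assoc, mul_smul_comm]
    module

theorem boson_comm_current (p : ℂ) (u : Bool → ℂ) (s : Bool) (m n : ℤ) :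
    ⁅boson p s m, current p u n⁆ = if n = -m then ((m : ℂ) * u s) • 1 else 0 := by
  rw [current, comm_add, comm_smul, comm_smul, boson_lie_boson_ite, boson_lie_boson_ite]
  split_ifs <;> cases s <;> simp_all [smul_smul, mul_comm]

theorem current_comm_current (p : ℂ) (u w : Bool → ℂ) (m n : ℤ) :
    ⁅current p u m, current p w n⁆ = if n = -m then ((m : ℂ) * dot u w) • 1 else 0 := by
  rw [current, add_comm_right, smul_comm_right, smul_comm_right, boson_comm_current,
    boson_comm_current, dot]
  split_ifs
  · module
  · simp

theorem boson_comm_quad (p : ℂ) (u : Bool → ℂ) (s : Bool) (m n : ℤ) :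
    ⁅boson p s m, quad p u n⁆ = (2 * (m : ℂ) * u s) • current p u (n + m) := by
  simp only [quad, comm_add, comm_smul, boson_comm_bosonPair, current]
  cases s <;> simp <;> module

theorem quad_comm_current (p : ℂ) (u w : Bool → ℂ) (n m : ℤ) :
    ⁅quad p u n, current p w m⁆ = (-2 * (m : ℂ) * dot u w) • current p u (n + m) := by
  rw [comm_swap, current, add_comm_right, smul_comm_right, smul_comm_right, boson_comm_quad,
    boson_comm_quad, dot]
  module

theorem quad_comm_quad_of_dot_eq_zero (p : ℂ) {u w : Bool → ℂ} (h : dot u w = 0) (n m : ℤ) :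
    ⁅quad p u n, quad p w m⁆ = 0 := by
  have hJ : ∀ l, ⁅quad p u n, current p w l⁆ = 0 := fun l => by
    rw [quad_comm_current, h, mul_zero, zero_smul]
  refine ((quad_hasSum p w m).comm_left _).unique (LocHasSum.zero.congr fun l => ?_)
  rw [quadTerm]
  split_ifs <;> rw [comm_mul, hJ, hJ, zero_mul, mul_zero, add_zero]

/-- The eigenvalue of the zero mode of a current on a vacuum vector. -/
def currentValue (p : ℂ) (u : Bool → ℂ) (c : ℤ) : ℂ := u false * c + u true * p

theorem current_zero_vac (p : ℂ) (u : Bool → ℂ) (c : ℤ) :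
    current p u 0 (ket (c, 0)) = currentValue p u c • ket (c, 0) := by
  simp only [current, LinearMap.add_apply, LinearMap.smul_apply, boson_zero_vac, zeroValue,
    currentValue, smul_smul, add_smul]
  simp

theorem current_neg_apply_vac (p : ℂ) (u : Bool → ℂ) {n : ℤ} (hn : n < 0) (v : Fock) (c : ℤ) :
    current p u n v (c, 0) = 0 := by
  simp [current, boson_neg_apply_vac p _ hn]

theorem current_pos_vac (p : ℂ) (u : Bool → ℂ) {n : ℤ} (hn : 0 < n) (c : ℤ) :
    current p u n (ket (c, 0)) = 0 := by
  simp [current, boson_pos_vac p _ hn]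

theorem current_vac (p : ℂ) (u : Bool → ℂ) (n c c' : ℤ) : current p u n (ket (c, 0)) (c', 0) =
    if c' = c ∧ n = 0 then currentValue p u c else 0 := by
  simp only [current, LinearMap.add_apply, LinearMap.smul_apply, Finsupp.add_apply,
    Finsupp.smul_apply, boson_vac_coord, zeroValue, currentValue, smul_eq_mul]
  by_cases h : c' = c ∧ n = 0 <;> simp [h]

theorem current_current_vac (p : ℂ) (u : Bool → ℂ) {m : ℤ} (n c c' : ℤ) (hm : m < 0) :
    current p u n (current p u m (ket (c, 0))) (c', 0) =
      if c' = c ∧ n + m = 0 then (n : ℂ) * dot u u else 0 := by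
  rcases lt_or_ge 0 n with h | h
  · have e : current p u n * current p u m =
        ⁅current p u n, current p u m⁆ + current p u m * current p u n := by
      rw [Ring.lie_def]; abel
    rw [← Module.End.mul_apply, e, current_comm_current, LinearMap.add_apply,
      Module.End.mul_apply, current_pos_vac p u h, map_zero, add_zero, ite_smul_one_vac]
    refine if_congr ?_ rfl rfl
    omega
  · rw [if_neg (by omega)]
    rcases h.lt_or_eq with h | h
    · exact current_neg_apply_vac p u h _ _
    · subst h
      have e : current p u 0 * current p u m = current p u m * current p u 0 :=
        mul_eq_of_comm_eq_zero (by
          rw [current_comm_current, if_neg (by omega)])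
      rw [← Module.End.mul_apply, e, Module.End.mul_apply, current_neg_apply_vac p u hm]

theorem quad_neg_apply_vac (p : ℂ) (u : Bool → ℂ) {n : ℤ} (hn : n < 0) (v : Fock) (c : ℤ) :
    quad p u n v (c, 0) = 0 := by
  refine (quad_hasSum p u n).coord_eq_zero _ _ fun l => ?_
  rw [quadTerm]
  split_ifs with h <;> rw [Module.End.mul_apply]
  · exact current_neg_apply_vac p u h _ _
  · exact current_neg_apply_vac p u (by omega) _ _

theorem quad_pos_vac (p : ℂ) (u : Bool → ℂ) {n : ℤ} (hn : 0 < n) (c : ℤ) :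
    quad p u n (ket (c, 0)) = 0 := by
  refine (quad_hasSum p u n).apply_eq_zero _ fun l => ?_
  rw [quadTerm]
  split_ifs with h <;> rw [Module.End.mul_apply]
  · rw [current_pos_vac p u (by omega), map_zero]
  · rcases (not_lt.1 h).lt_or_eq with h | h
    · rw [current_pos_vac p u h, map_zero]
    · rw [← h, current_zero_vac, map_smul, current_pos_vac p u (by omega), smul_zero]

theorem quad_zero_vac (p : ℂ) (u : Bool → ℂ) (c : ℤ) :
    quad p u 0 (ket (c, 0)) = currentValue p u c ^ 2 • ket (c, 0) := by
  rw [(quad_hasSum p u 0).apply_eq_single _ 0]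
  · rw [quadTerm, if_neg (lt_irrefl _), Module.End.mul_apply, current_zero_vac, map_smul, sub_zero,
      current_zero_vac, smul_smul, sq]
  · intro l hl
    rw [quadTerm]
    split_ifs with h <;> rw [Module.End.mul_apply]
    · rw [current_pos_vac p u (by omega), map_zero]
    · rw [current_pos_vac p u (by omega), map_zero]

theorem current_zero_apply (p : ℂ) (u : Bool → ℂ) (v : Fock) (b : FockIndex) :
    current p u 0 v b = currentValue p u b.1 * v b := by
  have h : boson p true 0 v b = p * v b := rfl
  simp only [current, LinearMap.add_apply, LinearMap.smul_apply, Finsupp.add_apply,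
    Finsupp.smul_apply, charge_apply, h, currentValue, smul_eq_mul]
  ring

theorem quad_zero_apply_vac (p : ℂ) (u : Bool → ℂ) (v : Fock) (c : ℤ) :
    quad p u 0 v (c, 0) = currentValue p u c ^ 2 * v (c, 0) := by
  rw [(quad_hasSum p u 0).coord_eq_single _ _ 0]
  · rw [quadTerm, if_neg (lt_irrefl _), Module.End.mul_apply, sub_zero, current_zero_apply,
      current_zero_apply]
    ring
  · intro l hl
    rw [quadTerm]
    split_ifs with h <;> rw [Module.End.mul_apply]
    · exact current_neg_apply_vac p u h _ _
    · exact current_neg_apply_vac p u (by omega) _ _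

theorem sum_Icc_telescope (g : ℤ → ℂ) {a b : ℤ} (h : a ≤ b) :
    ∑ l ∈ Finset.Icc a b, (g (l + 1) - g l) = g (b + 1) - g a := by
  induction b, h using Int.leInduction with
  | base => simp
  | succ b hb ih =>
    have e : Finset.Icc a (b + 1) = insert (b + 1) (Finset.Icc a b) := by
      ext x; simp only [Finset.mem_Icc, Finset.mem_insert]; omega
    rw [e, Finset.sum_insert (by simp), ih]
    ring

/-- The mode `quad p u n` kills the vacuum and is moved to the right. The interior terms contract
fully and give the quadratic weight `l(n + l)`; the two ends `l = 0` and `l = m` involve the zero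
mode and give the momentum terms. -/
theorem quad_quad_term_vac (p : ℂ) (u : Bool → ℂ) {n m : ℤ} (hm : m < 0) {l : ℤ}
    (hl : l ∈ Finset.Icc m 0) (hn : 0 < n) (c c' : ℤ) :
    (quad p u n * quadTerm p u m l) (ket (c, 0)) (c', 0) = if c' = c ∧ n + m = 0 then
      ((if l = 0 then 2 * n * dot u u * currentValue p u c ^ 2 else 0) +
        (if l = m then 2 * n * dot u u * currentValue p u c ^ 2 else 0) +
        -2 * dot u u ^ 2 * l * (n + l)) else 0 := by
  rw [Finset.mem_Icc] at hl
  have key : ∀ i, quad p u n * current p u i =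
      (-2 * (i : ℂ) * dot u u) • current p u (n + i) + current p u i * quad p u n := fun i => by
    rw [← quad_comm_current, Ring.lie_def]; abel
  have key' : ∀ i v, quad p u n (current p u i v) =
      (-2 * (i : ℂ) * dot u u) • current p u (n + i) v + current p u i (quad p u n v) :=
    fun i v => by
      rw [← Module.End.mul_apply, key]; rfl
  have zero_case : quad p u n (current p u m (current p u 0 (ket (c, 0)))) (c', 0) =
      if c' = c ∧ n + m = 0 then 2 * n * dot u u * currentValue p u c ^ 2 else 0 := by
    rw [key', current_zero_vac, map_smul, map_smul, map_smul, quad_pos_vac p u hn]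
    simp only [smul_zero, map_zero, add_zero, Finsupp.smul_apply, current_vac, smul_eq_mul]
    split_ifs with h
    · have : (m : ℂ) = -n := by rw [eq_neg_iff_add_eq_zero, add_comm]; exact_mod_cast h.2
      rw [this]; ring
    · ring
  rcases hl.2.lt_or_eq with h0 | rfl
  · rw [Module.End.mul_apply, quadTerm, if_pos h0, if_neg h0.ne, Module.End.mul_apply]
    rcases hl.1.lt_or_eq with h1 | rfl
    · have hlm : (l + (m - l)) = m := by omega
      rw [key', Finsupp.add_apply, current_neg_apply_vac p u h0, Finsupp.smul_apply,
        current_current_vac p u _ _ _ (by omega), if_neg h1.ne', show n + l + (m - l) = n + m by omega]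
      split_ifs
      · push_cast
        rw [smul_eq_mul]; ring
      · simp
    · rw [sub_self, zero_case, if_pos rfl]
      split_ifs with h
      · have : (n : ℂ) + m = 0 := by exact_mod_cast h.2
        rw [this]; ring
      · rfl
  · rw [Module.End.mul_apply, quadTerm, if_neg (lt_irrefl _), Module.End.mul_apply, sub_zero,
      zero_case, if_pos rfl, if_neg hm.ne']
    simp

theorem sum_Icc_cubic {n : ℤ} (hn : 0 < n) :
    ∑ l ∈ Finset.Icc (-n) 0, ((l : ℂ) * (n + l)) = -((n : ℂ) ^ 3 - n) / 6 := by
  -- A discrete antiderivative of `l(n + l)`, assembled from those of `l` and of `l²`.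
  have h := sum_Icc_telescope (fun l : ℤ => (n : ℂ) * (l * (l - 1) / 2) +
    (l - 1) * l * (2 * l - 1) / 6) (a := -n) (b := 0) (by omega)
  rw [Finset.sum_congr rfl (g := fun l : ℤ => (l : ℂ) * (n + l)) (fun l _ => by push_cast; ring)] at h
  rw [h]
  push_cast
  ring

theorem quad_quad_vac (p : ℂ) (u : Bool → ℂ) (n m c c' : ℤ) :
    quad p u n (quad p u m (ket (c, 0))) (c', 0) = if c' = c ∧ n + m = 0 ∧ 0 ≤ n then
      (if n = 0 then currentValue p u c ^ 4 else 4 * n * dot u u * currentValue p u c ^ 2 +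
        dot u u ^ 2 * ((n : ℂ) ^ 3 - n) / 3) else 0 := by
  rcases lt_trichotomy m 0 with hm | rfl | hm
  · rcases lt_or_ge 0 n with hn | hn
    · rw [← Module.End.mul_apply, ((quad_hasSum p u m).mul_left (quad p u n)).coord_eq_sum _ _
        (Finset.Icc m 0)]
      · rw [Finset.sum_congr rfl (fun l hl => quad_quad_term_vac p u hm hl hn c c')]
        by_cases h : c' = c ∧ n + m = 0
        · obtain ⟨h1, h2⟩ := h
          obtain rfl : m = -n := by omega
          simp only [h1, h2, hn.le, if_true, if_neg hn.ne', and_self]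
          rw [Finset.sum_add_distrib, Finset.sum_add_distrib, Finset.sum_ite_eq', Finset.sum_ite_eq',
            if_pos (by simp [hn.le]), if_pos (by simp [hn.le]),
            Finset.sum_congr rfl (g := fun l : ℤ => -2 * dot u u ^ 2 * ((l : ℂ) * (n + l)))
              (fun l _ => by ring), ← Finset.mul_sum, sum_Icc_cubic hn]
          ring
        · rw [if_neg (by tauto)]
          simp [h]
      · intro l hl
        rw [Finset.mem_Icc, not_and_or, not_le, not_le] at hl
        rw [Module.End.mul_apply, quadTerm]
        rcases hl with h | h
        · rw [if_pos (by omega), Module.End.mul_apply, current_pos_vac p u (by omega), map_zero,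
            map_zero, Finsupp.zero_apply]
        · rw [if_neg (by omega), Module.End.mul_apply, current_pos_vac p u (by omega), map_zero,
            map_zero, Finsupp.zero_apply]
    · rw [if_neg (by omega)]
      rcases hn.lt_or_eq with hn | rfl
      · exact quad_neg_apply_vac p u hn _ _
      · rw [quad_zero_apply_vac, quad_neg_apply_vac p u hm, mul_zero]
  · rw [quad_zero_vac, map_smul, Finsupp.smul_apply]
    rcases lt_trichotomy n 0 with hn | rfl | hn
    · rw [quad_neg_apply_vac p u hn, if_neg (by omega), smul_zero]
    · rw [quad_zero_vac, Finsupp.smul_apply, ket_apply]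
      by_cases h : c' = c
      · simp [h]; ring
      · rw [if_neg (by simpa using Ne.symm h), if_neg (by tauto)]; simp
    · rw [quad_pos_vac p u hn, if_neg (by omega)]; simp
  · rw [quad_pos_vac p u hm, map_zero, Finsupp.zero_apply]
    rw [if_neg (by omega)]

theorem quad_vac (p : ℂ) (u : Bool → ℂ) (n c c' : ℤ) : quad p u n (ket (c, 0)) (c', 0) =
    if c' = c ∧ n = 0 then currentValue p u c ^ 2 else 0 := by
  rcases lt_trichotomy n 0 with hn | rfl | hn
  · rw [quad_neg_apply_vac p u hn, if_neg (by omega)]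
  · rw [quad_zero_vac, Finsupp.smul_apply, ket_apply]
    by_cases h : c' = c
    · simp [h]
    · rw [if_neg (by simpa using Ne.symm h), if_neg (by tauto)]; simp
  · rw [quad_pos_vac p u hn, if_neg (by omega), Finsupp.zero_apply]

/-- By the Jacobi identity the difference of the two sides commutes with every bosonic mode, so
vacuum matrix elements decide. The cubic central term is the vacuum value in `quad_quad_vac`. -/
theorem quad_comm_quad (p : ℂ) (u : Bool → ℂ) (n m : ℤ) :
    ⁅quad p u n, quad p u m⁆ = (2 * dot u u * ((n : ℂ) - m)) • quad p u (n + m) +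
      if n + m = 0 then (dot u u ^ 2 * ((n : ℂ) ^ 3 - n) / 3) • 1 else 0 := by
  rw [← sub_eq_zero]
  refine eq_zero_of_comm_of_vac p _ (fun s k _ => ?_) fun c c' => ?_
  · rw [comm_sub, comm_add, boson_comm_ite, comm_comm, comm_smul, boson_comm_quad, boson_comm_quad,
      boson_comm_quad, smul_comm_right, comm_smul, quad_comm_current,
      comm_swap (current p u (n + k)), quad_comm_current, show m + (n + k) = n + m + k by omega,
      show n + (m + k) = n + m + k by omega]
    push_cast
    module
  · rw [LinearMap.sub_apply, Finsupp.sub_apply, LinearMap.add_apply, Finsupp.add_apply,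
      ite_smul_one_vac, Ring.lie_def, LinearMap.sub_apply, Finsupp.sub_apply, Module.End.mul_apply,
      Module.End.mul_apply, quad_quad_vac, quad_quad_vac, LinearMap.smul_apply, Finsupp.smul_apply,
      quad_vac, add_comm m n, smul_eq_mul]
    by_cases h : c' = c ∧ n + m = 0
    · obtain ⟨h1, h2⟩ := h
      obtain rfl : m = -n := by omega
      rcases lt_trichotomy n 0 with hn | rfl | hn
      · simp only [h1, h2, true_and, and_true, if_true, if_neg (show ¬ 0 ≤ n by omega),
          if_pos (show 0 ≤ -n by omega), if_neg (show -n ≠ 0 by omega)]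
        push_cast
        ring
      · simp [h1]
      · simp only [h1, h2, true_and, and_true, if_true, if_neg (show ¬ 0 ≤ -n by omega),
          if_pos (show 0 ≤ n by omega), if_neg (show n ≠ 0 by omega)]
        push_cast
        ring
    · rw [if_neg (by tauto), if_neg (by tauto), if_neg h, if_neg h]
      ring

/-- The modes of the square of a current plus a multiple of its derivative. -/
def sugawara (p : ℂ) (u : Bool → ℂ) (ρ : ℂ) (n : ℤ) : Module.End ℂ Fock :=
  quad p u n - (ρ * ((n : ℂ) + 1)) • current p u n

theorem sugawara_comm_current (p : ℂ) (u : Bool → ℂ) (ρ : ℂ) (w : Bool → ℂ) (n m : ℤ) :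
    ⁅sugawara p u ρ n, current p w m⁆ = (-2 * (m : ℂ) * dot u w) • current p u (n + m) -
      if n + m = 0 then (ρ * ((n : ℂ) + 1) * (n * dot u w)) • 1 else 0 := by
  rw [sugawara, sub_comm_right, smul_comm_right, quad_comm_current, current_comm_current]
  congr 1
  by_cases h : n + m = 0
  · rw [if_pos h, if_pos (by omega), smul_smul]
  · rw [if_neg h, if_neg (by omega), smul_zero]

theorem sugawara_comm_sugawara (p : ℂ) (u : Bool → ℂ) (ρ : ℂ) (n m : ℤ) :
    ⁅sugawara p u ρ n, sugawara p u ρ m⁆ = (2 * dot u u * ((n : ℂ) - m)) • sugawara p u ρ (n + m) +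
      if n + m = 0 then ((dot u u ^ 2 / 3 - ρ ^ 2 * dot u u) * ((n : ℂ) ^ 3 - n)) •
        (1 : Module.End ℂ Fock) else 0 := by
  simp only [sugawara, comm_sub, sub_comm_right, comm_smul, smul_comm_right, quad_comm_quad,
    quad_comm_current, current_comm_current]
  rw [comm_swap (current p u n), quad_comm_current, add_comm m n]
  by_cases h : n + m = 0
  · obtain rfl : m = -n := by omega
    simp only [h, if_true]
    push_cast
    module
  · rw [if_neg h, if_neg h, if_neg (by omega)]
    push_cast
    module

theorem sugawara_comm_of_dot_eq_zero (p : ℂ) {u w : Bool → ℂ} (h : dot u w = 0) (ρ ρ' : ℂ)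
    (n m : ℤ) : ⁅sugawara p u ρ n, sugawara p w ρ' m⁆ = 0 := by
  have h' : dot w u = 0 := by rw [← h, dot, dot]; ring
  simp only [sugawara, comm_sub, sub_comm_right, comm_smul, smul_comm_right,
    quad_comm_quad_of_dot_eq_zero p h, quad_comm_current, current_comm_current]
  rw [comm_swap (current p u n), quad_comm_current, h, h']
  simp

/-! ### Operators commuting with the fermions and with `ã` -/

theorem psit_psi_vertexOp (p : ℂ) (i : ℤ) :
    vertexOp p 1 i = (rtTwo / 2) • (psit p i + Complex.I • psi p i) := by
  rw [psi_apply, psit_apply, mul_inv, mul_smul, smul_smul Complex.I,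
    mul_inv_cancel₀ Complex.I_ne_zero, one_smul, ← smul_add, smul_smul,
    show rtTwo / 2 * rtTwo⁻¹ = 1 / 2 by field_simp [rtTwo_ne_zero]]
  module

/-- The modes `a_n` are themselves bilinear in the fermions, by `ψ̃ψ = iφ'`. -/
theorem comm_boson_of_comm_fermions (p : ℂ) {D : Module.End ℂ Fock} (h1 : ∀ i, ⁅psi p i, D⁆ = 0)
    (h2 : ∀ i, ⁅psit p i, D⁆ = 0) (n : ℤ) : ⁅boson p false n, D⁆ = 0 := by
  have h := ((psit_psi_hasSum p (-n - 1)).comm_right D).unique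
    (LocHasSum.zero.congr fun i => by rw [mul_comm_right, h1, h2, mul_zero, zero_mul, add_zero])
  rw [smul_comm_right, show -(-n - 1) - 1 = n by omega] at h
  exact (smul_eq_zero.1 h).resolve_left Complex.I_ne_zero

/-- Schur's lemma for the Fock space. Commuting with all bosons makes `D` act on each `|c⟩` by a
scalar; commuting with `:e^{φ}:`, a combination of the fermions which moves `|c⟩` to `|c + 1⟩`,
makes these scalars equal. -/
theorem eq_smul_one_of_comm (p : ℂ) {D : Module.End ℂ Fock} (h1 : ∀ i, ⁅psi p i, D⁆ = 0)
    (h2 : ∀ i, ⁅psit p i, D⁆ = 0) (h3 : ∀ n, ⁅boson p true n, D⁆ = 0) :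
    D = (D (ket (0, 0)) (0, 0)) • (1 : Module.End ℂ Fock) := by
  have hb : ∀ s n, ⁅boson p s n, D⁆ = 0 := fun s n => by
    cases s
    · exact comm_boson_of_comm_fermions p h1 h2 n
    · exact h3 n
  have hq : ⁅boson p false 0, D⁆ = ((0 : ℤ) : ℂ) • D := by rw [hb]; simp
  have hvac : ∀ c : ℤ, D (ket (c, 0)) = (D (ket (c, 0)) (c, 0)) • ket (c, 0) := by
    intro c
    ext ⟨c', m⟩
    rw [Finsupp.smul_apply, ket_apply, smul_eq_mul]
    by_cases hc : c' = c
    · subst hc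
      by_cases hm : m = 0
      · simp [hm]
      · rw [apply_eq_zero_of_annihilate _ _ hm, if_neg (by simpa using Ne.symm hm), mul_zero]
        intro s k
        rw [← boson_succ p, ← Module.End.mul_apply, mul_eq_of_comm_eq_zero (hb s _),
          Module.End.mul_apply, boson_pos_vac p s (by omega), map_zero]
    · rw [apply_eq_zero_of_charge hq (by simpa using hc), if_neg, mul_zero]
      simp only [Prod.mk.injEq, not_and]
      exact fun h => absurd h.symm hc
  have hV : ∀ i, ⁅vertexOp p 1 i, D⁆ = 0 := fun i => by
    rw [psit_psi_vertexOp, smul_comm_right, add_comm_right, smul_comm_right, h1, h2]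
    simp
  have hstep : ∀ c : ℤ, D (ket (c + 1, 0)) (c + 1, 0) = D (ket (c, 0)) (c, 0) := by
    intro c
    have h : D (ket (c + 1, 0)) = (D (ket (c, 0)) (c, 0)) • ket (c + 1, 0) := by
      rw [← vertexOp_apply_vac p 1 c, ← Module.End.mul_apply, ← mul_eq_of_comm_eq_zero (hV _),
        Module.End.mul_apply, hvac c, map_smul]
      simp [ket_apply]
    rw [h]
    simp [ket_apply]
  have hconst : ∀ c : ℤ, D (ket (c, 0)) (c, 0) = D (ket (0, 0)) (0, 0) := by
    intro c
    induction c using Int.induction_on with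
    | zero => rfl
    | succ i ih => rw [hstep, ih]
    | pred i ih => rw [← ih, ← hstep, sub_add_cancel]
  rw [← sub_eq_zero]
  refine eq_zero_of_comm_of_vac p _ (fun s n _ => ?_) fun c c' => ?_
  · rw [comm_sub, hb, comm_smul, comm_one, smul_zero, sub_zero]
  · rw [LinearMap.sub_apply, LinearMap.smul_apply, Module.End.one_apply, hvac, hconst c, sub_self]
    rfl

/-! ### The free fermion algebra and the Virasoro algebra of a fermion -/

theorem isFreeFermion_psit (p : ℂ) : IsFreeFermion (fermiMode (psit p)) := by
  intro r t
  rw [fermiMode, fermiMode, psit_anticomm]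
  exact if_congr (by omega) rfl rfl

/-- The modes of the normally ordered product of `ψ'` and `ψ`. -/
def fermiVir (p : ℂ) (n : ℤ) : Module.End ℂ Fock := fermiBilinear (psi p) (-n - 2)

theorem fermiVir_hasSum (p : ℂ) (n : ℤ) :
    LocHasSum (fermiTerm (psi p) (-n - 2)) (fermiVir p n) := by
  rw [fermiVir, fermiBilinear_psi]
  exact fermiTerm_psi_hasSum p _

/-- Normal ordering changes the product only by a scalar, which no commutator sees. -/
theorem fermiNormal_psi_comm (p : ℂ) (X : Module.End ℂ Fock) (r t : ℤ) :
    ⁅X, fermiNormal (psi p) r t⁆ = ⁅X, psi p (-r - 1) * psi p (-t - 1)⁆ := by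
  rw [fermiNormal, fermiMode, fermiMode]
  split_ifs
  · rfl
  · rw [eq_sub_of_add_eq (psi_anticomm p (-r - 1) (-t - 1)), comm_sub, comm_neg]
    split_ifs
    · rw [comm_one, zero_sub]
    · rw [comm_zero, zero_sub]

theorem fermiVir_comm_hasSum (p : ℂ) (X : Module.End ℂ Fock) (n : ℤ) :
    LocHasSum (fun i : ℤ => (i : ℂ) • ⁅X, psi p i * psi p (-n - 1 - i)⁆) ⁅X, fermiVir p n⁆ := by
  refine (((fermiVir_hasSum p n).comm_left X).reflect (-1)).congr fun i => ?_
  rw [fermiTerm, comm_smul, fermiNormal_psi_comm, show -(-1 - i) - 1 = i by omega,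
    show -(-(-n - 2) - 3 - (-1 - i)) - 1 = -n - 1 - i by omega]
  push_cast
  congr 1
  ring

theorem fermiVir_comm_of_anticomm (p : ℂ) (X : Module.End ℂ Fock) (n : ℤ)
    (h : ∀ i, X * psi p i = -(psi p i * X)) : ⁅X, fermiVir p n⁆ = 0 := by
  refine (fermiVir_comm_hasSum p X n).unique (LocHasSum.zero.congr fun i => ?_)
  rw [Ring.lie_def, ← mul_assoc, h, neg_mul, mul_assoc, h, mul_neg, neg_neg, mul_assoc, sub_self,
    smul_zero]

theorem fermiVir_comm_of_comm (p : ℂ) (X : Module.End ℂ Fock) (n : ℤ)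
    (h : ∀ i, ⁅X, psi p i⁆ = 0) : ⁅X, fermiVir p n⁆ = 0 := by
  refine (fermiVir_comm_hasSum p X n).unique (LocHasSum.zero.congr fun i => ?_)
  rw [comm_mul, h, h, mul_zero, zero_mul, add_zero, smul_zero]

theorem psi_comm_psi_mul_psi (p : ℂ) (j i k : ℤ) : ⁅psi p j, psi p i * psi p k⁆ =
    (if i + j = -1 then psi p k else 0) - if k + j = -1 then psi p i else 0 := by
  have e : ⁅psi p j, psi p i * psi p k⁆ = (psi p i * psi p j + psi p j * psi p i) * psi p k -
      psi p i * (psi p k * psi p j + psi p j * psi p k) := by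
    rw [Ring.lie_def]; noncomm_ring
  rw [e, psi_anticomm, psi_anticomm]
  split_ifs <;> simp

theorem fermiVir_comm_psi (p : ℂ) (n j : ℤ) :
    ⁅fermiVir p n, psi p j⁆ = (2 * (j : ℂ) + 1 - n) • psi p (j - n) := by
  have h := ((LocHasSum.ite_eq (-1 - j) fun i : ℤ => (i : ℂ) • psi p (-n - 1 - i)).sub
    (LocHasSum.ite_eq (j - n) fun i : ℤ => (i : ℂ) • psi p i))
  rw [comm_swap, (fermiVir_comm_hasSum p (psi p j) n).unique (h.congr fun i => ?_)]
  · rw [show -n - 1 - (-1 - j) = j - n by omega]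
    push_cast
    module
  · rw [psi_comm_psi_mul_psi, smul_sub, smul_ite, smul_ite, smul_zero]
    congr 1
    · exact if_congr (by omega) rfl rfl
    · exact if_congr (by omega) rfl rfl

theorem boson_true_comm_fermiVir (p : ℂ) (m n : ℤ) : ⁅boson p true m, fermiVir p n⁆ = 0 :=
  fermiVir_comm_of_comm p _ n (boson_true_comm_psi p m)

theorem psit_comm_fermiVir (p : ℂ) (i n : ℤ) : ⁅psit p i, fermiVir p n⁆ = 0 :=
  fermiVir_comm_of_anticomm p _ n (psit_mul_psi p i)

/-- The label of the field `a`. -/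
def chargeVec : Bool → ℂ := fun s => if s then 0 else 1

theorem quad_chargeVec (p : ℂ) (n : ℤ) : quad p chargeVec n = bosonPair p false false n := by
  simp [quad, chargeVec]

theorem fermiVir_eq (p : ℂ) (n : ℤ) : fermiVir p n =
    (1 / 2 : ℂ) • (quad p chargeVec n - (vertexOp p 2 (-n - 2) + vertexOp p (-2) (-n - 2))) := by
  rw [fermiVir, fermiBilinear_psi, quad_chargeVec, show -(-n - 2) - 2 = n by omega]

theorem vertexOp_comm_charge (p : ℂ) (k i : ℤ) :
    ⁅boson p false 0, vertexOp p k i⁆ = (k : ℂ) • vertexOp p k i := charge_comm_normalExp _ _ _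

theorem charge_comm_quad (p : ℂ) (u : Bool → ℂ) (n : ℤ) : ⁅boson p false 0, quad p u n⁆ = 0 := by
  rw [boson_comm_quad]; simp

/-- The two-point function is that of `(z - w)^{-4}`, with coefficients `(M + 1)(M + 2)(M + 3)/6`;
at `M = n - 2` this is `(n³ - n)/6`. The values for `n = 0, 1` vanish as well, so the condition can
be stated as `0 ≤ n`. -/
theorem vertexOp_two_vac (p : ℂ) {k : ℤ} (hk : k * k = 4) (n m : ℤ) :
    vertexOp p k (-n - 2) (vertexOp p (-k) (-m - 2) (ket (0, 0))) (0, 0) =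
      if n + m = 0 ∧ 0 ≤ n then ((n : ℂ) ^ 3 - n) / 6 else 0 := by
  rw [two_point p k (-k) (fun M => ((M : ℂ) + 1) * ((M : ℂ) + 2) * ((M : ℂ) + 3) / 6)]
  · by_cases h : n + m = 0 ∧ 2 ≤ n
    · obtain ⟨h1, h2⟩ := h
      obtain ⟨N, hN⟩ := Int.eq_ofNat_of_zero_le (show 0 ≤ n - 2 by omega)
      obtain rfl : n = N + 2 := by omega
      obtain rfl : m = -(N + 2) := by omega
      rw [if_pos ⟨by ring, by rw [mul_neg, hk]; ring, by simp⟩, if_pos (by omega),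
        show (-(-((N : ℤ) + 2)) - 2 - -k * 0).toNat = N by simp]
      push_cast
      ring
    · rw [if_neg (by rw [mul_neg, hk]; simp only [mul_zero]; omega)]
      split_ifs with h'
      · obtain rfl | rfl : n = 0 ∨ n = 1 := by omega
        · simp
        · simp
      · rfl
  · norm_num
  · intro M
    have : ((k * -k : ℤ) : ℂ) = -4 := by rw [mul_neg, hk]; norm_num
    push_cast at this ⊢
    rw [this]; ring

/-- Only products of total charge zero survive. For `n + m = 0` and `n ≥ 0`, the square of the
current gives `(n³ - n)/3` and the two mixed vertex products `(n³ - n)/6` each; a quarter of the sum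
remains. -/
theorem fermiVir_fermiVir_vac (p : ℂ) (n m : ℤ) :
    fermiVir p n (fermiVir p m (ket (0, 0))) (0, 0) =
      if n + m = 0 ∧ 0 ≤ n then ((n : ℂ) ^ 3 - n) / 6 else 0 := by
  have hSV : ∀ k i, k ≠ 0 → (quad p chargeVec n * vertexOp p k i) (ket (0, 0)) (0, 0) = 0 :=
    fun k i hk => apply_eq_zero_of_charge (p := p) (q := k)
      (by rw [comm_mul, charge_comm_quad, vertexOp_comm_charge, zero_mul, zero_add, mul_smul_comm])
      (by simpa using hk.symm)
  have hVS : ∀ k i, k ≠ 0 → (vertexOp p k i * quad p chargeVec m) (ket (0, 0)) (0, 0) = 0 :=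
    fun k i hk => apply_eq_zero_of_charge (p := p) (q := k)
      (by rw [comm_mul, charge_comm_quad, vertexOp_comm_charge, mul_zero, add_zero, smul_mul_assoc])
      (by simpa using hk.symm)
  have hVV : ∀ k i j, k ≠ 0 → (vertexOp p k i * vertexOp p k j) (ket (0, 0)) (0, 0) = 0 :=
    fun k i j hk => apply_eq_zero_of_charge (p := p) (q := k + k)
      (by rw [comm_mul, vertexOp_comm_charge, vertexOp_comm_charge, mul_smul_comm, smul_mul_assoc]
          push_cast; module)
      (by dsimp only; omega)
  have h22 := vertexOp_two_vac p (k := 2) (by norm_num) n m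
  have h22' := vertexOp_two_vac p (k := -2) (by norm_num) n m
  rw [neg_neg] at h22'
  have hQ := quad_quad_vac p chargeVec n m 0 0
  have e : fermiVir p n * fermiVir p m = (1 / 4 : ℂ) •
      (quad p chargeVec n * quad p chargeVec m - quad p chargeVec n * vertexOp p 2 (-m - 2) -
      quad p chargeVec n * vertexOp p (-2) (-m - 2) - vertexOp p 2 (-n - 2) * quad p chargeVec m -
      vertexOp p (-2) (-n - 2) * quad p chargeVec m +
      vertexOp p 2 (-n - 2) * vertexOp p 2 (-m - 2) +
      vertexOp p (-2) (-n - 2) * vertexOp p (-2) (-m - 2) +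
      vertexOp p 2 (-n - 2) * vertexOp p (-2) (-m - 2) +
      vertexOp p (-2) (-n - 2) * vertexOp p 2 (-m - 2)) := by
    rw [fermiVir_eq, fermiVir_eq, smul_mul_smul_comm, show (1 / 2 : ℂ) * (1 / 2) = 1 / 4 by norm_num]
    congr 1
    noncomm_ring
  rw [← Module.End.mul_apply, e]
  simp only [LinearMap.smul_apply, LinearMap.add_apply, LinearMap.sub_apply, Finsupp.smul_apply,
    Finsupp.add_apply, Finsupp.sub_apply, hSV 2 _ two_ne_zero, hSV (-2) _ (by norm_num),
    hVS 2 _ two_ne_zero, hVS (-2) _ (by norm_num), hVV 2 _ _ two_ne_zero,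
    hVV (-2) _ _ (by norm_num)]
  rw [Module.End.mul_apply, Module.End.mul_apply, Module.End.mul_apply, h22, h22', hQ]
  have h0 : currentValue p chargeVec 0 = 0 := by simp [currentValue, chargeVec]
  have h1 : dot chargeVec chargeVec = 1 := by simp [dot, chargeVec]
  rw [h0, h1]
  simp only [true_and, smul_eq_mul]
  split_ifs with h h'
  · simp [h']
  · ring
  · ring

/-- By the Jacobi identity the difference of the two sides commutes with `ψ`, `ψ̃` and `ã`, hence is
a scalar; its value is the vacuum expectation value. The factor 2 reflects that these modes are
twice the Virasoro modes. -/
theorem fermiVir_comm_fermiVir (p : ℂ) (n m : ℤ) : ⁅fermiVir p n, fermiVir p m⁆ =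
    (2 * ((n : ℂ) - m)) • fermiVir p (n + m) +
      if n + m = 0 then (((n : ℂ) ^ 3 - n) / 6) • 1 else 0 := by
  have h := eq_smul_one_of_comm p
    (D := ⁅fermiVir p n, fermiVir p m⁆ - (2 * ((n : ℂ) - m)) • fermiVir p (n + m))
    (fun i => ?_) (fun i => ?_) fun i => ?_
  · rw [← sub_eq_iff_eq_add', h]
    have hvac : fermiVir p (n + m) (ket (0, 0)) (0, 0) = 0 := by
      have h0 : currentValue p chargeVec 0 = 0 := by simp [currentValue, chargeVec]
      rw [fermiVir_eq, LinearMap.smul_apply, LinearMap.sub_apply, LinearMap.add_apply,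
        Finsupp.smul_apply, Finsupp.sub_apply, Finsupp.add_apply, quad_vac, vertexOp_vac,
        vertexOp_vac, h0]
      simp
    rw [LinearMap.sub_apply, Finsupp.sub_apply, LinearMap.smul_apply, Finsupp.smul_apply, hvac,
      Ring.lie_def, LinearMap.sub_apply, Finsupp.sub_apply, Module.End.mul_apply,
      Module.End.mul_apply, fermiVir_fermiVir_vac, fermiVir_fermiVir_vac, add_comm m n]
    by_cases h : n + m = 0
    · obtain rfl : m = -n := by omega
      rcases lt_trichotomy n 0 with hn | rfl | hn
      · simp only [h, true_and, if_true, if_neg (show ¬ 0 ≤ n by omega),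
          if_pos (show 0 ≤ -n by omega)]
        push_cast
        rw [smul_zero, sub_zero]
        congr 1
        ring
      · simp
      · simp only [h, true_and, if_true, if_neg (show ¬ 0 ≤ -n by omega),
          if_pos (show 0 ≤ n by omega)]
        rw [smul_zero, sub_zero, sub_zero]
    · simp [h]
  · rw [comm_sub, comm_smul, comm_comm, comm_swap (psi p i), comm_swap (psi p i),
      comm_swap (psi p i), fermiVir_comm_psi, fermiVir_comm_psi, fermiVir_comm_psi, ← neg_smul,
      ← neg_smul, smul_comm_right, comm_smul, comm_swap (psi p (i - n)), fermiVir_comm_psi,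
      fermiVir_comm_psi, show i - n - m = i - (n + m) by omega,
      show i - m - n = i - (n + m) by omega]
    push_cast
    module
  · rw [comm_sub, comm_smul, comm_comm, psit_comm_fermiVir, psit_comm_fermiVir, psit_comm_fermiVir,
      zero_comm, comm_zero, smul_zero, add_zero, sub_zero]
  · rw [comm_sub, comm_smul, comm_comm, boson_true_comm_fermiVir, boson_true_comm_fermiVir,
      boson_true_comm_fermiVir, zero_comm, comm_zero, smul_zero, add_zero, sub_zero]

/-! ### The super Virasoro algebra -/

/-- The label of the field `ã`. -/
def neutralVec : Bool → ℂ := fun s => if s then 1 else 0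

theorem current_neutralVec (p : ℂ) (n : ℤ) : current p neutralVec n = boson p true n := by
  simp [current, neutralVec]

theorem quad_neutralVec (p : ℂ) (n : ℤ) : quad p neutralVec n = bosonPair p true true n := by
  simp [quad, neutralVec]

theorem dot_neutralVec : dot neutralVec neutralVec = 1 := by simp [dot, neutralVec]

theorem virMode_currentT (β rβ p : ℂ) (n : ℤ) : virMode (currentT β rβ p) n =
    (1 / 2 : ℂ) • (sugawara p neutralVec (2 * sigma β rβ) n + fermiVir p n) := by
  rw [virMode, currentT_eq, sugawara, quad_neutralVec, current_neutralVec, fermiVir,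
    show -(-n - 2) - 2 = n by omega]
  push_cast
  module

theorem sugawara_comm_of_boson_true (p : ℂ) (X : Module.End ℂ Fock) (ρ : ℂ) (n : ℤ)
    (h : ∀ m, ⁅X, boson p true m⁆ = 0) : ⁅X, sugawara p neutralVec ρ n⁆ = 0 := by
  have hq : ⁅X, quad p neutralVec n⁆ = 0 := by
    refine ((quad_hasSum p neutralVec n).comm_left X).unique (LocHasSum.zero.congr fun l => ?_)
    rw [quadTerm, current_neutralVec, current_neutralVec]
    split_ifs <;> rw [comm_mul, h, h, zero_mul, mul_zero, add_zero]
  rw [sugawara, comm_sub, comm_smul, hq, current_neutralVec, h, smul_zero, sub_zero]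

/-- The bosonic and fermionic parts commute, and their central charges `1 - 12σ²` and `1/2` add. -/
theorem isVirasoro_currentT (β rβ p : ℂ) :
    IsVirasoro (3 / 2 - 12 * sigma β rβ ^ 2) (virMode (currentT β rβ p)) := by
  intro n m
  have h1 : ∀ n m, ⁅fermiVir p n, sugawara p neutralVec (2 * sigma β rβ) m⁆ = 0 := fun n m =>
    sugawara_comm_of_boson_true p _ _ _ fun k => by
      rw [comm_swap, boson_true_comm_fermiVir, neg_zero]
  have h2 : ∀ n m, ⁅sugawara p neutralVec (2 * sigma β rβ) m, fermiVir p n⁆ = 0 := fun n m => by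
    rw [comm_swap, h1, neg_zero]
  rw [← Ring.lie_def, virMode_currentT, virMode_currentT, virMode_currentT, smul_comm_right,
    comm_smul, add_comm_right, comm_add, comm_add, h1, h2, sugawara_comm_sugawara,
    fermiVir_comm_fermiVir, dot_neutralVec]
  split_ifs <;> module

theorem virMode_comm_boson_true (β rβ p : ℂ) (n m : ℤ) :
    ⁅virMode (currentT β rβ p) n, boson p true m⁆ = (-(m : ℂ)) • boson p true (n + m) -
      if n + m = 0 then (sigma β rβ * (n * (n + 1))) • 1 else 0 := by
  rw [virMode_currentT, smul_comm_right, add_comm_right, comm_swap (fermiVir p n),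
    boson_true_comm_fermiVir, ← current_neutralVec, sugawara_comm_current, dot_neutralVec,
    current_neutralVec]
  split_ifs <;> module

theorem virMode_comm_psi (β rβ p : ℂ) (n j : ℤ) : ⁅virMode (currentT β rβ p) n, psi p j⁆ =
    ((j : ℂ) + 1 / 2 - n / 2) • psi p (j - n) := by
  rw [virMode_currentT, smul_comm_right, add_comm_right, fermiVir_comm_psi,
    comm_swap (sugawara p neutralVec _ n), sugawara_comm_of_boson_true]
  · module
  · intro m
    rw [comm_swap, boson_true_comm_psi, neg_zero]

theorem psit_comm_virMode (β rβ p : ℂ) (i n : ℤ) : ⁅psit p i, virMode (currentT β rβ p) n⁆ = 0 := by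
  rw [virMode_currentT, comm_smul, comm_add, psit_comm_fermiVir, sugawara_comm_of_boson_true,
    add_zero, smul_zero]
  intro m
  rw [comm_swap, boson_true_comm_psit, neg_zero]

theorem superMode_currentG (β rβ p : ℂ) (r : ℤ) : superMode (currentG β rβ p) r =
    mulField (dphi p true) (psi p) (-r - 2) -
      (2 * sigma β rβ * ((r : ℂ) + 1)) • psi p (-r - 1) := by
  rw [superMode, currentG_apply, derivField, show -r - 2 + 1 = -r - 1 by omega]
  push_cast
  module

theorem boson_psi_hasSum (p : ℂ) (n : ℤ) : LocHasSum
    (fun m => boson p true m * psi p (m + n + 1)) (mulField (dphi p true) (psi p) n) := by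
  refine (((dphi_psi_mulExists p).locHasSum n).reflect (-1)).congr fun m => ?_
  rw [dphi, show -(-1 - m) - 1 = m by omega, show n - (-1 - m) = m + n + 1 by omega]

theorem superMode_comm_boson_true (β rβ p : ℂ) (r m : ℤ) :
    ⁅superMode (currentG β rβ p) r, boson p true m⁆ = (-(m : ℂ)) • psi p (-m - r - 1) := by
  have h : ⁅boson p true m, mulField (dphi p true) (psi p) (-r - 2)⁆ =
      (m : ℂ) • psi p (-m - r - 1) := by
    refine ((boson_psi_hasSum p (-r - 2)).comm_left _).unique
      ((LocHasSum.ite_eq (-m) fun k => (m : ℂ) • psi p (k - r - 1)).congr fun k => ?_)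
    rw [comm_mul, boson_true_comm_psi, mul_zero, add_zero, boson_lie_boson_ite, ite_mul, zero_mul]
    simp only [if_true, smul_mul_assoc, one_mul]
    rw [show k + (-r - 2) + 1 = k - r - 1 by omega]
  rw [comm_swap, superMode_currentG, comm_sub, h, comm_smul, boson_true_comm_psi]
  module

theorem superMode_anticomm_psi (β rβ p : ℂ) (r j : ℤ) :
    superMode (currentG β rβ p) r * psi p j + psi p j * superMode (currentG β rβ p) r =
      boson p true (r - j) - if j = r then (2 * sigma β rβ * ((r : ℂ) + 1)) • 1 else 0 := by
  have h : mulField (dphi p true) (psi p) (-r - 2) * psi p j +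
      psi p j * mulField (dphi p true) (psi p) (-r - 2) = boson p true (r - j) := by
    have hs := boson_psi_hasSum p (-r - 2)
    refine ((hs.mul_right (psi p j)).add (hs.mul_left (psi p j))).unique
      ((LocHasSum.ite_eq (r - j) fun k => boson p true k).congr fun k => ?_)
    have hc := mul_eq_of_comm_eq_zero (boson_true_comm_psi p k j)
    rw [← mul_assoc, ← hc, mul_assoc, mul_assoc, ← mul_add, psi_anticomm, mul_ite, mul_one, mul_zero]
    exact if_congr (by omega) rfl rfl
  have e : ∀ (A B C : Module.End ℂ Fock) (a : ℂ),
      (A - a • B) * C + C * (A - a • B) = (A * C + C * A) - a • (B * C + C * B) := by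
    intro A B C a
    simp only [sub_mul, mul_sub, smul_mul_assoc, mul_smul_comm]
    module
  rw [superMode_currentG, e, h, psi_anticomm, smul_ite, smul_zero]
  congr 1
  exact if_congr (by omega) rfl rfl

theorem boson_psi_weighted_hasSum (p : ℂ) (f : ℤ → ℂ) (n : ℤ) :
    ∃ X, LocHasSum (fun m => f m • (boson p true m * psi p (m + n))) X := by
  have h := boson_psi_hasSum p (n - 1)
  refine ⟨_, LocallyFiniteSum.locHasSum fun v => ((h v).1).subset fun m hm hz => hm ?_⟩
  have hz' : (boson p true m * psi p (m + n)) v = 0 := by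
    rw [show m + n = m + (n - 1) + 1 by omega]; exact hz
  rw [LinearMap.smul_apply, hz', smul_zero]

theorem virMode_comm_superMode (β rβ p : ℂ) (n r : ℤ) :
    ⁅virMode (currentT β rβ p) n, superMode (currentG β rβ p) r⁆ =
      ((n : ℂ) / 2 - ((r : ℂ) + 1 / 2)) • superMode (currentG β rβ p) (n + r) := by
  have key : ⁅virMode (currentT β rβ p) n, mulField (dphi p true) (psi p) (-r - 2)⁆ =
      ((n : ℂ) / 2 - ((r : ℂ) + 1 / 2)) • mulField (dphi p true) (psi p) (-(n + r) - 2) -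
        (sigma β rβ * (n * (n + 1))) • psi p (-(n + r) - 1) := by
    -- The two weights come from acting on `ã` and on `ψ`. After the first sum is shifted by `n`,
    -- they add up to a constant independent of `m`, the expected structure constant; `hZ` carries
    -- the anomalous term of `[L_n, ã_m]`.
    obtain ⟨X, hX⟩ := boson_psi_weighted_hasSum p (fun m => -((m : ℂ) - n)) (-(n + r) - 1)
    obtain ⟨Y, hY⟩ := boson_psi_weighted_hasSum p
      (fun m => (m : ℂ) - r - 1 / 2 - n / 2) (-(n + r) - 1)
    have hZ := LocHasSum.ite_eq (-n) fun _ : ℤ => (sigma β rβ * (n * (n + 1))) • psi p (-(n + r) - 1)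
    have hXY : X + Y = ((n : ℂ) / 2 - ((r : ℂ) + 1 / 2)) •
        mulField (dphi p true) (psi p) (-(n + r) - 2) := by
      refine (hX.add hY).unique (((boson_psi_hasSum p (-(n + r) - 2)).smul _).congr fun m => ?_)
      rw [show m + (-(n + r) - 2) + 1 = m + (-(n + r) - 1) by omega]
      module
    rw [← hXY]
    refine ((boson_psi_hasSum p (-r - 2)).comm_left _).unique
      ((((hX.shift n).add hY).sub hZ).congr fun m => ?_)
    rw [comm_mul, virMode_comm_boson_true, virMode_comm_psi, sub_mul, smul_mul_assoc,
      mul_smul_comm, show m + n + (-(n + r) - 1) = m + (-r - 2) + 1 by omega,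
      show m + (-r - 2) + 1 - n = m + (-(n + r) - 1) by omega, add_comm m n]
    by_cases h : n + m = 0
    · obtain rfl : m = -n := by omega
      rw [if_pos h, if_pos rfl, smul_mul_assoc, one_mul,
        show -n + (-r - 2) + 1 = -(n + r) - 1 by omega]
      push_cast
      module
    · rw [if_neg h, if_neg (by omega), zero_mul]
      push_cast
      module
  rw [superMode_currentG, superMode_currentG, comm_sub, key, comm_smul, virMode_comm_psi,
    show -r - 1 - n = -(n + r) - 1 by omega]
  push_cast
  module

theorem psit_anticomm_superMode (β rβ p : ℂ) (i r : ℤ) :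
    psit p i * superMode (currentG β rβ p) r + superMode (currentG β rβ p) r * psit p i = 0 := by
  rw [superMode, psit_mul_currentG, neg_add_cancel]

/-- The anticommutator of two operators. -/
def anticomm (X Y : Module.End ℂ Fock) : Module.End ℂ Fock := X * Y + Y * X

/-- A graded Jacobi identity. It yields the commutators of `{G, G}` with the fermions from the known
`{G, ψ}` and `{G, ψ̃}`; the next one serves for `ã`. -/
theorem comm_anticomm (X Y Z : Module.End ℂ Fock) :
    ⁅anticomm X Y, Z⁆ = ⁅X, anticomm Y Z⁆ + ⁅Y, anticomm X Z⁆ := by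
  simp only [Ring.lie_def, anticomm]; noncomm_ring

theorem comm_anticomm' (X Y Z : Module.End ℂ Fock) :
    ⁅anticomm X Y, Z⁆ = anticomm ⁅X, Z⁆ Y + anticomm X ⁅Y, Z⁆ := by
  simp only [Ring.lie_def, anticomm]; noncomm_ring

/-! ### Vacuum expectation values for the anticommutator of the supercurrent -/

theorem psi_neg_vac (p : ℂ) {j : ℤ} (hj : j < 0) : psi p j (ket (0, 0)) = 0 := by
  rw [psi_apply, LinearMap.smul_apply, LinearMap.sub_apply,
    vertexOp_apply_vac_of_lt p 1 (by omega), vertexOp_apply_vac_of_lt p (-1) (by omega), sub_zero,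
    smul_zero]

theorem psi_psi_vac (p : ℂ) (i j : ℤ) : psi p i (psi p j (ket (0, 0))) (0, 0) =
    if i + j = -1 ∧ 0 ≤ j then 1 else 0 := by
  have hq : ∀ k : ℤ, k ≠ 0 → (vertexOp p k i * vertexOp p k j) (ket (0, 0)) (0, 0) = 0 :=
    fun k hk => apply_eq_zero_of_charge (p := p) (q := k + k)
      (by rw [comm_mul, vertexOp_comm_charge, vertexOp_comm_charge, mul_smul_comm, smul_mul_assoc]
          push_cast; module)
      (by dsimp only; omega)
  have h1 := two_point_neg_one p (k := 1) (by norm_num) i j 0 0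
  have h2 := two_point_neg_one p (k := -1) (by norm_num) i j 0 0
  rw [neg_neg] at h2
  have e : psi p i * psi p j = (1 / 2 : ℂ) • (vertexOp p 1 i * vertexOp p (-1) j +
      vertexOp p (-1) i * vertexOp p 1 j - vertexOp p 1 i * vertexOp p 1 j -
      vertexOp p (-1) i * vertexOp p (-1) j) := by
    rw [psi_apply, psi_apply, smul_mul_smul_comm, I_rtTwo_inv_sq, neg_smul, ← smul_neg]
    congr 1
    noncomm_ring
  rw [← Module.End.mul_apply, e]
  simp only [LinearMap.smul_apply, LinearMap.add_apply, LinearMap.sub_apply, Finsupp.smul_apply,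
    Finsupp.add_apply, Finsupp.sub_apply, hq 1 one_ne_zero, hq (-1) (by norm_num)]
  rw [Module.End.mul_apply, Module.End.mul_apply, h1, h2]
  simp only [mul_zero, true_and]
  split_ifs <;> norm_num

theorem superMode_nonneg_vac (β rβ p : ℂ) {r : ℤ} (hr : 0 ≤ r) :
    superMode (currentG β rβ p) r (ket (0, 0)) = 0 := by
  rw [superMode_currentG, LinearMap.sub_apply, LinearMap.smul_apply, psi_neg_vac p (by omega),
    smul_zero, sub_zero]
  refine (boson_psi_hasSum p _).apply_eq_zero _ fun m => ?_
  rcases lt_or_ge 0 m with hm | hm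
  · rw [mul_eq_of_comm_eq_zero (boson_true_comm_psi p _ _), Module.End.mul_apply,
      boson_pos_vac p true hm, map_zero]
  · rw [Module.End.mul_apply, psi_neg_vac p (by omega), map_zero]

theorem psi_superMode_vac (β rβ p : ℂ) {j : ℤ} (hj : 0 ≤ j) (r : ℤ) :
    psi p j (superMode (currentG β rβ p) r (ket (0, 0))) (0, 0) = 0 := by
  rw [superMode_currentG, LinearMap.sub_apply, LinearMap.smul_apply, map_sub, map_smul,
    Finsupp.sub_apply, Finsupp.smul_apply, psi_psi_vac, if_neg (by omega), smul_zero, sub_zero,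
    ← Module.End.mul_apply]
  refine ((boson_psi_hasSum p _).mul_left _).coord_eq_zero _ _ fun m => ?_
  have hc : psi p j * (boson p true m * psi p (m + (-r - 2) + 1)) =
      boson p true m * (psi p j * psi p (m + (-r - 2) + 1)) := by
    rw [← mul_assoc, ← mul_eq_of_comm_eq_zero (boson_true_comm_psi p m j), mul_assoc]
  have hc' : boson p true m * (psi p j * psi p (m + (-r - 2) + 1)) =
      psi p j * psi p (m + (-r - 2) + 1) * boson p true m := by
    refine mul_eq_of_comm_eq_zero ?_
    rw [comm_mul, boson_true_comm_psi, boson_true_comm_psi, mul_zero, zero_mul, add_zero]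
  rcases lt_trichotomy m 0 with hm | rfl | hm
  · rw [hc, Module.End.mul_apply, boson_neg_apply_vac p true hm]
  · rw [hc, hc', Module.End.mul_apply, boson_zero_vac, map_smul, Finsupp.smul_apply,
      Module.End.mul_apply, psi_psi_vac, if_neg (by omega), smul_zero]
  · rw [hc, hc', Module.End.mul_apply, boson_pos_vac p true hm, map_zero, Finsupp.zero_apply]

theorem superMode_psi_vac (β rβ p : ℂ) {j : ℤ} (hj : 0 ≤ j) (r : ℤ) :
    superMode (currentG β rβ p) r (psi p j (ket (0, 0))) (0, 0) =
      if j = r then p - 2 * sigma β rβ * ((r : ℂ) + 1) else 0 := by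
  have h := congrArg (fun X : Module.End ℂ Fock => X (ket (0, 0)) (0, 0))
    (superMode_anticomm_psi β rβ p r j)
  simp only [LinearMap.add_apply, LinearMap.sub_apply, Finsupp.add_apply, Finsupp.sub_apply,
    Module.End.mul_apply, psi_superMode_vac β rβ p hj, boson_vac_coord, ite_smul_one_vac,
    true_and, add_zero, zeroValue, if_true] at h
  rw [h]
  by_cases hjr : j = r
  · simp [hjr]
  · rw [if_neg (by omega), if_neg hjr, if_neg hjr, sub_zero]

/-- Expanding the right supercurrent leaves only `t + 1 ≤ m ≤ 0`. If `r + t = -1`, the terms with `m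
< 0` contribute `-m`, summing to `r(r + 1)/2`; the term `m = 0` and the derivative term combine to
the product containing `p`. -/
theorem superMode_superMode_vac (β rβ p : ℂ) {t : ℤ} (ht : t < 0) (r : ℤ) :
    superMode (currentG β rβ p) r (superMode (currentG β rβ p) t (ket (0, 0))) (0, 0) =
      if r + t = -1 then (r : ℂ) * (r + 1) / 2 +
        (p + 2 * sigma β rβ * r) * (p - 2 * sigma β rβ * ((r : ℂ) + 1)) else 0 := by
  have hterm : ∀ m ∈ Finset.Icc (t + 1) 0, (superMode (currentG β rβ p) r *
      (boson p true m * psi p (m + (-t - 2) + 1))) (ket (0, 0)) (0, 0) =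
      (if r + t = -1 then -(m : ℂ) else 0) +
        if m = 0 then p * (if r + t = -1 then p - 2 * sigma β rβ * ((r : ℂ) + 1) else 0) else 0 := by
    intro m hm
    rw [Finset.mem_Icc] at hm
    rcases hm.2.lt_or_eq with h | rfl
    · have e : superMode (currentG β rβ p) r * boson p true m = (-(m : ℂ)) • psi p (-m - r - 1) +
          boson p true m * superMode (currentG β rβ p) r := by
        rw [← superMode_comm_boson_true β rβ p r m, Ring.lie_def]; abel
      rw [← mul_assoc, e, add_mul, mul_assoc, LinearMap.add_apply, Finsupp.add_apply,
        Module.End.mul_apply (boson p true m), boson_neg_apply_vac p true h, if_neg h.ne,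
        smul_mul_assoc, LinearMap.smul_apply, Finsupp.smul_apply, Module.End.mul_apply,
        psi_psi_vac, smul_eq_mul, mul_ite, mul_one, mul_zero]
      congr 1
      exact if_congr (by omega) rfl rfl
    · rw [mul_eq_of_comm_eq_zero (boson_true_comm_psi p _ _), Module.End.mul_apply,
        Module.End.mul_apply, boson_zero_vac, map_smul, map_smul, Finsupp.smul_apply,
        superMode_psi_vac β rβ p (by omega), if_pos rfl, smul_eq_mul, zeroValue, if_pos rfl,
        Int.cast_zero, neg_zero, ite_self, zero_add]
      rw [zero_add]
      congr 1
      exact if_congr (by omega) rfl rfl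
  have hsum : (superMode (currentG β rβ p) r * mulField (dphi p true) (psi p) (-t - 2))
      (ket (0, 0)) (0, 0) = _ :=
    ((boson_psi_hasSum p (-t - 2)).mul_left _).coord_eq_sum (ket (0, 0)) (0, 0)
      (Finset.Icc (t + 1) 0) fun m hm => by
        rw [Finset.mem_Icc, not_and_or, not_le, not_le] at hm
        rcases hm with hm | hm
        · rw [Module.End.mul_apply, Module.End.mul_apply, psi_neg_vac p (by omega), map_zero,
            map_zero, Finsupp.zero_apply]
        · rw [mul_eq_of_comm_eq_zero (boson_true_comm_psi p _ _), Module.End.mul_apply,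
            Module.End.mul_apply, boson_pos_vac p true hm, map_zero, map_zero, Finsupp.zero_apply]
  rw [Finset.sum_congr rfl hterm, Finset.sum_add_distrib, Finset.sum_ite_eq',
    if_pos (Finset.mem_Icc.2 ⟨by omega, le_rfl⟩)] at hsum
  rw [superMode_currentG β rβ p t, LinearMap.sub_apply, LinearMap.smul_apply, map_sub, map_smul,
    Finsupp.sub_apply, Finsupp.smul_apply, superMode_psi_vac β rβ p (by omega),
    ← Module.End.mul_apply, hsum, smul_eq_mul]
  by_cases h : r + t = -1
  · obtain rfl : t = -1 - r := by omega
    have ht := sum_Icc_telescope (fun l : ℤ => -((l : ℂ) * (l - 1) / 2)) (a := -1 - r + 1) (b := 0)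
      (by omega)
    rw [Finset.sum_congr rfl (g := fun l : ℤ => -(l : ℂ)) (fun l _ => by push_cast; ring)] at ht
    simp only [h, if_true, ht, show -(-1 - r) - 1 = r by omega]
    push_cast
    ring
  · rw [if_neg h, if_neg h, if_neg (by omega)]
    simp [h]

theorem superMode_anticomm_vac (β rβ p : ℂ) (r t : ℤ) :
    anticomm (superMode (currentG β rβ p) r) (superMode (currentG β rβ p) t)
      (ket (0, 0)) (0, 0) = if r + t + 1 = 0 then (1 / 2 - 4 * sigma β rβ ^ 2) * (r * (r + 1)) +
        (p ^ 2 - 2 * sigma β rβ * p) else 0 := by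
  have hpos : ∀ r t : ℤ, 0 ≤ t → superMode (currentG β rβ p) r
      (superMode (currentG β rβ p) t (ket (0, 0))) (0, 0) = 0 := fun r t ht => by
    rw [superMode_nonneg_vac β rβ p ht, map_zero, Finsupp.zero_apply]
  rw [anticomm, LinearMap.add_apply, Finsupp.add_apply, Module.End.mul_apply, Module.End.mul_apply]
  by_cases h : r + t + 1 = 0
  · obtain rfl : t = -1 - r := by omega
    rw [if_pos h]
    rcases lt_or_ge r 0 with hr | hr
    · rw [hpos _ (-1 - r) (by omega), superMode_superMode_vac β rβ p hr, if_pos (by omega)]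
      push_cast
      ring
    · rw [hpos _ r hr, superMode_superMode_vac β rβ p (by omega), if_pos (by omega)]
      ring
  · rw [if_neg h]
    rcases lt_or_ge r 0 with hr | hr <;> rcases lt_or_ge t 0 with ht | ht
    · rw [superMode_superMode_vac β rβ p hr, superMode_superMode_vac β rβ p ht, if_neg (by omega),
        if_neg (by omega), add_zero]
    · rw [superMode_superMode_vac β rβ p hr, hpos _ _ ht, if_neg (by omega), add_zero]
    · rw [superMode_superMode_vac β rβ p ht, hpos _ _ hr, if_neg (by omega), add_zero]
    · rw [hpos _ _ hr, hpos _ _ ht, add_zero]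

theorem virMode_vac (β rβ p : ℂ) (n : ℤ) : virMode (currentT β rβ p) n (ket (0, 0)) (0, 0) =
    if n = 0 then (p ^ 2 - 2 * sigma β rβ * p) / 2 else 0 := by
  have h0 : currentValue p chargeVec 0 = 0 := by simp [currentValue, chargeVec]
  have h1 : currentValue p neutralVec 0 = p := by simp [currentValue, neutralVec]
  rw [virMode_currentT, sugawara, fermiVir_eq]
  simp only [LinearMap.smul_apply, LinearMap.sub_apply, LinearMap.add_apply,
    Finsupp.smul_apply, Finsupp.sub_apply, Finsupp.add_apply, quad_vac, vertexOp_vac, current_vac,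
    h0, h1]
  by_cases h : n = 0
  · simp [h]; ring
  · simp [h]

/-- The difference with `2L` commutes with `ψ`, `ψ̃` and `ã`, hence is a scalar. On the vacuum its
part depending on `p` cancels against `2L_0`, so only the central term remains. -/
theorem superMode_anticomm_superMode (β rβ p : ℂ) (r t : ℤ) :
    anticomm (superMode (currentG β rβ p) r) (superMode (currentG β rβ p) t) =
      (2 : ℂ) • virMode (currentT β rβ p) (r + t + 1) +
      (if r + t + 1 = 0 then (1 / 2 - 4 * sigma β rβ ^ 2) * (r * (r + 1)) else 0) •
        (1 : Module.End ℂ Fock) := by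
  have h := eq_smul_one_of_comm p
    (D := anticomm (superMode (currentG β rβ p) r) (superMode (currentG β rβ p) t) -
      (2 : ℂ) • virMode (currentT β rβ p) (r + t + 1)) (fun i => ?_) (fun i => ?_) fun i => ?_
  · rw [← sub_eq_iff_eq_add', h]
    congr 1
    rw [LinearMap.sub_apply, Finsupp.sub_apply, LinearMap.smul_apply, Finsupp.smul_apply,
      superMode_anticomm_vac, virMode_vac, smul_eq_mul]
    split_ifs <;> ring
  · have e : ∀ r j, anticomm (superMode (currentG β rβ p) r) (psi p j) = _ :=
      superMode_anticomm_psi β rβ p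
    rw [comm_swap, sub_comm_right, smul_comm_right, comm_anticomm, e, e, comm_sub, comm_sub,
      superMode_comm_boson_true, superMode_comm_boson_true, virMode_comm_psi]
    have hz : ∀ (X : Module.End ℂ Fock) (P : Prop) [Decidable P] (a : ℂ),
        ⁅X, if P then a • (1 : Module.End ℂ Fock) else 0⁆ = 0 := fun X P _ a => by
      split_ifs
      · rw [comm_smul, comm_one, smul_zero]
      · exact comm_zero X
    rw [hz, hz, show -(t - i) - r - 1 = i - (r + t + 1) by omega,
      show -(r - i) - t - 1 = i - (r + t + 1) by omega]
    push_cast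
    module
  · have e : ∀ r, anticomm (superMode (currentG β rβ p) r) (psit p i) = 0 := fun r => by
      rw [anticomm, add_comm, psit_anticomm_superMode]
    rw [comm_swap, sub_comm_right, smul_comm_right, comm_anticomm, e, e, comm_zero, comm_zero,
      comm_swap (virMode _ _), psit_comm_virMode]
    simp
  · have e : ∀ r j, anticomm (superMode (currentG β rβ p) r) (psi p j) = _ :=
      superMode_anticomm_psi β rβ p
    have e' : ∀ r j, anticomm (psi p j) (superMode (currentG β rβ p) r) = _ := fun r j =>
      (add_comm _ _).trans (superMode_anticomm_psi β rβ p r j)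
    have hs : ∀ (a : ℂ) (X Y : Module.End ℂ Fock), anticomm (a • X) Y = a • anticomm X Y :=
      fun a X Y => by simp [anticomm]
    have hs' : ∀ (a : ℂ) (X Y : Module.End ℂ Fock), anticomm X (a • Y) = a • anticomm X Y :=
      fun a X Y => by simp [anticomm]
    rw [comm_swap, sub_comm_right, smul_comm_right, comm_anticomm', superMode_comm_boson_true,
      superMode_comm_boson_true, hs, hs', e, e', virMode_comm_boson_true,
      show t - (-i - r - 1) = r + t + 1 + i by omega,
      show r - (-i - t - 1) = r + t + 1 + i by omega]
    by_cases h : r + t + 1 + i = 0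
    · obtain rfl : i = -(r + t + 1) := by omega
      rw [if_pos (by omega), if_pos (by omega), if_pos h]
      push_cast
      module
    · rw [if_neg (by omega), if_neg (by omega), if_neg h]
      module

theorem isSuperVirasoro (β rβ p : ℂ) : IsSuperVirasoro (3 / 2 - 12 * sigma β rβ ^ 2)
    (virMode (currentT β rβ p)) (superMode (currentG β rβ p)) := by
  refine ⟨isVirasoro_currentT β rβ p, virMode_comm_superMode β rβ p, fun r t => ?_⟩
  have h := superMode_anticomm_superMode β rβ p r t
  rw [anticomm] at h
  rw [h]
  congr 2
  refine if_congr Iff.rfl ?_ rfl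
  ring

/-! ### The two commuting Virasoro algebras -/

/-- The normally ordered product of a current with a vertex operator. -/
def currentVertex (p : ℂ) (u : Bool → ℂ) (k n : ℤ) : Module.End ℂ Fock :=
  u false • bosonVertex p false k n + u true • bosonVertex p true k n

theorem currentVertex_hasSum (p : ℂ) (u : Bool → ℂ) (k n : ℤ) :
    LocHasSum (fun l => if l < 0 then current p u l * vertexOp p k (n + l)
      else vertexOp p k (n + l) * current p u l) (currentVertex p u k n) := by
  refine (((bosonVertex_hasSum p false k n).smul (u false)).add
    ((bosonVertex_hasSum p true k n).smul (u true))).congr fun l => ?_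
  simp only [bosonVertexTerm, current]
  split_ifs <;> simp only [add_mul, mul_add, smul_mul_assoc, mul_smul_comm]

theorem current_comm_vertexOp (p : ℂ) (u : Bool → ℂ) (k n i : ℤ) :
    ⁅current p u n, vertexOp p k i⁆ = (k * u false) • vertexOp p k (i - n) := by
  rw [current, add_comm_right, smul_comm_right, smul_comm_right, boson_comm_vertexOp,
    boson_comm_vertexOp, vertexWeight, vertexWeight]
  simp [smul_smul, mul_comm]

/-- Counts the modes to be reordered in the commutator of a quadratic mode with a vertex operator:
with sign `+1` for `0 ≤ l ≤ n` and `-1` for `n < l < 0`. The net number is `n + 1` for either sign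
of `n`. -/
theorem reordering_count (X : Module.End ℂ Fock) (n : ℤ) :
    LocHasSum (fun l : ℤ => (if 0 ≤ l ∧ l ≤ n then (1 : ℂ) else if n < l ∧ l < 0 then -1 else 0) • X)
      (((n : ℂ) + 1) • X) := by
  rcases lt_or_ge n 0 with hn | hn
  · have h := LocHasSum.of_finset (f := fun l : ℤ =>
      (if 0 ≤ l ∧ l ≤ n then (1 : ℂ) else if n < l ∧ l < 0 then -1 else 0) • X) (Finset.Ioo n 0)
      fun l hl => by
        rw [Finset.mem_Ioo] at hl
        simp only [if_neg hl, if_neg (show ¬(0 ≤ l ∧ l ≤ n) by omega), zero_smul]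
    rw [Finset.sum_congr rfl (g := fun _ => -X) (fun l hl => by
      rw [Finset.mem_Ioo] at hl
      rw [if_neg (by omega), if_pos hl, neg_one_smul]), Finset.sum_const, Int.card_Ioo] at h
    have e : (n + 1 : ℂ) • X = (0 - n - 1).toNat • -X := by
      rw [← Nat.cast_smul_eq_nsmul ℂ, smul_neg, ← neg_smul]
      congr 1
      have : (((0 - n - 1).toNat : ℤ) : ℂ) = ((0 - n - 1 : ℤ) : ℂ) := by
        rw [Int.toNat_of_nonneg (by omega)]
      push_cast at this
      rw [this]; ring
    rw [e]
    exact h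
  · have h := LocHasSum.of_finset (f := fun l : ℤ =>
      (if 0 ≤ l ∧ l ≤ n then (1 : ℂ) else if n < l ∧ l < 0 then -1 else 0) • X) (Finset.Icc 0 n)
      fun l hl => by
        rw [Finset.mem_Icc] at hl
        simp only [if_neg hl, if_neg (show ¬(n < l ∧ l < 0) by omega), zero_smul]
    rw [Finset.sum_congr rfl (g := fun _ => X) (fun l hl => by
      rw [Finset.mem_Icc] at hl
      rw [if_pos hl, one_smul]), Finset.sum_const, Int.card_Icc] at h
    have e : (n + 1 : ℂ) • X = (n + 1 - 0).toNat • X := by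
      rw [← Nat.cast_smul_eq_nsmul ℂ]
      congr 1
      have : (((n + 1 - 0).toNat : ℤ) : ℂ) = ((n + 1 - 0 : ℤ) : ℂ) := by
        rw [Int.toNat_of_nonneg (by omega)]
      push_cast at this
      rw [this]; ring
    rw [e]
    exact h

theorem quad_comm_vertexOp (p : ℂ) (u : Bool → ℂ) (k n i : ℤ) :
    ⁅quad p u n, vertexOp p k i⁆ = (2 * (k * u false)) • currentVertex p u k (i - n) +
      ((k * u false) ^ 2 * ((n : ℂ) + 1)) • vertexOp p k (i - n) := by
  set w : ℂ := k * u false with hw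
  have h := currentVertex_hasSum p u k (i - n)
  -- Either factor of the square may meet the vertex operator. Each choice sums to `currentVertex`,
  -- the second after reflection and up to the reordering terms.
  have hs := ((h.smul w).add ((h.reflect n).smul w)).add
    ((reordering_count (vertexOp p k (i - n)) n).smul (w ^ 2))
  rw [show (2 * w) • currentVertex p u k (i - n) + (w ^ 2 * ((n : ℂ) + 1)) • vertexOp p k (i - n) =
    w • currentVertex p u k (i - n) + w • currentVertex p u k (i - n) +
      w ^ 2 • (((n : ℂ) + 1) • vertexOp p k (i - n)) by module]
  refine ((quad_hasSum p u n).comm_right _).unique (hs.congr fun l => ?_)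
  have hJ : ∀ l, ⁅current p u l, vertexOp p k i⁆ = w • vertexOp p k (i - l) := fun l =>
    current_comm_vertexOp p u k l i
  have hJV : current p u (n - l) * vertexOp p k (i - l) =
      w • vertexOp p k (i - n) + vertexOp p k (i - l) * current p u (n - l) := by
    have := current_comm_vertexOp p u k (n - l) (i - l)
    rw [show i - l - (n - l) = i - n by omega, Ring.lie_def] at this
    rw [← this]; abel
  rw [quadTerm, show i - n + (n - l) = i - l by omega]
  by_cases h1 : l < 0
  · rw [if_pos h1, if_pos h1, mul_comm_right, hJ, hJ, show i - (n - l) = i - n + l by omega,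
      mul_smul_comm, smul_mul_assoc, if_neg (show ¬(0 ≤ l ∧ l ≤ n) by omega)]
    by_cases h2 : n - l < 0
    · rw [if_pos h2, if_pos (by omega), hJV]
      module
    · rw [if_neg h2, if_neg (by omega)]
      module
  · rw [if_neg h1, if_neg h1, mul_comm_right, hJ, hJ, show i - (n - l) = i - n + l by omega,
      mul_smul_comm, smul_mul_assoc]
    by_cases h2 : n - l < 0
    · rw [if_pos h2, if_neg (by omega), if_neg (by omega)]
      module
    · rw [if_neg h2, if_pos (by omega), hJV]
      module

theorem sugawara_comm_vertexOp (p : ℂ) (u : Bool → ℂ) (ρ : ℂ) (k n i : ℤ) :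
    ⁅sugawara p u ρ n, vertexOp p k i⁆ = (2 * (k * u false)) • currentVertex p u k (i - n) +
      (((k * u false) ^ 2 - ρ * (k * u false)) * ((n : ℂ) + 1)) • vertexOp p k (i - n) := by
  rw [sugawara, sub_comm_right, smul_comm_right, quad_comm_vertexOp, current_comm_vertexOp]
  module

theorem vertexOp_comm_vertexOp (p : ℂ) {k : ℤ} (hk : k * k = 4) (i j : ℤ) :
    ⁅vertexOp p k i, vertexOp p k j⁆ = 0 := by
  rw [Ring.lie_def, vertexOp_mul_comm p (k := k) (l := k) (a := 4) (by exact_mod_cast hk)]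
  norm_num

/-- The modes of `:J(z)²: + ρ J'(z) + κ :e^{kφ(z)}:` for a current `J`. -/
def dressed (p : ℂ) (u : Bool → ℂ) (ρ κ : ℂ) (k n : ℤ) : Module.End ℂ Fock :=
  sugawara p u ρ n + κ • vertexOp p k (-n - 2)

/-- For `dot u u ≠ 0`, the hypothesis `h` says that the vertex operator has weight one for the
normalized Sugawara field. The current–vertex terms cancel by antisymmetry in `n` and `m`, and the
weight terms leave precisely the factor `n - m`. Two vertex operators of charge `k` commute since
`k²` is even and positive. -/
theorem dressed_comm_dressed (p : ℂ) (u : Bool → ℂ) (ρ κ : ℂ) {k : ℤ} (hk : k * k = 4)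
    (h : (k * u false) ^ 2 - ρ * (k * u false) = 2 * dot u u) (n m : ℤ) :
    ⁅dressed p u ρ κ k n, dressed p u ρ κ k m⁆ =
      (2 * dot u u * ((n : ℂ) - m)) • dressed p u ρ κ k (n + m) +
      if n + m = 0 then ((dot u u ^ 2 / 3 - ρ ^ 2 * dot u u) * ((n : ℂ) ^ 3 - n)) •
        (1 : Module.End ℂ Fock) else 0 := by
  simp only [dressed, add_comm_right, comm_add, smul_comm_right, comm_smul]
  rw [sugawara_comm_sugawara, vertexOp_comm_vertexOp p hk, comm_swap (vertexOp p k _),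
    sugawara_comm_vertexOp, sugawara_comm_vertexOp, h, show -m - 2 - n = -(n + m) - 2 by omega,
    show -n - 2 - m = -(n + m) - 2 by omega]
  module

theorem isVirasoro_dressed (p : ℂ) (u : Bool → ℂ) (ρ κ : ℂ) {k : ℤ} (hk : k * k = 4)
    (h : (k * u false) ^ 2 - ρ * (k * u false) = 2 * dot u u) (hu : dot u u ≠ 0) :
    IsVirasoro (1 - 3 * ρ ^ 2 / dot u u) fun n => (1 / (2 * dot u u)) • dressed p u ρ κ k n := by
  intro n m
  dsimp only
  rw [← Ring.lie_def, smul_comm_right, comm_smul, dressed_comm_dressed p u ρ κ hk h, smul_add,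
    smul_add]
  congr 1
  · simp only [smul_smul]
    congr 1
    field_simp
  · split_ifs
    · simp only [smul_smul]
      congr 1
      field_simp
      ring
    · simp

/-- Orthogonality kills the bosonic commutator. The two cross terms have equal coefficients `θ`, and
since `u` and `w` agree on `ã`, the difference of their current–vertex products is a multiple of the
derivative of the vertex operator; it cancels the weight terms. -/
theorem dressed_comm_of_dot_eq_zero (p : ℂ) {u w : Bool → ℂ} (huw : dot u w = 0) {ρ κ κ' θ : ℂ}
    {k : ℤ} (hk : k * k = 4) (h1 : κ' * (k * u false) = θ) (h2 : κ * (k * w false) = θ)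
    (h3 : κ' * ((k * u false) ^ 2 - ρ * (k * u false)) = θ * (k * u false - k * w false) / 2)
    (h4 : κ * ((k * w false) ^ 2 - ρ * (k * w false)) = -(θ * (k * u false - k * w false) / 2))
    (h5 : u true = w true) (n m : ℤ) :
    ⁅dressed p u ρ κ k n, dressed p w ρ κ' k m⁆ = 0 := by
  set N : ℤ := -(n + m) - 2 with hN
  have hP : currentVertex p u k N - currentVertex p w k N =
      ((k * u false - k * w false) * N / 4) • vertexOp p k N := by
    have hkc : (k : ℂ) * k = 4 := by exact_mod_cast hk
    have hb : bosonVertex p false k N = ((k : ℂ) / 4) • ((N : ℂ) • vertexOp p k N) := by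
      rw [smul_vertexOp, smul_smul, div_mul_eq_mul_div, hkc, div_self (by norm_num : (4 : ℂ) ≠ 0), one_smul]
    rw [currentVertex, currentVertex, h5, hb]
    module
  have e : ∀ (P Q V : Module.End ℂ Fock), P - Q = ((k * u false - k * w false) * N / 4) • V →
      κ' • ((2 * (k * u false)) • P +
        (((k * u false) ^ 2 - ρ * (k * u false)) * ((n : ℂ) + 1)) • V) -
      κ • ((2 * (k * w false)) • Q +
        (((k * w false) ^ 2 - ρ * (k * w false)) * ((m : ℂ) + 1)) • V) = 0 := by
    intro P Q V hPQ
    calc _ = (2 * (κ' * (k * u false))) • P +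
          (κ' * ((k * u false) ^ 2 - ρ * (k * u false)) * ((n : ℂ) + 1)) • V -
          (2 * (κ * (k * w false))) • Q -
          (κ * ((k * w false) ^ 2 - ρ * (k * w false)) * ((m : ℂ) + 1)) • V := by module
      _ = (2 * θ) • (P - Q) + (θ * (k * u false - k * w false) / 2 * ((n : ℂ) + m + 2)) • V := by
        rw [h1, h2, h3, h4]; module
      _ = 0 := by
        rw [hPQ, hN]
        push_cast
        module
  have := e _ _ _ hP
  simp only [dressed, add_comm_right, comm_add, smul_comm_right, comm_smul]
  rw [sugawara_comm_of_dot_eq_zero p huw, vertexOp_comm_vertexOp p hk, comm_swap (vertexOp p k _),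
    sugawara_comm_vertexOp, sugawara_comm_vertexOp, show -m - 2 - n = N by omega,
    show -n - 2 - m = N by omega]
  refine Eq.trans ?_ this
  simp only [smul_neg, smul_zero, zero_add, add_zero]
  abel

/-- The label of the current in `𝖳(x; z)`. -/
def mixedVec (rβ x : ℂ) : Bool → ℂ := fun s => if s then rβ else x

theorem virMode_sfT {β rβ : ℂ} (hβ : β ≠ 0) (hr : rβ ^ 2 = β) (p x : ℂ) (n : ℤ) :
    (2 * β) • virMode (sfT β rβ p x) n = sugawara p (mixedVec rβ x) (1 - β) n +
      ((1 + x) * (x - β)) • vertexOp p 2 (-n - 2) +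
      ((x - 1) * (x + β)) • vertexOp p (-2) (-n - 2) := by
  rw [virMode, sfT_eq hβ hr, show -(-n - 2) - 2 = n by omega, sugawara, quad, current]
  simp only [mixedVec, if_true, Bool.false_eq_true, if_false, hr]
  push_cast
  module

/-- At these four values of `x` one of the factors `(1 + x)(x - β)` and `(x - 1)(x + β)` vanishes,
and both members of a pair retain the same vertex operator. -/
theorem virMode_sfT_eq_dressed {β rβ : ℂ} (hβ : β ≠ 0) (hr : rβ ^ 2 = β) (p : ℂ) {k : ℤ} {ε : ℂ}
    (h : ε = 1 ∧ k = 2 ∨ ε = -1 ∧ k = -2) (n : ℤ) :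
    (2 * β) • virMode (sfT β rβ p ε) n =
      dressed p (mixedVec rβ ε) (1 - β) (2 * (1 - β)) k n ∧
    (2 * β) • virMode (sfT β rβ p (-ε * β)) n =
      dressed p (mixedVec rβ (-ε * β)) (1 - β) (-2 * β * (1 - β)) k n := by
  rw [virMode_sfT hβ hr, virMode_sfT hβ hr, dressed, dressed]
  rcases h with ⟨rfl, rfl⟩ | ⟨rfl, rfl⟩ <;> constructor <;> module

theorem sfT_commute {β rβ : ℂ} (hβ : β ≠ 0) (hr : rβ ^ 2 = β) (p : ℂ) {ε : ℂ}
    (hε : ε = 1 ∨ ε = -1) (n m : ℤ) :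
    Commute (virMode (sfT β rβ p ε) n) (virMode (sfT β rβ p (-ε * β)) m) := by
  have h2β : (2 * β) ≠ 0 := mul_ne_zero two_ne_zero hβ
  obtain ⟨k, hk⟩ : ∃ k : ℤ, ε = 1 ∧ k = 2 ∨ ε = -1 ∧ k = -2 := by
    rcases hε with h | h
    · exact ⟨2, Or.inl ⟨h, rfl⟩⟩
    · exact ⟨-2, Or.inr ⟨h, rfl⟩⟩
  have h : ⁅(2 * β) • virMode (sfT β rβ p ε) n, (2 * β) • virMode (sfT β rβ p (-ε * β)) m⁆ = 0 := by
    rw [(virMode_sfT_eq_dressed hβ hr p hk n).1, (virMode_sfT_eq_dressed hβ hr p hk m).2]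
    -- The value of `θ` is forced by `κ' k u = (-2β(1 - β)) (kε)` with `kε = 2`.
    refine dressed_comm_of_dot_eq_zero p (θ := -4 * β * (1 - β)) ?_ ?_ ?_ ?_ ?_ ?_ ?_ n m <;>
      (try simp only [dot, mixedVec, if_true, Bool.false_eq_true, if_false]) <;>
      rcases hk with ⟨rfl, rfl⟩ | ⟨rfl, rfl⟩ <;> push_cast <;>
      first | rfl | ring1 | linear_combination hr
  rw [smul_comm_right, comm_smul, smul_smul, smul_eq_zero] at h
  exact mul_eq_of_comm_eq_zero (h.resolve_left (mul_ne_zero h2β h2β))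

theorem sfT_isVirasoro {β rβ : ℂ} (hβ : β ≠ 0) (hr : rβ ^ 2 = β) (p : ℂ) {ε : ℂ}
    (hε : ε = 1 ∨ ε = -1) (h1 : β ≠ -1) :
    IsVirasoro ((2 - β) * (3 * β - 1) / (1 + β))
        (fun n => (β / (1 + β)) • virMode (sfT β rβ p ε) n) ∧
      IsVirasoro ((2 * β - 1) * (3 - β) / (β * (1 + β)))
        (fun n => (1 / (1 + β)) • virMode (sfT β rβ p (-ε * β)) n) := by
  have h1β : 1 + β ≠ 0 := fun h => h1 (by linear_combination h)
  obtain ⟨k, hk⟩ : ∃ k : ℤ, ε = 1 ∧ k = 2 ∨ ε = -1 ∧ k = -2 := by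
    rcases hε with h | h
    · exact ⟨2, Or.inl ⟨h, rfl⟩⟩
    · exact ⟨-2, Or.inr ⟨h, rfl⟩⟩
  have hkk : k * k = 4 := by rcases hk with ⟨-, rfl⟩ | ⟨-, rfl⟩ <;> norm_num
  have hε2 : ε ^ 2 = 1 := by rcases hε with rfl | rfl <;> norm_num
  have hkε : k * ε = 2 := by rcases hk with ⟨rfl, rfl⟩ | ⟨rfl, rfl⟩ <;> norm_num
  have d1 : dot (mixedVec rβ ε) (mixedVec rβ ε) = 1 + β := by
    simp only [dot, mixedVec, if_true, Bool.false_eq_true, if_false]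
    linear_combination hε2 + hr
  have d2 : dot (mixedVec rβ (-ε * β)) (mixedVec rβ (-ε * β)) = β * (1 + β) := by
    simp only [dot, mixedVec, if_true, Bool.false_eq_true, if_false]
    linear_combination β ^ 2 * hε2 + hr
  constructor
  · have h := isVirasoro_dressed p (mixedVec rβ ε) (1 - β) (2 * (1 - β)) hkk (by
      rw [d1]
      simp only [mixedVec, Bool.false_eq_true, if_false, hkε]
      ring) (by rw [d1]; exact h1β)
    have e : (fun n => (β / (1 + β)) • virMode (sfT β rβ p ε) n) = fun n : ℤ =>
        (1 / (2 * dot (mixedVec rβ ε) (mixedVec rβ ε))) •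
          dressed p (mixedVec rβ ε) (1 - β) (2 * (1 - β)) k n := by
      funext n
      rw [← (virMode_sfT_eq_dressed hβ hr p hk n).1, d1, smul_smul]
      congr 1
      field_simp
    rw [e]
    convert h using 1
    rw [d1]
    field_simp
    ring
  · have h := isVirasoro_dressed p (mixedVec rβ (-ε * β)) (1 - β) (-2 * β * (1 - β)) hkk (by
      rw [d2]
      simp only [mixedVec, Bool.false_eq_true, if_false]
      rw [show k * (-ε * β) = -β * (k * ε) by ring, hkε]
      ring) (by rw [d2]; exact mul_ne_zero hβ h1β)
    have e : (fun n => (1 / (1 + β)) • virMode (sfT β rβ p (-ε * β)) n) = fun n : ℤ =>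
        (1 / (2 * dot (mixedVec rβ (-ε * β)) (mixedVec rβ (-ε * β)))) •
          dressed p (mixedVec rβ (-ε * β)) (1 - β) (-2 * β * (1 - β)) k n := by
      funext n
      rw [← (virMode_sfT_eq_dressed hβ hr p hk n).2, d2, smul_smul]
      congr 1
      field_simp
    rw [e]
    convert h using 1
    rw [d2]
    field_simp
    ring

/-! ### Second-order Taylor expansions -/

open Asymptotics in
/-- The function `f` is analytic at `0` and `f(h) = a + b h + c h² + O(h³)`. -/
def Jet (f : ℂ → ℂ) (a b c : ℂ) : Prop :=
  AnalyticAt ℂ f 0 ∧ (fun h => f h - (a + b * h + c * h ^ 2)) =O[nhds 0] fun h => h ^ 3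

namespace Jet

variable {f g : ℂ → ℂ} {a b c a' b' c' : ℂ}

theorem congr (h : Jet f a b c) (hf : ∀ z, g z = f z) (ha : a' = a) (hb : b' = b) (hc : c' = c) :
    Jet g a' b' c' := by
  obtain rfl : g = f := funext hf
  subst ha hb hc
  exact h

theorem add (h : Jet f a b c) (h' : Jet g a' b' c') :
    Jet (fun z => f z + g z) (a + a') (b + b') (c + c') := by
  refine ⟨h.1.add h'.1, (h.2.add h'.2).congr_left fun z => ?_⟩
  ring

theorem smul (h : Jet f a b c) (k : ℂ) : Jet (fun z => k * f z) (k * a) (k * b) (k * c) := by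
  refine ⟨analyticAt_const.mul h.1, (h.2.const_mul_left k).congr_left fun z => ?_⟩
  ring

theorem neg (h : Jet f a b c) : Jet (fun z => -f z) (-a) (-b) (-c) :=
  (h.smul (-1)).congr (fun _ => by ring) (by ring) (by ring) (by ring)

theorem sub (h : Jet f a b c) (h' : Jet g a' b' c') :
    Jet (fun z => f z - g z) (a - a') (b - b') (c - c') :=
  (h.add h'.neg).congr (fun _ => by ring) (by ring) (by ring) (by ring)

theorem const (k : ℂ) : Jet (fun _ => k) k 0 0 := by
  refine ⟨analyticAt_const, (Asymptotics.isBigO_zero _ _).congr_left fun z => ?_⟩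
  ring

theorem isBigO_one (h : AnalyticAt ℂ f 0) : f =O[nhds 0] fun _ => (1 : ℂ) :=
  h.continuousAt.tendsto.isBigO_one ℂ

theorem mul (h : Jet f a b c) (h' : Jet g a' b' c') :
    Jet (fun z => f z * g z) (a * a') (a * b' + b * a') (a * c' + b * b' + c * a') := by
  refine ⟨h.1.mul h'.1, ?_⟩
  have h1 := h.2.mul (isBigO_one h'.1)
  have h2 := (isBigO_one (f := fun z => a + b * z + c * z ^ 2) (by fun_prop)).mul h'.2
  have h3 := (Asymptotics.isBigO_refl (fun z : ℂ => z ^ 3) (nhds 0)).mul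
    (isBigO_one (f := fun z => b * c' + c * b' + c * c' * z) (by fun_prop))
  simp only [mul_one, one_mul] at h1 h2 h3
  refine ((h1.add h2).add h3).congr_left fun z => ?_
  ring

theorem apply_zero (h : Jet f a b c) : f 0 = a := by
  obtain ⟨C, hC⟩ := Asymptotics.isBigO_iff.1 h.2
  have := hC.self_of_nhds
  rw [← sub_eq_zero]
  simpa using this

theorem poly (a b c : ℂ) : Jet (fun z => a + b * z + c * z ^ 2) a b c :=
  ⟨by fun_prop, (Asymptotics.isBigO_zero _ _).congr_left fun z => (sub_self _).symm⟩

/-- The hypotheses say that `r + s z + t z²` is the quotient by long division through order two. -/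
theorem div (h : Jet f a b c) (h' : Jet g a' b' c') (h0 : a' ≠ 0) {r s t : ℂ} (ha : a = r * a')
    (hb : b = r * b' + s * a') (hc : c = r * c' + s * b' + t * a') :
    Jet (fun z => f z / g z) r s t := by
  have hg0 : g 0 ≠ 0 := by rwa [h'.apply_zero]
  refine ⟨h.1.div h'.1 hg0, ?_⟩
  have h1 := (h.sub ((poly r s t).mul h')).2.mul (isBigO_one (h'.1.inv hg0))
  simp only [mul_one] at h1
  refine h1.congr' ?_ Filter.EventuallyEq.rfl
  filter_upwards [h'.1.continuousAt.eventually_ne hg0] with z hz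
  subst ha hb hc
  rw [Pi.inv_apply]
  field_simp
  ring

theorem exp (k : ℂ) : Jet (fun z => Complex.exp (k * z)) 1 k (k ^ 2 / 2) := by
  refine ⟨by fun_prop, ?_⟩
  have ht : Filter.Tendsto (fun z : ℂ => k * z) (nhds 0) (nhds 0) := by
    have : Continuous fun z : ℂ => k * z := by fun_prop
    simpa using this.tendsto 0
  have h := (Complex.exp_sub_sum_range_isBigO_pow 3).comp_tendsto ht
  have h2 : ((fun z : ℂ => z ^ 3) ∘ fun z => k * z) =O[nhds 0] fun z : ℂ => z ^ 3 :=
    ((Asymptotics.isBigO_refl (fun z : ℂ => z ^ 3) (nhds 0)).const_mul_left (k ^ 3)).congr_left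
      fun z => by simp; ring
  refine (h.trans h2).congr_left fun z => ?_
  simp [Finset.sum_range_succ, Nat.factorial]
  ring

/-- After a prefactor of order two, only the value at zero of the other factor is needed; its Taylor
coefficients do not matter. -/
theorem order_two_mul (h : Jet f 0 0 c) (hg : AnalyticAt ℂ g 0) :
    Jet (fun z => f z * g z) 0 0 (c * g 0) := by
  refine ⟨h.1.mul hg, ?_⟩
  have h1 := h.2.mul (isBigO_one hg)
  have h2 : (fun z => g z - g 0) =O[nhds 0] fun z : ℂ => z := by
    simpa using hg.differentiableAt.isBigO_sub
  have h3 := (Asymptotics.isBigO_refl (fun z : ℂ => z ^ 2) (nhds 0)).mul h2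
  simp only [mul_one] at h1
  refine (h1.add ((h3.const_mul_left c).congr_right fun z => by ring)).congr_left fun z => ?_
  ring

theorem sum {ι : Type*} (s : Finset ι) {F : ι → ℂ → ℂ} {A B C : ι → ℂ}
    (h : ∀ i ∈ s, Jet (F i) (A i) (B i) (C i)) :
    Jet (fun z => ∑ i ∈ s, F i z) (∑ i ∈ s, A i) (∑ i ∈ s, B i) (∑ i ∈ s, C i) := by
  classical
  induction s using Finset.induction_on with
  | empty => simpa using const 0
  | insert i s hi ih =>
    simp only [Finset.sum_insert hi]
    exact (h i (by simp)).add (ih fun j hj => h j (by simp [hj]))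

end Jet

/-! ### The exponents of the deformed vertex operators -/

theorem qq_zpow (β h : ℂ) (n : ℤ) : qq β h ^ n = Complex.exp (n * ((β - 1) / 2) * h) := by
  rw [qq, ← Complex.exp_int_mul]
  congr 1
  ring

theorem q1_zpow (h : ℂ) (n : ℤ) : q1 h ^ n = Complex.exp (n * h) := by
  rw [q1, ← Complex.exp_int_mul]

theorem q2_zpow (β h : ℂ) (n : ℤ) : q2 β h ^ n = Complex.exp (n * (β - 1) * h) := by
  rw [q2, ← Complex.exp_int_mul]
  congr 1
  ring

theorem q3_zpow (β h : ℂ) (n : ℤ) : q3 β h ^ n = Complex.exp (-(n * β) * h) := by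
  rw [q3, ← Complex.exp_int_mul]
  congr 1
  ring

theorem exp_zpow (x h : ℂ) (n : ℤ) :
    Complex.exp (x * h) ^ n = Complex.exp (n * x * h) := by
  rw [← Complex.exp_int_mul]
  congr 1
  ring

/-- Positive and negative modes are defined by different formulas, but their expansions agree
through second order; for `n < 0` this uses `rβ² = β`. -/
theorem jet_bCoeff_true {β rβ : ℂ} (hβ : β ≠ 0) (hr : rβ ^ 2 = β) (ε : ℤ) {n : ℤ} (hn : n ≠ 0) :
    Jet (fun h => bCoeff β rβ h ε true n) 0 (-(rβ / 2 * n)) (-(rβ * n ^ 2 / 4)) := by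
  have hrβ : rβ ≠ 0 := fun h => hβ (by rw [← hr, h]; ring)
  rcases lt_or_gt_of_ne hn with h | h
  · refine Jet.congr (((Jet.const 1).sub (Jet.exp (n * β))).div
      (((Jet.const 1).add (Jet.exp (n * (β - 1)))).smul rβ) ?_ (r := 0) (s := -(rβ / 2 * n))
      (t := -(rβ * n ^ 2 / 4)) ?_ ?_ ?_) (fun z => ?_) rfl rfl rfl
    · exact mul_ne_zero hrβ (by norm_num)
    · ring
    · linear_combination (n : ℂ) * hr
    · linear_combination ((n : ℂ) ^ 2 * β / 2) * hr
    · simp only [bCoeff, if_neg (show ¬ 0 < n by omega), if_true, q3_zpow, q2_zpow]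
      push_cast
      rw [show -(-(n : ℂ) * β) = n * β by ring]
  · refine Jet.congr (((Jet.const 1).sub (Jet.exp n)).smul (rβ / 2)) (fun z => ?_) ?_ ?_ ?_
    · simp only [bCoeff, if_pos h, if_true, q1_zpow]
    · ring
    · ring
    · ring

/-- The second-order coefficient is left unspecified: for the neutral products this factor
multiplies `ξ^{-n} - 1`, which vanishes at `ħ = 0`, so only orders zero and one enter. -/
theorem jet_bCoeff_false (β rβ : ℂ) (ε : ℤ) (n : ℤ) :
    ∃ c, Jet (fun h => bCoeff β rβ h ε false n) ε 0 c := by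
  by_cases h : 0 < n
  · refine ⟨ε * (n ^ 2 * β / 4), Jet.congr (((((Jet.const 1).add (Jet.exp n)).mul
      ((Jet.const 1).add (Jet.exp (-(n * β))))).div
      (((Jet.const 1).add (Jet.exp (-n * (β - 1)))).smul 2) ?_ (r := 1) (s := 0)
      (t := n ^ 2 * β / 4) ?_ ?_ ?_).smul ε)
      (fun z => ?_) (mul_one _).symm (mul_zero _).symm rfl⟩
    · norm_num
    · ring
    · ring
    · ring
    · simp only [bCoeff, if_pos h, Bool.false_eq_true, if_false, q1_zpow, q2_zpow, q3_zpow]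
      push_cast
      rfl
  · refine ⟨0, (Jet.const ε).congr (fun z => ?_) rfl rfl rfl⟩
    simp [bCoeff, h]

theorem bCoeff_false_neg (β rβ h : ℂ) (n : ℤ) :
    bCoeff β rβ h (-1) false n = -bCoeff β rβ h 1 false n := by
  simp only [bCoeff]
  split_ifs <;> simp_all

theorem jet_expPP_true {β rβ : ℂ} (hβ : β ≠ 0) (hr : rβ ^ 2 = β) (x : ℂ) {n : ℤ} (hn : n ≠ 0) :
    Jet (fun h => (expPP β rβ h (Complex.exp (x * h))).coeff true n) 0 rβ
      (rβ * (β - x) / 2 * n) := by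
  have hn' : (n : ℂ) ≠ 0 := by exact_mod_cast hn
  have hb := jet_bCoeff_true hβ hr 1 hn
  have hb' := jet_bCoeff_true hβ hr (-1) hn
  have hq := (Jet.exp (n * ((β - 1) / 2))).smul (-(1 / (n : ℂ)))
  refine Jet.congr (((hq.mul hb).mul (Jet.exp (-n * x))).add (hq.mul hb')) (fun z => ?_) ?_ ?_ ?_
  · simp only [expPP, Exponent.add, lambdaPlus, qq_zpow, exp_zpow, one_zpow]
    push_cast
    ring
  · ring
  · field_simp; ring
  · field_simp; ring

theorem jet_expMM_true {β rβ : ℂ} (hβ : β ≠ 0) (hr : rβ ^ 2 = β) (x : ℂ) {n : ℤ} (hn : n ≠ 0) :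
    Jet (fun h => (expMM β rβ h (Complex.exp (x * h))).coeff true n) 0 (-rβ)
      (rβ * (β - 2 + x) / 2 * n) := by
  have hn' : (n : ℂ) ≠ 0 := by exact_mod_cast hn
  have hb := jet_bCoeff_true hβ hr 1 hn
  have hb' := jet_bCoeff_true hβ hr (-1) hn
  have hq := (Jet.exp (-n * ((β - 1) / 2))).smul (1 / (n : ℂ))
  refine Jet.congr (((hq.mul hb).mul (Jet.exp (-n * x))).add (hq.mul hb')) (fun z => ?_) ?_ ?_ ?_
  · simp only [expMM, Exponent.add, lambdaMinus, qq_zpow, exp_zpow, one_zpow]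
    push_cast
    ring
  · ring
  · field_simp; ring
  · field_simp; ring

theorem jet_expPP_false (β rβ x : ℂ) {n : ℤ} (hn : n ≠ 0) :
    Jet (fun h => (expPP β rβ h (Complex.exp (x * h))).coeff false n) 0 x
      (x * (β - 1 - x) / 2 * n) := by
  have hn' : (n : ℂ) ≠ 0 := by exact_mod_cast hn
  obtain ⟨t, hb⟩ := jet_bCoeff_false β rβ 1 n
  have hq := (Jet.exp (n * ((β - 1) / 2))).smul (-(1 / (n : ℂ)))
  refine Jet.congr ((hq.mul hb).mul ((Jet.exp (-n * x)).sub (Jet.const 1))) (fun z => ?_) ?_ ?_ ?_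
  · simp only [expPP, Exponent.add, lambdaPlus, qq_zpow, exp_zpow, one_zpow, bCoeff_false_neg]
    push_cast
    ring
  · ring
  · push_cast; field_simp; ring
  · push_cast; field_simp; ring

theorem jet_expMM_false (β rβ x : ℂ) {n : ℤ} (hn : n ≠ 0) :
    Jet (fun h => (expMM β rβ h (Complex.exp (x * h))).coeff false n) 0 (-x)
      (x * (β - 1 + x) / 2 * n) := by
  have hn' : (n : ℂ) ≠ 0 := by exact_mod_cast hn
  obtain ⟨t, hb⟩ := jet_bCoeff_false β rβ 1 n
  have hq := (Jet.exp (-n * ((β - 1) / 2))).smul (1 / (n : ℂ))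
  refine Jet.congr ((hq.mul hb).mul ((Jet.exp (-n * x)).sub (Jet.const 1))) (fun z => ?_) ?_ ?_ ?_
  · simp only [expMM, Exponent.add, lambdaMinus, qq_zpow, exp_zpow, one_zpow, bCoeff_false_neg]
    push_cast
    ring
  · ring
  · push_cast; field_simp; ring
  · push_cast; field_simp; ring

/-! ### Second-order expansion of a neutral normally ordered exponential -/

/-- A family of neutral exponents whose coefficients have the expansions
`u_s h + n e_s h² + O(h³)`. -/
structure NeutralFamily (p : ℂ) (E : ℂ → Exponent) (u e : Bool → ℂ) : Prop where
  coeff_jet : ∀ s n, n ≠ 0 → Jet (fun h => (E h).coeff s n) 0 (u s) (e s * n)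
  charge_eq : ∀ h, (E h).charge = 0
  zero_eq : ∀ h (c : ℤ), (E h).scale ^ c * Complex.exp ((E h).tilde * p) =
    Complex.exp (currentValue p u c * h)

/-- The coefficients of the expansion of a neutral normally ordered exponential. -/
def neutralTerm (p : ℂ) (u e : Bool → ℂ) (N : ℤ) : Fin 3 → Module.End ℂ Fock
  | 0 => if N = 0 then 1 else 0
  | 1 => current p u (-N)
  | 2 => (1 / 2 : ℂ) • quad p u (-N) + (-(N : ℂ)) • current p e (-N)

/-- Formally this is the expansion of `:exp(hJ + h²K + O(h³)):` through order two. The induction on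
matrix elements applies because commutation with a mode multiplies the exponential by a scalar
function with a known expansion. -/
theorem jet_normalExp {p : ℂ} {E : ℂ → Exponent} {u e : Bool → ℂ} (hE : NeutralFamily p E u e)
    (N : ℤ) (b b' : FockIndex) : Jet (fun h => normalExp p (E h) N (ket b) b')
      (neutralTerm p u e N 0 (ket b) b') (neutralTerm p u e N 1 (ket b) b')
      (neutralTerm p u e N 2 (ket b) b') := by
  -- The parameter set joins all values of `h` with three extra points carrying the proposed Taylor
  -- coefficients. The subspace consists of the data for which the expansion is correct.
  let I : Submodule ℂ (ℂ ⊕ Fin 3 → ℂ) :=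
    { carrier := {F | Jet (fun h => F (Sum.inl h)) (F (Sum.inr 0)) (F (Sum.inr 1)) (F (Sum.inr 2))}
      add_mem' := fun h h' => h.add h'
      zero_mem' := Jet.const 0
      smul_mem' := fun k _ h => h.smul k }
  -- Scalar prefactors with an expansion are included so that the family is closed under
  -- commutators; the three extra entries follow the Leibniz rule.
  let X (r : ℂ → ℂ) (r0 r1 r2 : ℂ) (N : ℤ) : ℂ ⊕ Fin 3 → Module.End ℂ Fock := Sum.elim
    (fun h => r h • normalExp p (E h) N)
    ![r0 • neutralTerm p u e N 0, r0 • neutralTerm p u e N 1 + r1 • neutralTerm p u e N 0,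
      r0 • neutralTerm p u e N 2 + r1 • neutralTerm p u e N 1 + r2 • neutralTerm p u e N 0]
  have h := matrix_mem_of_vac p I {Y | ∃ r r0 r1 r2 N, Jet r r0 r1 r2 ∧ Y = X r r0 r1 r2 N}
    ?_ ?_ (X (fun _ => 1) 1 0 0 N) ⟨_, _, _, _, _, Jet.const 1, rfl⟩ b b'
  · refine Jet.congr (f := fun h => X (fun _ => 1) 1 0 0 N (Sum.inl h) (ket b) b') h
      (fun z => ?_) ?_ ?_ ?_ <;> simp [X]
  · rintro _ ⟨r, r0, r1, r2, N, hr, rfl⟩ s m hm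
    refine ⟨_, _, _, _, N - m, hr.mul ((hE.coeff_jet s (-m) (neg_ne_zero.2 hm)).smul m), ?_⟩
    have h0 : ⁅boson p s m, neutralTerm p u e N 0⁆ = 0 := by
      simp only [neutralTerm]
      split_ifs
      · exact comm_one _
      · exact comm_zero _
    have h1 : ⁅boson p s m, neutralTerm p u e N 1⁆ = (m * u s) • neutralTerm p u e (N - m) 0 := by
      simp only [neutralTerm]
      rw [boson_comm_current, smul_ite, smul_zero]
      exact if_congr (by omega) rfl rfl
    have h2 : ⁅boson p s m, neutralTerm p u e N 2⁆ = (m * u s) • neutralTerm p u e (N - m) 1 +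
        (m * (e s * -m)) • neutralTerm p u e (N - m) 0 := by
      simp only [neutralTerm]
      rw [comm_add, comm_smul, comm_smul, boson_comm_quad, boson_comm_current,
        show -(N - m) = -N + m by omega]
      by_cases h : N = m
      · subst h
        rw [if_pos rfl, if_pos (by omega)]
        module
      · rw [if_neg (by omega), if_neg (by omega)]
        module
    funext θ
    rcases θ with h | i
    · simp only [X, Sum.elim_inl]
      rw [comm_smul, boson_comm_normalExp p _ s hm, smul_smul]
    · fin_cases i
      · simp [X, h0, comm_smul]
      · simp [X, h0, h1, comm_smul, comm_add, smul_smul]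
      · simp only [X, Sum.elim_inr]
        simp [h0, h1, h2, comm_smul, comm_add, smul_smul]
        module
  · rintro _ ⟨r, r0, r1, r2, N, hr, rfl⟩ c c'
    have hv : ∀ h, normalExp p (E h) N (ket (c, 0)) (c', 0) =
        if c' = c ∧ N = 0 then Complex.exp (currentValue p u c * h) else 0 := fun h => by
      rw [normalExp_vac, hE.charge_eq, hE.zero_eq]
      refine if_congr ?_ rfl rfl
      omega
    have h0 : neutralTerm p u e N 0 (ket (c, 0)) (c', 0) = if c' = c ∧ N = 0 then 1 else 0 := by
      simp only [neutralTerm]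
      have := ite_smul_one_vac (N = 0) 1 c c'
      rwa [one_smul] at this
    have h1 : neutralTerm p u e N 1 (ket (c, 0)) (c', 0) =
        if c' = c ∧ N = 0 then currentValue p u c else 0 := by
      simp only [neutralTerm, current_vac, neg_eq_zero]
    have h2 : neutralTerm p u e N 2 (ket (c, 0)) (c', 0) =
        if c' = c ∧ N = 0 then currentValue p u c ^ 2 / 2 else 0 := by
      simp only [neutralTerm, LinearMap.add_apply, LinearMap.smul_apply, Finsupp.add_apply,
        Finsupp.smul_apply, quad_vac, current_vac, neg_eq_zero, smul_eq_mul]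
      split_ifs with h
      · rw [h.2, Int.cast_zero]; ring
      · ring
    change Jet (fun h => r h * normalExp p (E h) N (ket (c, 0)) (c', 0))
      (r0 * neutralTerm p u e N 0 (ket (c, 0)) (c', 0))
      (r0 * neutralTerm p u e N 1 (ket (c, 0)) (c', 0) +
        r1 * neutralTerm p u e N 0 (ket (c, 0)) (c', 0))
      (r0 * neutralTerm p u e N 2 (ket (c, 0)) (c', 0) +
        r1 * neutralTerm p u e N 1 (ket (c, 0)) (c', 0) +
        r2 * neutralTerm p u e N 0 (ket (c, 0)) (c', 0))
    simp only [hv, h0, h1, h2]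
    by_cases h : c' = c ∧ N = 0
    · simp only [if_pos h]
      exact Jet.congr (hr.mul (Jet.exp (currentValue p u c))) (fun _ => rfl) (by ring) (by ring)
        (by ring)
    · simp only [if_neg h]
      exact Jet.congr (Jet.const 0) (fun _ => by ring) (by ring) (by ring) (by ring)

/-! ### Analytic dependence of a normally ordered exponential -/

/-- The same reduction to vacua, now with the subspace of functions analytic at 0 and analytic
scalar prefactors. -/
theorem analyticAt_normalExp {p : ℂ} {E : ℂ → Exponent} {k : ℤ}
    (hc : ∀ s n, n ≠ 0 → AnalyticAt ℂ (fun h => (E h).coeff s n) 0)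
    (hk : ∀ h, (E h).charge = k)
    (hz : ∀ c : ℤ, AnalyticAt ℂ (fun h => (E h).scale ^ c * Complex.exp ((E h).tilde * p)) 0)
    (N : ℤ) (b b' : FockIndex) : AnalyticAt ℂ (fun h => normalExp p (E h) N (ket b) b') 0 := by
  let I : Submodule ℂ (ℂ → ℂ) :=
    { carrier := {F | AnalyticAt ℂ F 0}
      add_mem' := fun h h' => h.add h'
      zero_mem' := analyticAt_const
      smul_mem' := fun k _ h => analyticAt_const.mul h }
  have h := matrix_mem_of_vac p I
    {Y | ∃ (r : ℂ → ℂ) (N : ℤ), AnalyticAt ℂ r 0 ∧ Y = fun h => r h • normalExp p (E h) N}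
    ?_ ?_ (fun h => (1 : ℂ) • normalExp p (E h) N) ⟨_, _, analyticAt_const, rfl⟩ b b'
  · simp only [one_smul] at h
    exact h
  · rintro _ ⟨r, N, hr, rfl⟩ s m hm
    refine ⟨fun h => r h * (m * (E h).coeff s (-m)), N - m,
      hr.mul (analyticAt_const.mul (hc s (-m) (neg_ne_zero.2 hm))), ?_⟩
    funext h
    rw [comm_smul, boson_comm_normalExp p _ s hm, smul_smul]
  · rintro _ ⟨r, N, hr, rfl⟩ c c'
    change AnalyticAt ℂ (fun h => r h * normalExp p (E h) N (ket (c, 0)) (c', 0)) 0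
    simp only [normalExp_vac, hk]
    split_ifs
    · exact hr.mul (hz c)
    · exact hr.mul analyticAt_const

/-! ### The mixed terms of charge `±2` -/

theorem Exponent.ext' {E F : Exponent} (h1 : E.coeff = F.coeff) (h2 : E.charge = F.charge)
    (h3 : E.scale = F.scale) (h4 : E.tilde = F.tilde) : E = F := by
  cases E; cases F; simp_all

theorem bCoeff_zero (β rβ : ℂ) (ε : ℤ) (s : Bool) (n : ℤ) :
    bCoeff β rβ 0 ε s n = if s then 0 else (ε : ℂ) := by
  cases s <;> simp [bCoeff, q1, q2, q3]
  norm_num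

theorem expPM_zero (β rβ : ℂ) : expPM β rβ 0 1 = phiExponent 2 := by
  refine Exponent.ext' ?_ ?_ ?_ ?_
  · funext s n
    simp only [expPM, Exponent.add, lambdaPlus, lambdaMinus, bCoeff_zero, qq, phiExponent]
    cases s <;> simp
    ring
  · simp [expPM, Exponent.add, lambdaPlus, lambdaMinus, phiExponent]
  · simp [expPM, Exponent.add, lambdaPlus, lambdaMinus, phiExponent, qq]
  · simp [expPM, Exponent.add, lambdaPlus, lambdaMinus, phiExponent]

theorem expMP_zero (β rβ : ℂ) : expMP β rβ 0 1 = phiExponent (-2) := by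
  refine Exponent.ext' ?_ ?_ ?_ ?_
  · funext s n
    simp only [expMP, Exponent.add, lambdaPlus, lambdaMinus, bCoeff_zero, qq, phiExponent]
    cases s <;> simp
    ring
  · simp [expMP, Exponent.add, lambdaPlus, lambdaMinus, phiExponent]
  · simp [expMP, Exponent.add, lambdaPlus, lambdaMinus, phiExponent, qq]
  · simp [expMP, Exponent.add, lambdaPlus, lambdaMinus, phiExponent]

theorem jet_bCoeff {β rβ : ℂ} (hβ : β ≠ 0) (hr : rβ ^ 2 = β) (ε : ℤ) (s : Bool) {n : ℤ}
    (hn : n ≠ 0) : AnalyticAt ℂ (fun h => bCoeff β rβ h ε s n) 0 := by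
  cases s
  · exact (jet_bCoeff_false β rβ ε n).choose_spec.1
  · exact (jet_bCoeff_true hβ hr ε hn).1

theorem analyticAt_expPM {β rβ : ℂ} (hβ : β ≠ 0) (hr : rβ ^ 2 = β) (p x : ℂ) (N : ℤ)
    (b b' : FockIndex) : AnalyticAt ℂ
      (fun h => normalExp p (expPM β rβ h (Complex.exp (x * h))) N (ket b) b') 0 := by
  refine analyticAt_normalExp (k := 2) (fun s n hn => ?_) (fun h => rfl) (fun c => ?_) N b b'
  · have h1 := jet_bCoeff hβ hr 1 s hn
    have h2 := jet_bCoeff hβ hr (-1) s hn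
    simp only [expPM, Exponent.add, lambdaPlus, lambdaMinus, qq_zpow, exp_zpow, one_zpow]
    fun_prop
  -- In the mixed term the `ã_0` factors and the powers of `q` cancel, leaving `ξ^c` as the
  -- zero-mode factor.
  · have e : (fun h => (expPM β rβ h (Complex.exp (x * h))).scale ^ c *
        Complex.exp ((expPM β rβ h (Complex.exp (x * h))).tilde * p)) =
        fun h => Complex.exp (c * x * h) := by
      funext h
      have hq : qq β h ≠ 0 := Complex.exp_ne_zero _
      simp only [expPM, Exponent.add, lambdaPlus, lambdaMinus]
      rw [add_neg_cancel, zero_mul, Complex.exp_zero, mul_one, ← exp_zpow]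
      congr 1
      simp only [neg_neg, zpow_one]
      field_simp
    rw [e]
    fun_prop

theorem analyticAt_expMP {β rβ : ℂ} (hβ : β ≠ 0) (hr : rβ ^ 2 = β) (p x : ℂ) (N : ℤ)
    (b b' : FockIndex) : AnalyticAt ℂ
      (fun h => normalExp p (expMP β rβ h (Complex.exp (x * h))) N (ket b) b') 0 := by
  refine analyticAt_normalExp (k := -2) (fun s n hn => ?_) (fun h => rfl) (fun c => ?_) N b b'
  · have h1 := jet_bCoeff hβ hr 1 s hn
    have h2 := jet_bCoeff hβ hr (-1) s hn
    simp only [expMP, Exponent.add, lambdaPlus, lambdaMinus, qq_zpow, exp_zpow, one_zpow]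
    fun_prop
  · have e : (fun h => (expMP β rβ h (Complex.exp (x * h))).scale ^ c *
        Complex.exp ((expMP β rβ h (Complex.exp (x * h))).tilde * p)) =
        fun h => Complex.exp (-c * x * h) := by
      funext h
      have hq : qq β h ≠ 0 := Complex.exp_ne_zero _
      have hx : Complex.exp (x * h) ≠ 0 := Complex.exp_ne_zero _
      simp only [expMP, Exponent.add, lambdaPlus, lambdaMinus]
      have := exp_zpow x h (-c)
      push_cast at this
      rw [neg_add_cancel, zero_mul, Complex.exp_zero, mul_one, ← this,
        zpow_neg (Complex.exp (x * h)) c, ← inv_zpow]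
      congr 1
      simp only [zpow_neg, zpow_one]
      field_simp
    rw [e]
    fun_prop

/-! ### The expansion of the deformed current -/

/-- The second-order coefficients of the exponent of `:Λ⁺_1(ξz) Λ⁺_2(z):`. -/
def vecPP (β rβ x : ℂ) : Bool → ℂ := fun s => if s then rβ * (β - x) / 2 else x * (β - 1 - x) / 2

/-- The second-order coefficients of the exponent of `:Λ⁻_1(ξz) Λ⁻_2(z):`. -/
def vecMM (β rβ x : ℂ) : Bool → ℂ :=
  fun s => if s then rβ * (β - 2 + x) / 2 else x * (β - 1 + x) / 2

theorem neutralFamily_expPP {β rβ : ℂ} (hβ : β ≠ 0) (hr : rβ ^ 2 = β) (p x : ℂ) :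
    NeutralFamily p (fun h => expPP β rβ h (Complex.exp (x * h))) (mixedVec rβ x)
      (vecPP β rβ x) where
  coeff_jet s n hn := by
    cases s
    · exact jet_expPP_false β rβ x hn
    · exact jet_expPP_true hβ hr x hn
  charge_eq h := rfl
  zero_eq h c := by
    have hq : qq β h ≠ 0 := Complex.exp_ne_zero _
    have e : (expPP β rβ h (Complex.exp (x * h))).scale = Complex.exp (x * h) := by
      simp only [expPP, Exponent.add, lambdaPlus, zpow_neg, zpow_one]
      field_simp
    rw [e, exp_zpow, ← Complex.exp_add]
    congr 1
    simp only [expPP, Exponent.add, lambdaPlus, currentValue, mixedVec, if_true,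
      Bool.false_eq_true, if_false]
    ring

theorem neutralFamily_expMM {β rβ : ℂ} (hβ : β ≠ 0) (hr : rβ ^ 2 = β) (p x : ℂ) :
    NeutralFamily p (fun h => expMM β rβ h (Complex.exp (x * h))) (fun s => -mixedVec rβ x s)
      (vecMM β rβ x) where
  coeff_jet s n hn := by
    cases s
    · exact jet_expMM_false β rβ x hn
    · exact jet_expMM_true hβ hr x hn
  charge_eq h := rfl
  zero_eq h c := by
    have hq : qq β h ≠ 0 := Complex.exp_ne_zero _
    have hx : Complex.exp (x * h) ≠ 0 := Complex.exp_ne_zero _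
    have e : (expMM β rβ h (Complex.exp (x * h))).scale = (Complex.exp (x * h))⁻¹ := by
      simp only [expMM, Exponent.add, lambdaMinus, zpow_neg, zpow_one, neg_neg]
      field_simp
    have e' := exp_zpow x h (-c)
    push_cast at e'
    rw [e, inv_zpow, ← zpow_neg, e', ← Complex.exp_add]
    congr 1
    simp only [expMM, Exponent.add, lambdaMinus, currentValue, mixedVec, if_true,
      Bool.false_eq_true, if_false]
    ring

theorem current_neg (p : ℂ) (u : Bool → ℂ) (n : ℤ) :
    current p (fun s => -u s) n = -current p u n := by
  simp only [current]
  module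

theorem quad_neg (p : ℂ) (u : Bool → ℂ) (n : ℤ) : quad p (fun s => -u s) n = quad p u n := by
  simp only [quad]
  module

/-- With `ξ = e^{xħ}` each of the two brackets vanishes to first order, with slopes `-(1 + x)` and
`-(x - β)`. -/
theorem jet_prefactor_PM (β x : ℂ) :
    Jet (fun h => qq β h * (1 - q1 h * Complex.exp (x * h)) * (1 - q3 β h * Complex.exp (x * h)))
      0 0 ((1 + x) * (x - β)) := by
  refine Jet.congr (((Jet.exp ((β - 1) / 2)).mul ((Jet.const 1).sub (Jet.exp (1 + x)))).mul
    ((Jet.const 1).sub (Jet.exp (x - β)))) (fun z => ?_) ?_ ?_ ?_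
  · rw [qq, q1, q3, ← Complex.exp_add, ← Complex.exp_add, show z + x * z = (1 + x) * z by ring,
      show -(β * z) + x * z = (x - β) * z by ring, show (β - 1) * z / 2 = (β - 1) / 2 * z by ring]
  all_goals ring

theorem jet_prefactor_MP (β x : ℂ) :
    Jet (fun h => (qq β h)⁻¹ * (1 - (q1 h)⁻¹ * Complex.exp (x * h)) *
      (1 - (q3 β h)⁻¹ * Complex.exp (x * h))) 0 0 ((x - 1) * (x + β)) := by
  refine Jet.congr (((Jet.exp (-((β - 1) / 2))).mul ((Jet.const 1).sub (Jet.exp (x - 1)))).mul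
    ((Jet.const 1).sub (Jet.exp (x + β)))) (fun z => ?_) ?_ ?_ ?_
  · rw [qq, q1, q3, ← Complex.exp_neg, ← Complex.exp_neg, ← Complex.exp_neg, ← Complex.exp_add,
      ← Complex.exp_add, show -z + x * z = (x - 1) * z by ring,
      show -(-(β * z)) + x * z = (x + β) * z by ring,
      show -((β - 1) * z / 2) = -((β - 1) / 2) * z by ring]
  all_goals ring

/-- The coefficient of `ħ²` in the deformed current. -/
theorem expansion_second {β rβ : ℂ} (hβ : β ≠ 0) (hr : rβ ^ 2 = β) (p x : ℂ) (n : ℤ) :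
    ((2 * β) • zSq (sfT β rβ p x) + ((β - 1) ^ 2 / 4) • oneField) n =
      quad p (mixedVec rβ x) (-n) + ((1 - β) * ((n : ℂ) - 1)) • current p (mixedVec rβ x) (-n) +
      ((1 + x) * (x - β)) • vertexOp p 2 (n - 2) +
      ((x - 1) * (x + β)) • vertexOp p (-2) (n - 2) +
      ((β - 1) ^ 2 / 4) • (if n = 0 then 1 else 0) := by
  have h : ((2 * β) • zSq (sfT β rβ p x) + ((β - 1) ^ 2 / 4) • oneField) n =
      (2 * β) • virMode (sfT β rβ p x) (-n) + ((β - 1) ^ 2 / 4) • (if n = 0 then 1 else 0) := by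
    rw [virMode, neg_neg]; rfl
  rw [h, virMode_sfT hβ hr, sugawara, neg_neg]
  push_cast
  module

theorem jet_calT_ket {β rβ : ℂ} (hβ : β ≠ 0) (hr : rβ ^ 2 = β) (p x : ℂ) (n : ℤ)
    (b b' : FockIndex) : Jet (fun h => calT β rβ p h (Complex.exp (x * h)) n (ket b) b')
      (((2 : ℂ) • oneField) n (ket b) b') 0
      (((2 * β) • zSq (sfT β rβ p x) + ((β - 1) ^ 2 / 4) • oneField) n (ket b) b') := by
  have h1 := (Jet.exp ((β - 1) / 2)).mul (jet_normalExp (neutralFamily_expPP hβ hr p x) n b b')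
  have h2 := (Jet.exp (-((β - 1) / 2))).mul (jet_normalExp (neutralFamily_expMM hβ hr p x) n b b')
  have h3 := (jet_prefactor_PM β x).order_two_mul (analyticAt_expPM hβ hr p x (n - 2) b b')
  have h4 := (jet_prefactor_MP β x).order_two_mul (analyticAt_expMP hβ hr p x (n - 2) b b')
  rw [mul_zero, Complex.exp_zero, expPM_zero] at h3
  rw [mul_zero, Complex.exp_zero, expMP_zero] at h4
  rw [expansion_second hβ hr]
  have e0 : ((2 : ℂ) • oneField) n = (2 : ℂ) • (if n = 0 then 1 else 0) := rfl
  rw [e0]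
  refine Jet.congr (((h1.add h2).add h3).add h4) (fun z => ?_) ?_ ?_ ?_
  · have e1 : Complex.exp ((β - 1) / 2 * z) = qq β z := by rw [qq]; congr 1; ring
    have e2 : Complex.exp (-((β - 1) / 2) * z) = (qq β z)⁻¹ := by
      rw [qq, ← Complex.exp_neg]; congr 1; ring
    rw [e1, e2]
    rfl
  · simp only [neutralTerm, LinearMap.smul_apply, Finsupp.smul_apply, smul_eq_mul]
    ring
  · simp only [neutralTerm, current_neg, LinearMap.neg_apply, Finsupp.neg_apply]
    ring
  -- The two squares add up to `quad`. The cross terms with `q^{±1}` give `(β - 1)` times the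
  -- current, and the sum of `vecPP` and `vecMM` is `(β - 1)` times `mixedVec`; together they form
  -- the derivative term. The constant `(β - 1)²/4` is twice the second coefficient of `q^{±1}`.
  · simp only [neutralTerm, quad_neg]
    generalize quad p (mixedVec rβ x) (-n) = Q
    simp only [current, vecPP, vecMM, mixedVec, LinearMap.add_apply, Finsupp.add_apply,
      LinearMap.smul_apply, Finsupp.smul_apply, smul_eq_mul, if_true, Bool.false_eq_true, if_false,
      vertexOp]
    ring

theorem jet_calT {β rβ : ℂ} (hβ : β ≠ 0) (hr : rβ ^ 2 = β) (p x : ℂ) (n : ℤ) (v : Fock)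
    (b : FockIndex) : Jet (fun h => calT β rβ p h (Complex.exp (x * h)) n v b)
      (((2 : ℂ) • oneField) n v b) 0
      (((2 * β) • zSq (sfT β rβ p x) + ((β - 1) ^ 2 / 4) • oneField) n v b) := by
  have key : ∀ X : Module.End ℂ Fock, X v b = ∑ c ∈ v.support, v c * X (ket c) b := fun X => by
    conv_lhs => rw [ket_span v]
    simp [Finsupp.sum, Finsupp.finsetSum_apply]
  simp only [key]
  exact Jet.congr (Jet.sum v.support fun c _ => (jet_calT_ket hβ hr p x n c b).smul (v c))
    (fun _ => rfl) rfl (by simp) rfl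

end QSVir
end

theorem mainTheorem9 (β rβ p : ℂ) (hβ : β ≠ 0) (hr : rβ ^ 2 = β) :
    -- all infinite sums of operators that occur are finite on every vector
    ((∀ E : QSVir.Exponent, QSVir.NormalExpExists p E) ∧
      (∀ n : ℤ, QSVir.LocallyFiniteSum (QSVir.bosonTerm p n)) ∧
      (∀ n : ℤ, QSVir.LocallyFiniteSum (QSVir.fermiTerm (QSVir.psi p) n)) ∧
      (∀ n : ℤ, QSVir.LocallyFiniteSum (QSVir.fermiTerm (QSVir.psit p) n)) ∧
      QSVir.MulExists (QSVir.dphi p true) (QSVir.psi p) ∧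
      QSVir.MulExists (QSVir.psit p) (QSVir.currentG β rβ p)) ∧
    -- the expansion of the current, coefficient by coefficient
    (∀ (x : ℂ) (n : ℤ) (v : QSVir.Fock) (b : QSVir.FockIndex),
      AnalyticAt ℂ (fun h : ℂ => QSVir.calT β rβ p h (Complex.exp (x * h)) n v b) 0 ∧
      (fun h : ℂ => QSVir.calT β rβ p h (Complex.exp (x * h)) n v b
          - ((2 : ℂ) • QSVir.oneField
              + h ^ 2 • ((2 * β) • QSVir.zSq (QSVir.sfT β rβ p x)
                  + ((β - 1) ^ 2 / 4) • QSVir.oneField)) n v b)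
        =O[nhds 0] (fun h : ℂ => h ^ 3)) ∧
    -- the free fermion and super Virasoro algebras
    (QSVir.IsFreeFermion (QSVir.fermiMode (QSVir.psit p)) ∧
      QSVir.IsSuperVirasoro (3 / 2 - 12 * QSVir.sigma β rβ ^ 2)
        (QSVir.virMode (QSVir.currentT β rβ p)) (QSVir.superMode (QSVir.currentG β rβ p)) ∧
      (∀ r n : ℤ, Commute (QSVir.fermiMode (QSVir.psit p) r)
        (QSVir.virMode (QSVir.currentT β rβ p) n)) ∧
      (∀ r t : ℤ, QSVir.fermiMode (QSVir.psit p) r * QSVir.superMode (QSVir.currentG β rβ p) t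
        + QSVir.superMode (QSVir.currentG β rβ p) t * QSVir.fermiMode (QSVir.psit p) r = 0)) ∧
    -- the two commuting Virasoro algebras
    (∀ ε : ℂ, ε = 1 ∨ ε = -1 →
      (∀ n m : ℤ, Commute (QSVir.virMode (QSVir.sfT β rβ p ε) n)
        (QSVir.virMode (QSVir.sfT β rβ p (-ε * β)) m)) ∧
      (β ≠ -1 →
        QSVir.IsVirasoro ((2 - β) * (3 * β - 1) / (1 + β))
          (fun n => (β / (1 + β)) • QSVir.virMode (QSVir.sfT β rβ p ε) n) ∧
        QSVir.IsVirasoro ((2 * β - 1) * (3 - β) / (β * (1 + β)))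
          (fun n => (1 / (1 + β)) • QSVir.virMode (QSVir.sfT β rβ p (-ε * β)) n))) := by
  refine ⟨⟨QSVir.normalExpExists p, QSVir.bosonTerm_locallyFinite p,
    fun n v => (QSVir.fermiTerm_psi_hasSum p n v).1,
    fun n v => (QSVir.fermiTerm_psit_hasSum p n v).1, QSVir.dphi_psi_mulExists p,
    QSVir.psit_currentG_mulExists β rβ p⟩, fun x n v b => ?_, ⟨QSVir.isFreeFermion_psit p,
    QSVir.isSuperVirasoro β rβ p,
    fun r n => QSVir.mul_eq_of_comm_eq_zero (QSVir.psit_comm_virMode β rβ p _ n),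
    fun r t => QSVir.psit_anticomm_superMode β rβ p _ t⟩,
    fun ε hε => ⟨QSVir.sfT_commute hβ hr p hε, QSVir.sfT_isVirasoro hβ hr p hε⟩⟩
  have h := QSVir.jet_calT hβ hr p x n v b
  refine ⟨h.1, h.2.congr_left fun z => ?_⟩
  simp only [Pi.add_apply, Pi.smul_apply, LinearMap.add_apply, LinearMap.smul_apply,
    Finsupp.add_apply, Finsupp.smul_apply, smul_eq_mul]
  ring
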